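/- **Setting.** Let $\overline{\mathbb R}=[-\infty,\infty]$ and let $\mathbb R^2_{\rm c}=(\overline{\mathbb R}\times\mathbb R)\cup\{(*,-\infty),(*,\infty)\}$ be compactified space-time, with a metric that induces the product topology on $\overline{\mathbb R}\times\mathbb R$ and for which $(x_n,t_n)\to(*,\pm\infty)$ iff $t_n\to\pm\infty$. A *càdlàg path* $f$ on a closed interval $I(f)=[\sigma_f,\tau_f]\subseteq\overline{\mathbb R}$ assigns to each real $t\in I(f)$ values $f(t-),f(t+)\in\overline{\mathbb R}$ such that $t\mapsto f(t+)$ is right-continuous at real $t\in[\sigma_f,\tau_f)$ and has left limit $f(t-)$ at real $t\in(\sigma_f,\tau_f]$ (so $f(\sigma_f-)$ and $f(\tau_f+)$ are unrestricted); at times $\pm\infty\in I(f)$ its value is $*$. Its *interpolated graph* $H(f)\subseteq\mathbb R^2_{\rm c}$ is the set of $(x,t)$ with $t\in I(f)\cap\mathbb R$ and $x$ between $f(t-)$ and $f(t+)$, together with $(*,\pm\infty)$ when $\pm\infty\in I(f)$. It is totally ordered by $\sqsubseteq$: first by time, and at equal times from $f(t-)$ towards $f(t+)$. Put $H^{(2)}(f)=\{(z_1,z_2)\in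 H(f)^2: z_1\sqsubseteq z_2\}$. The space $\Pi$ of càdlàg paths has the M1 metric, the Hausdorff distance of the sets $H^{(2)}(f)$, and the space $\mathcal K(\Pi)$ of nonempty compact subsets of $\Pi$ has the Hausdorff metric and its Borel $\sigma$-field. Let $\Pi^\uparrow=\{f:\tau_f=\infty\}$ and $\Pi^\updownarrow=\{f:\sigma_f=-\infty,\tau_f=\infty\}$. Write $f\subseteq g$ ($g$ *extends* $f$) if $H^{(2)}(f)\subseteq H^{(2)}(g)$. For $A\subseteq\Pi^\uparrow$ let $A_\uparrow=\{g\in\Pi^\uparrow: g\subseteq f\text{ for some }f\in A\}$, and write $A\preceq B$ if $A_\uparrow\cap B\subseteq A\subseteq B_\uparrow$. Paths $f,g$ are *non-crossing* if they have extensions $f',g'\in\Pi^\updownarrow$ with $f'(t\pm)\le g'(t\pm)$ for all $t\in\mathbb R$, or with $g'(t\pm)\le f'(t\pm)$ for all $t\in\mathbb R$. A set of paths is non-crossing if all pairs of its elements are, and $f$ does not cross $A$ if it is non-crossing with each element of $A$. Let $A(z)=\{f\in A: z\in H(f)\}$; $A$ is *pervasive* if $A(z)\ne\emptyset$ for all $z\in\mathbb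 R^2_{\rm c}$. A point $z$ is *non-ramified* in $A$ if $f\subseteq g$ or $g\subseteq f$ for all $f,g\in A(z)$; a set of points is non-ramified if all its points are. A *weave* is the law of a random element $\mathcal A$ of $\mathcal K(\Pi)$ that is almost surely a subset of $\Pi^\uparrow$, non-crossing and pervasive; a *deterministic weave* is an element of $\mathcal K(\Pi)$ with these properties. For laws, $\mathcal A\preceq_{\rm d}\mathcal B$ means that some coupling has $\mathbb P[\mathcal A\preceq\mathcal B]=1$. A *web* is a $\preceq_{\rm d}$-minimal weave and a *flow* is a $\preceq_{\rm d}$-maximal weave. For a deterministic weave $A$ let $\mathrm{flow}(A)$ be the set of $f\in\Pi^\updownarrow$ that do not cross $A$, and for a dense non-ramified $D\subseteq\mathbb R^2$ let $\mathrm{web}_D(A)=\overline{(A|_D)_\uparrow}$, where $A|_D$ is the set of $g\in\Pi^\uparrow$ that start at a point $z\in D$ (that is, $(g(\sigma_g-),\sigma_g)=z$) and are extended by some $f\in A(z)$. **Theorem.** For a deterministic weave $A$ the non-ramified points in $\mathbb R^2$ are dense, the set $\mathrm{web}(A):=\mathrm{web}_D(A)$ does not depend on the dense non-ramified $D\subseteq\mathbb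 R^2$, and $\mathrm{web}(A)$ and $\mathrm{flow}(A)$ are deterministic weaves. Let $\mathcal A$ be a weave. Then $\mathrm{web}(\mathcal A)$ and $\mathrm{flow}(\mathcal A)$ are random variables in $\mathcal K(\Pi)$ (measurable up to null sets), and: 1. $\mathcal A$ is a web if and only if $\mathcal A=\mathrm{web}(\mathcal A)$ almost surely. 2. The following are equivalent: (a) $\mathcal A$ is a flow; (b) $\mathcal A=\mathrm{flow}(\mathcal A)$ almost surely; (c) $\mathcal A\subseteq\Pi^\updownarrow$ almost surely. 3. Almost surely $\mathrm{web}(\mathcal A)\preceq\mathcal A\preceq\mathrm{flow}(\mathcal A)$. 4. There are a unique (in law) web $\mathcal W$ and a unique (in law) flow $\mathcal F$ with $\mathcal W\preceq_{\rm d}\mathcal A\preceq_{\rm d}\mathcal F$, and they are the laws of $\mathrm{web}(\mathcal A)$ and $\mathrm{flow}(\mathcal A)$. Consequently, for weaves $\mathcal A,\mathcal B$ one has $\mathrm{web}(\mathcal A)\overset{\rm d}{=}\mathrm{web}(\mathcal B)$ if and only if $\mathrm{flow}(\mathcal A)\overset{\rm d}{=}\mathrm{flow}(\mathcal B)$, and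 each class of the resulting equivalence relation on weaves contains exactly one web, which is the $\preceq_{\rm d}$-minimum of the class, and exactly one flow, which is its $\preceq_{\rm d}$-maximum. -/

import Mathlib

open Set Filter Topology MeasureTheory TopologicalSpace

noncomputable section

/-! ### Compactified space-time -/

/-- Compactified space-time `(ℝ̄ × ℝ) ∪ {(*, -∞), (*, ∞)}`: `pt x t` is the point with spatial
coordinate `x` and time coordinate `t`, `bot` is `(*, -∞)` and `top` is `(*, ∞)`. -/
inductive SpaceTime : Type
  | pt (x : EReal) (t : ℝ) : SpaceTime
  | bot : SpaceTime
  | top : SpaceTime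

/-- An increasing homeomorphism from `[-∞, ∞]` onto `[-1, 1]`. -/
def squash (x : EReal) : ℝ :=
  if x = ⊥ then -1 else if x = ⊤ then 1 else x.toReal / (1 + |x.toReal|)

theorem abs_squash_coe_lt (a : ℝ) : |squash (a : EReal)| < 1 := by
  have key : squash (a : EReal) = a / (1 + |a|) := by simp [squash]
  rw [key, abs_div, abs_of_pos (by positivity : (0 : ℝ) < 1 + |a|), div_lt_one (by positivity)]
  linarith

theorem squash_injective : Function.Injective squash := by
  have key : ∀ a : ℝ, squash (a : EReal) = a / (1 + |a|) := fun a => by simp [squash]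
  have hb : squash ⊥ = -1 := by simp [squash]
  have ht : squash ⊤ = 1 := by simp [squash]
  intro x y h
  induction x <;> induction y
  all_goals try rfl
  case coe.coe a b =>
    rw [key, key, div_eq_div_iff (by positivity) (by positivity)] at h
    congr 1
    rcases abs_cases a with ⟨ha, ha'⟩ | ⟨ha, ha'⟩ <;> rcases abs_cases b with ⟨hb, hb'⟩ | ⟨hb, hb'⟩ <;>
      rw [ha, hb] at h <;> nlinarith
  all_goals exfalso
  all_goals first
    | (rename_i a; have := abs_lt.1 (abs_squash_coe_lt a); simp only [hb, ht] at h; linarith [this.1, this.2])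
    | (simp only [hb, ht] at h; norm_num at h)

namespace SpaceTime

/-- The embedding of compactified space-time into the plane as the compact set
`{(u, v) : |u| + |v| ≤ 1}`; each of the two points at infinite time is a corner of that set. -/
def embed : SpaceTime → ℝ × ℝ
  | pt x t => (squash t, (1 - |squash t|) * squash x)
  | bot => (-1, 0)
  | top => (1, 0)

theorem embed_injective : Function.Injective embed := by
  intro z w h
  rcases z with ⟨x, t⟩ | _ | _ <;> rcases w with ⟨y, s⟩ | _ | _ <;>
    simp only [embed, Prod.mk.injEq] at h
  · have hts : t = s := EReal.coe_injective (squash_injective h.1)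
    subst hts
    have hne : (1 - |squash (t : EReal)|) ≠ 0 := by linarith [abs_squash_coe_lt t]
    rw [squash_injective (mul_left_cancel₀ hne h.2)]
  all_goals first
    | rfl
    | (have ht := abs_lt.1 (abs_squash_coe_lt t); linarith [ht.1, ht.2, h.1])
    | (have hs := abs_lt.1 (abs_squash_coe_lt s); linarith [hs.1, hs.2, h.1])
    | (exfalso; linarith [h.1])

/-- Compactified space-time carries the metric of its planar image. It induces the product topology
on `ℝ̄ × ℝ`, and `(xₙ, tₙ) → (*, ±∞)` if and only if `tₙ → ±∞`. As the space is compact, these two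
properties determine the topology, and the topologies of the Hausdorff metrics built on it. -/
instance : MetricSpace SpaceTime := MetricSpace.induced embed embed_injective inferInstance

end SpaceTime

/-! ### Càdlàg paths and the M1 topology -/

/-- A càdlàg path on a closed interval `[σ, τ]` of the extended real line, with `left t = f(t-)` and
`right t = f(t+)` at the real times `t` of the interval. The values `f(σ-)` and `f(τ+)` are not
restricted by the other values, so that jumps at the initial and the final time are allowed. There
are no values at the times `±∞`. Outside the interval both functions take the dummy value `0`, so
that equality of paths means: same interval and same values at all real times of it. -/
@[ext]
structure CadlagPath where
  /-- the initial time -/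
  σ : EReal
  /-- the final time -/
  τ : EReal
  /-- the values `f(t-)` -/
  left : ℝ → EReal
  /-- the values `f(t+)` -/
  right : ℝ → EReal
  le : σ ≤ τ
  tendsto_right : ∀ t : ℝ, σ ≤ (t : EReal) → (t : EReal) < τ →
    Tendsto right (𝓝[>] t) (𝓝 (right t))
  tendsto_left : ∀ t : ℝ, σ < (t : EReal) → (t : EReal) ≤ τ →
    Tendsto right (𝓝[<] t) (𝓝 (left t))
  left_off : ∀ t : ℝ, ¬(σ ≤ (t : EReal) ∧ (t : EReal) ≤ τ) → left t = 0
  right_off : ∀ t : ℝ, ¬(σ ≤ (t : EReal) ∧ (t : EReal) ≤ τ) → right t = 0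

namespace CadlagPath

/-- The interpolated graph `H(f)`. The point `(*, ±∞)` belongs to it when `±∞` is a time of `f`. -/
def graph (f : CadlagPath) : Set SpaceTime :=
  {z | match z with
    | .pt x t => f.σ ≤ (t : EReal) ∧ (t : EReal) ≤ f.τ ∧ x ∈ uIcc (f.left t) (f.right t)
    | .bot => f.σ = ⊥
    | .top => f.τ = ⊤}

/-- The natural order along the interpolated graph of `f`, for two points of that graph: the first
one is earlier, or the times agree and its spatial coordinate is at most as far from `f(t-)`
(both coordinates lie between `f(t-)` and `f(t+)`). -/
def Before (f : CadlagPath) : SpaceTime → SpaceTime → Prop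
  | .bot, _ => True
  | _, .top => True
  | .pt x₁ t₁, .pt x₂ t₂ => t₁ < t₂ ∨ (t₁ = t₂ ∧ x₁ ∈ uIcc (f.left t₁) x₂)
  | .pt _ _, .bot => False
  | .top, _ => False

/-- The second order interpolated graph `H⁽²⁾(f)`. -/
def graph₂ (f : CadlagPath) : Set (SpaceTime × SpaceTime) :=
  {p | p.1 ∈ f.graph ∧ p.2 ∈ f.graph ∧ f.Before p.1 p.2}

/-- The M1 topology: the distance of two paths is the Hausdorff distance of their second order
interpolated graphs. -/
instance : PseudoEMetricSpace CadlagPath where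
  edist f g := Metric.hausdorffEDist f.graph₂ g.graph₂
  edist_self _ := Metric.hausdorffEDist_self
  edist_comm _ _ := Metric.hausdorffEDist_comm
  edist_triangle _ _ _ := Metric.hausdorffEDist_triangle

/-- The initial point `(f(σ-), σ)` of a path. -/
def initialPoint (f : CadlagPath) : SpaceTime :=
  if f.σ = ⊥ then .bot else if f.σ = ⊤ then .top else .pt (f.left f.σ.toReal) f.σ.toReal

/-- `f.ExtendsTo g`, written `f ⊆ g` in words: the path `g` extends the path `f`. -/
def ExtendsTo (f g : CadlagPath) : Prop := f.graph₂ ⊆ g.graph₂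

/-- The paths `f` and `g` are non-crossing: they have bi-infinite extensions one of which lies
(weakly) to the left of the other at all times. -/
def NonCrossing (f g : CadlagPath) : Prop :=
  ∃ f' g' : CadlagPath, f'.σ = ⊥ ∧ f'.τ = ⊤ ∧ g'.σ = ⊥ ∧ g'.τ = ⊤ ∧
    f.ExtendsTo f' ∧ g.ExtendsTo g' ∧
    ((∀ t, f'.left t ≤ g'.left t ∧ f'.right t ≤ g'.right t) ∨
      (∀ t, g'.left t ≤ f'.left t ∧ g'.right t ≤ f'.right t))

end CadlagPath

open CadlagPath

/-! ### Sets of paths -/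

/-- The half-infinite paths `Π^↑`. -/
def halfInfinite : Set CadlagPath := {f | f.τ = ⊤}

/-- The bi-infinite paths `Π^↕`. -/
def biInfinite : Set CadlagPath := {f | f.σ = ⊥ ∧ f.τ = ⊤}

/-- The set `A_↑` of half-infinite paths that are extended by an element of `A`. -/
def downset (A : Set CadlagPath) : Set CadlagPath :=
  {g | g ∈ halfInfinite ∧ ∃ f ∈ A, g.ExtendsTo f}

/-- The order `A ≼ B` on sets of half-infinite paths. -/
def Preceq (A B : Set CadlagPath) : Prop := downset A ∩ B ⊆ A ∧ A ⊆ downset B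

/-- All pairs of elements of `A` are non-crossing. -/
def IsNonCrossing (A : Set CadlagPath) : Prop := ∀ f ∈ A, ∀ g ∈ A, f.NonCrossing g

/-- Every point of compactified space-time is passed by a path of `A`. -/
def IsPervasive (A : Set CadlagPath) : Prop := ∀ z : SpaceTime, ∃ f ∈ A, z ∈ f.graph

/-- The point `z` is non-ramified in `A`: any two paths of `A` through `z` are comparable. -/
def IsNonRamified (A : Set CadlagPath) (z : SpaceTime) : Prop :=
  ∀ f ∈ A, ∀ g ∈ A, z ∈ f.graph → z ∈ g.graph → f.ExtendsTo g ∨ g.ExtendsTo f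

/-- The non-ramified points of `A` in `ℝ²` (pairs of a spatial and a time coordinate). -/
def nonRamified (A : Set CadlagPath) : Set (ℝ × ℝ) :=
  {z | IsNonRamified A (.pt (z.1 : EReal) z.2)}

/-- The set `A|_D` of the restrictions `f|_z`, for `z ∈ D` and `f ∈ A` passing through `z`, where
`f|_z` is the half-infinite path with initial point `z` that is extended by `f`. -/
def restrictTo (A : Set CadlagPath) (D : Set (ℝ × ℝ)) : Set CadlagPath :=
  {g | g ∈ halfInfinite ∧ ∃ z ∈ D, ∃ f ∈ A, SpaceTime.pt (z.1 : EReal) z.2 ∈ f.graph ∧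
    g.ExtendsTo f ∧ g.initialPoint = SpaceTime.pt (z.1 : EReal) z.2}

/-- `web_D(A)`, the closure of `(A|_D)_↑`. -/
def webOn (D : Set (ℝ × ℝ)) (A : Set CadlagPath) : Set CadlagPath :=
  closure (downset (restrictTo A D))

/-- `web(A)`, the set `web_D(A)` for the largest admissible `D`. -/
def web (A : Set CadlagPath) : Set CadlagPath := webOn (nonRamified A) A

/-- `flow(A)`, the bi-infinite paths that do not cross `A`. -/
def flow (A : Set CadlagPath) : Set CadlagPath :=
  {f | f ∈ biInfinite ∧ ∀ g ∈ A, f.NonCrossing g}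

/-! ### Random sets of paths -/

/-- The space `𝒦(Π)` of nonempty compact sets of paths. Its topology in Mathlib, the Vietoris
topology, is that of the Hausdorff metric. -/
abbrev CompactPaths : Type := NonemptyCompacts CadlagPath

instance : MeasurableSpace CompactPaths := borel CompactPaths

instance : BorelSpace CompactPaths := ⟨rfl⟩

/-- The deterministic weaves: non-crossing, pervasive, compact sets of half-infinite paths. -/
def detWeaves : Set CompactPaths :=
  {A | (A : Set CadlagPath) ⊆ halfInfinite ∧ IsNonCrossing (A : Set CadlagPath) ∧
    IsPervasive (A : Set CadlagPath)}

/-- A weave: the law of a random compact set of half-infinite paths that is almost surely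
non-crossing and pervasive. -/
structure IsWeave (μ : Measure CompactPaths) : Prop where
  isProbabilityMeasure : IsProbabilityMeasure μ
  ae_mem : ∀ᵐ A ∂μ, A ∈ detWeaves

/-- The relation `≼_d`: there is a coupling `π` of `μ` and `ν` under which `A ≼ B` almost surely. -/
def PreceqLaw (μ ν : Measure CompactPaths) : Prop :=
  ∃ π : Measure (CompactPaths × CompactPaths), π.map Prod.fst = μ ∧ π.map Prod.snd = ν ∧
    ∀ᵐ p ∂π, Preceq (p.1 : Set CadlagPath) (p.2 : Set CadlagPath)

/-- A web: a weave that is minimal with respect to `≼_d` among all weaves. -/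
def IsWeb (μ : Measure CompactPaths) : Prop :=
  IsWeave μ ∧ ∀ ν, IsWeave ν → PreceqLaw ν μ → ν = μ

/-- A flow: a weave that is maximal with respect to `≼_d` among all weaves. -/
def IsFlow (μ : Measure CompactPaths) : Prop :=
  IsWeave μ ∧ ∀ ν, IsWeave ν → PreceqLaw μ ν → ν = μ

open scoped Classical in
/-- The set `S` as an element of `𝒦(Π)` if it is nonempty and compact, and the dummy value `A`
otherwise. -/
def toCompactPaths (S : Set CadlagPath) (A : CompactPaths) : CompactPaths :=
  if h : IsCompact S ∧ S.Nonempty then ⟨⟨S, h.1⟩, h.2⟩ else A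

/-- The map `A ↦ web(A)` on `𝒦(Π)`. -/
def webMap (A : CompactPaths) : CompactPaths := toCompactPaths (web A) A

/-- The map `A ↦ flow(A)` on `𝒦(Π)`. -/
def flowMap (A : CompactPaths) : CompactPaths := toCompactPaths (flow A) A

/-- The law of `web(𝒜)` when `𝒜` has law `μ`. -/
def webLaw (μ : Measure CompactPaths) : Measure CompactPaths := μ.map webMap

/-- The law of `flow(𝒜)` when `𝒜` has law `μ`. -/
def flowLaw (μ : Measure CompactPaths) : Measure CompactPaths := μ.map flowMap

end

noncomputable section

section

/-! ### The topology of compactified space-time -/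

/-! Two half-infinite paths are non-crossing exactly when one lies weakly to the left of the other
in the pointwise sense `LeftOf` (`nonCrossing_iff`). The recurring contradiction is that
non-crossing paths cannot traverse one spatial interval at one time in opposite directions
(`NonCrossing.not_opposite`). It matches the M1 topology: compactified space-time is compact, so
second order graphs always have limits along ultrafilters, and such a limit is again a path unless
some segment is traversed both ways (`exists_tendsto_of_no_oscillation`).

A bi-infinite path that does not cross a pervasive family forces a member of the family to share
each of its moves (`exists_move_right`). An oscillation in a family of flow paths would thus create
opposite moves in the limiting weave. Hence flows are compact, and limits of elements of the flows
of convergent weaves lie in the flow of the limit (`exists_tendsto_flow`). Each path f of a weave A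
has an extension in flow(A): before its start, follow the right edge of the region occupied by the
paths of A that are not on the right of f; this edge has one-sided limits, again because opposite
moves are impossible (`exists_extension`). Finally flow(A) is non-crossing, since a path of A that
enters the gap between two flow paths keeps them apart from then on.

If every path of A is extended by one of B, then flow(A) = flow(B). By Baire's theorem the
non-ramified points of a flow are dense; they are non-ramified in A too, and there A and flow(A)
have the same restrictions. So web(A) = web(flow(A)), and comparable weaves share both web and flow.
Since web(A) ≼ A ≼ flow(A) and ≼ is antisymmetric, this settles the deterministic side.

For laws, the flow is upper and the web lower semicontinuous, hence both are measurable. A coupling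
of comparable weaves almost surely has equal webs and equal flows in its two components, which gives
minimality, maximality and uniqueness. -/

theorem squash_coe (a : ℝ) : squash (a : EReal) = a / (1 + |a|) := by simp [squash]

theorem squash_mem_Icc (x : EReal) : squash x ∈ Icc (-1 : ℝ) 1 := by
  induction x with
  | bot => simp [squash]
  | top => simp [squash]
  | coe a => exact abs_le.1 (abs_squash_coe_lt a).le

theorem squash_strictMono : StrictMono squash := by
  have hm : Monotone squash := by
    intro x y h
    induction x with
    | bot => simpa [squash] using (squash_mem_Icc y).1
    | top => rw [top_le_iff.1 h]
    | coe a =>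
      induction y with
      | bot => simp at h
      | top => simpa [squash] using (squash_mem_Icc a).2
      | coe b =>
        have hab : a ≤ b := by exact_mod_cast h
        rw [squash_coe, squash_coe, div_le_div_iff₀ (by positivity) (by positivity)]
        rcases abs_cases a with ⟨ha, ha'⟩ | ⟨ha, ha'⟩ <;>
          rcases abs_cases b with ⟨hb, hb'⟩ | ⟨hb, hb'⟩ <;> rw [ha, hb] <;> nlinarith
  exact hm.strictMono_of_injective squash_injective

theorem exists_squash_eq {y : ℝ} (hy : y ∈ Icc (-1 : ℝ) 1) : ∃ x, squash x = y := by
  rcases eq_or_lt_of_le hy.1 with h | h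
  · exact ⟨⊥, by simp [squash, h]⟩
  rcases eq_or_lt_of_le hy.2 with h' | h'
  · exact ⟨⊤, by simp [squash, h']⟩
  have h1 : 0 < 1 - |y| := by linarith [abs_lt.2 ⟨h, h'⟩]
  refine ⟨((y / (1 - |y|) : ℝ) : EReal), ?_⟩
  rw [squash_coe, abs_div, abs_of_pos h1]
  field_simp
  ring

theorem continuous_squash : Continuous squash := by
  let g : EReal → Icc (-1 : ℝ) 1 := fun x => ⟨squash x, squash_mem_Icc x⟩
  have hg : StrictMono g := fun x y h => squash_strictMono h
  have hs : Function.Surjective g := fun y =>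
    let ⟨x, hx⟩ := exists_squash_eq y.2
    ⟨x, Subtype.ext hx⟩
  exact continuous_subtype_val.comp (hg.orderIsoOfSurjective g hs).continuous

theorem isEmbedding_squash : IsEmbedding squash :=
  (continuous_squash.isClosedEmbedding squash_injective).isEmbedding

namespace SpaceTime

/-- The time coordinate of a point of compactified space-time. -/
def time : SpaceTime → EReal
  | pt _ t => t
  | bot => ⊥
  | top => ⊤

/-- The spatial coordinate of a point at a real time, and `0` at infinite times. -/
def space : SpaceTime → EReal
  | pt x _ => x
  | bot => 0
  | top => 0

@[simp] theorem time_pt (x : EReal) (t : ℝ) : (pt x t).time = t := rfl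
@[simp] theorem time_bot : bot.time = ⊥ := rfl
@[simp] theorem time_top : top.time = ⊤ := rfl
@[simp] theorem space_pt (x : EReal) (t : ℝ) : (pt x t).space = x := rfl

theorem eq_pt_of_time {z : SpaceTime} {t : ℝ} (h : z.time = t) : z = pt z.space t := by
  cases z with
  | pt x s => simp only [time_pt, EReal.coe_eq_coe_iff] at h; simp [h]
  | bot => simp at h
  | top => simp at h

theorem eq_top_of_time {z : SpaceTime} (h : z.time = ⊤) : z = top := by
  cases z <;> simp_all

theorem eq_bot_of_time {z : SpaceTime} (h : z.time = ⊥) : z = bot := by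
  cases z <;> simp_all

/-- The factor `1 - |squash z.time|` vanishes at infinite times, so the dummy spatial coordinate
there does no harm and one formula serves all points. -/
theorem embed_eq (z : SpaceTime) :
    z.embed = (squash z.time, (1 - |squash z.time|) * squash z.space) := by
  cases z with
  | pt x t => rfl
  | bot => simp [embed, time, squash]
  | top => simp [embed, time, squash]

theorem tendsto_iff_embed {α : Type*} {l : Filter α} {z : α → SpaceTime} {w : SpaceTime} :
    Tendsto z l (𝓝 w) ↔ Tendsto (fun i => (z i).embed) l (𝓝 w.embed) :=
  (⟨rfl⟩ : IsInducing embed).tendsto_nhds_iff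

theorem continuous_time : Continuous time := by
  refine continuous_iff_continuousAt.2 fun w => isEmbedding_squash.tendsto_nhds_iff.2 ?_
  have h := tendsto_iff_embed.1 (tendsto_id (x := 𝓝 w))
  simp only [embed_eq, id] at h
  exact h.fst_nhds

theorem tendsto_pt {α : Type*} {l : Filter α} {z : α → SpaceTime} {x : EReal} {t : ℝ} :
    Tendsto z l (𝓝 (pt x t)) ↔
      Tendsto (fun i => (z i).time) l (𝓝 (t : EReal)) ∧
      Tendsto (fun i => (z i).space) l (𝓝 x) := by
  have h1 : (1 - |squash (t : EReal)|) ≠ 0 := by linarith [abs_squash_coe_lt t]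
  rw [tendsto_iff_embed]
  simp only [embed_eq]
  constructor
  · intro h
    refine ⟨isEmbedding_squash.tendsto_nhds_iff.2 h.fst_nhds,
      isEmbedding_squash.tendsto_nhds_iff.2 ?_⟩
    have hd : Tendsto (fun i => 1 - |squash (z i).time|) l (𝓝 (1 - |squash (t : EReal)|)) :=
      tendsto_const_nhds.sub h.fst_nhds.abs
    have hq := h.snd_nhds.div hd h1
    simp only [time_pt, space_pt] at hq
    rw [mul_div_cancel_left₀ _ h1] at hq
    refine hq.congr' ?_
    filter_upwards [hd.eventually_ne h1] with i hi
    simp [mul_div_cancel_left₀ _ hi]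
  · rintro ⟨ht, hx⟩
    have ht' := (continuous_squash.tendsto _).comp ht
    have hx' := (continuous_squash.tendsto _).comp hx
    exact ht'.prodMk_nhds ((tendsto_const_nhds.sub ht'.abs).mul hx')

/-- At a corner the factor `1 - |squash time|` tends to 0 while `squash` of the spatial coordinate
stays bounded, so only the times matter. -/
theorem tendsto_of_time {α : Type*} {l : Filter α} {z : α → SpaceTime} {w : SpaceTime}
    (hw : |squash w.time| = 1) (h : Tendsto (fun i => (z i).time) l (𝓝 w.time)) :
    Tendsto z l (𝓝 w) := by
  rw [tendsto_iff_embed]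
  simp only [embed_eq]
  have ht' := (continuous_squash.tendsto _).comp h
  refine ht'.prodMk_nhds ?_
  rw [hw, sub_self, zero_mul]
  have h0 : Tendsto (fun i => 1 - |squash (z i).time|) l (𝓝 0) := by
    have := tendsto_const_nhds (x := (1 : ℝ)).sub ht'.abs
    rwa [hw, sub_self] at this
  refine h0.zero_mul_isBoundedUnder_le (isBoundedUnder_of ⟨1, fun i => ?_⟩)
  exact abs_le.2 (squash_mem_Icc _)

theorem tendsto_top {α : Type*} {l : Filter α} {z : α → SpaceTime} :
    Tendsto z l (𝓝 top) ↔ Tendsto (fun i => (z i).time) l (𝓝 ⊤) :=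
  ⟨fun h => (continuous_time.tendsto _).comp h, fun h => tendsto_of_time (by simp [squash]) h⟩

theorem tendsto_bot {α : Type*} {l : Filter α} {z : α → SpaceTime} :
    Tendsto z l (𝓝 bot) ↔ Tendsto (fun i => (z i).time) l (𝓝 ⊥) :=
  ⟨fun h => (continuous_time.tendsto _).comp h, fun h => tendsto_of_time (by simp [squash]) h⟩

theorem exists_tendsto {α : Type*} (U : Ultrafilter α) (z : α → SpaceTime) :
    ∃ w, Tendsto z U (𝓝 w) := by
  have key : ∀ v : α → EReal, ∃ a, Tendsto v U (𝓝 a) := fun v => by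
    obtain ⟨a, -, ha⟩ := isCompact_univ.ultrafilter_le_nhds (U.map v) (by simp)
    exact ⟨a, ha⟩
  obtain ⟨t, ht⟩ := key fun i => (z i).time
  obtain ⟨x, hx⟩ := key fun i => (z i).space
  induction t with
  | bot => exact ⟨bot, tendsto_bot.2 ht⟩
  | top => exact ⟨top, tendsto_top.2 ht⟩
  | coe t => exact ⟨pt x t, tendsto_pt.2 ⟨ht, hx⟩⟩

instance : CompactSpace SpaceTime :=
  ⟨isCompact_iff_ultrafilter_le_nhds.2 fun U _ =>
    let ⟨w, hw⟩ := exists_tendsto U id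
    ⟨w, mem_univ w, hw⟩⟩

theorem continuous_pt : Continuous fun p : EReal × ℝ => pt p.1 p.2 :=
  continuous_iff_continuousAt.2 fun p => tendsto_pt.2
    ⟨(continuous_coe_real_ereal.comp continuous_snd).tendsto p, continuous_fst.tendsto p⟩

end SpaceTime
end

section

/-! ### Order and closedness of interpolated graphs -/

/-! ### Betweenness in a linear order. -/

section Order
variable {α : Type*} [LinearOrder α] {l r x y z : α}

theorem uIcc_total (hx : x ∈ uIcc l r) (hy : y ∈ uIcc l r) : x ∈ uIcc l y ∨ y ∈ uIcc l x := by
  simp only [mem_uIcc] at *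
  grind

theorem uIcc_antisymm (hx : x ∈ uIcc l y) (hy : y ∈ uIcc l x) : x = y := by
  simp only [mem_uIcc] at *
  grind

theorem uIcc_trans (hx : x ∈ uIcc l y) (hy : y ∈ uIcc l z) : x ∈ uIcc l z := by
  simp only [mem_uIcc] at *
  grind

end Order

/-- If `h s` is a limit of `g` at `s`, along filters `m s` compatible with `l`, then `h` has the same
limit as `g` along `l`. -/
theorem tendsto_of_iterated {X α β : Type*} [TopologicalSpace X] [RegularSpace X]
    {g : β → X} {h : α → X} {l : Filter α} {m : α → Filter β} {l' : Filter β} {a : X}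
    (hl : ∀ P : β → Prop, (∀ᶠ r in l', P r) → ∀ᶠ s in l, ∀ᶠ r in m s, P r)
    (hm : ∀ s, (m s).NeBot)
    (hg : Tendsto g l' (𝓝 a)) (hh : ∀ᶠ s in l, Tendsto g (m s) (𝓝 (h s))) :
    Tendsto h l (𝓝 a) := by
  refine (closed_nhds_basis a).tendsto_right_iff.2 fun W hW => ?_
  filter_upwards [hl _ (hg hW.1), hh] with s hs hs'
  have := hm s
  exact hW.2.mem_of_tendsto hs' hs

theorem eventually_nhdsLT_nhds {t : ℝ} {P : ℝ → Prop} (h : ∀ᶠ r in 𝓝[<] t, P r) :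
    ∀ᶠ s in 𝓝[<] t, ∀ᶠ r in 𝓝 s, P r := by
  filter_upwards [eventually_eventually_nhdsWithin.2 h, self_mem_nhdsWithin] with s hs hst
  rwa [(isOpen_Iio.nhdsWithin_eq hst)] at hs

theorem eventually_nhdsGT_nhds {t : ℝ} {P : ℝ → Prop} (h : ∀ᶠ r in 𝓝[>] t, P r) :
    ∀ᶠ s in 𝓝[>] t, ∀ᶠ r in 𝓝 s, P r := by
  filter_upwards [eventually_eventually_nhdsWithin.2 h, self_mem_nhdsWithin] with s hs hst
  rwa [(isOpen_Ioi.nhdsWithin_eq hst)] at hs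

open SpaceTime

namespace CadlagPath

variable {f g : CadlagPath}

theorem eventually_lt_of_lt {a : EReal} {t : ℝ} (h : a < t) : ∀ᶠ s : ℝ in 𝓝 t, a < (s : EReal) :=
  (continuous_coe_real_ereal.tendsto t).eventually_const_lt h

theorem eventually_gt_of_gt {a : EReal} {t : ℝ} (h : t < a) : ∀ᶠ s : ℝ in 𝓝 t, (s : EReal) < a :=
  (continuous_coe_real_ereal.tendsto t).eventually_lt_const h

theorem left_tendsto_left (f : CadlagPath) {t : ℝ} (h1 : f.σ < t) (h2 : t ≤ f.τ) :
    Tendsto f.left (𝓝[<] t) (𝓝 (f.left t)) := by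
  refine tendsto_of_iterated (m := fun s => 𝓝[<] s) (l' := 𝓝[<] t) (fun P hP => ?_)
    (fun s => inferInstance) (f.tendsto_left t h1 h2) ?_
  · exact (eventually_nhdsLT_nhds hP).mono fun s hs => hs.filter_mono nhdsWithin_le_nhds
  · filter_upwards [self_mem_nhdsWithin, nhdsWithin_le_nhds (eventually_lt_of_lt h1)] with s hs hs'
    exact f.tendsto_left s hs' ((EReal.coe_le_coe_iff.2 (le_of_lt hs)).trans h2)

theorem left_tendsto_right (f : CadlagPath) {t : ℝ} (h1 : f.σ ≤ t) (h2 : t < f.τ) :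
    Tendsto f.left (𝓝[>] t) (𝓝 (f.right t)) := by
  refine tendsto_of_iterated (m := fun s => 𝓝[<] s) (l' := 𝓝[>] t) (fun P hP => ?_)
    (fun s => inferInstance) (f.tendsto_right t h1 h2) ?_
  · exact (eventually_nhdsGT_nhds hP).mono fun s hs => hs.filter_mono nhdsWithin_le_nhds
  · filter_upwards [self_mem_nhdsWithin, nhdsWithin_le_nhds (eventually_gt_of_gt h2)] with s hs hs'
    exact f.tendsto_left s (h1.trans_lt (EReal.coe_lt_coe_iff.2 hs)) hs'.le

@[simp] theorem mem_graph_pt {x : EReal} {t : ℝ} :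
    pt x t ∈ f.graph ↔ f.σ ≤ t ∧ t ≤ f.τ ∧ x ∈ uIcc (f.left t) (f.right t) := Iff.rfl

@[simp] theorem mem_graph_bot : bot ∈ f.graph ↔ f.σ = ⊥ := Iff.rfl

@[simp] theorem mem_graph_top : top ∈ f.graph ↔ f.τ = ⊤ := Iff.rfl

theorem time_mem {z : SpaceTime} (h : z ∈ f.graph) : f.σ ≤ z.time ∧ z.time ≤ f.τ := by
  cases z with
  | pt x t => exact ⟨h.1, h.2.1⟩
  | bot => rw [mem_graph_bot] at h; simp [h]
  | top => rw [mem_graph_top] at h; simp [h]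

theorem pt_left_mem {t : ℝ} (h1 : f.σ ≤ t) (h2 : t ≤ f.τ) : pt (f.left t) t ∈ f.graph :=
  ⟨h1, h2, left_mem_uIcc⟩

theorem pt_right_mem {t : ℝ} (h1 : f.σ ≤ t) (h2 : t ≤ f.τ) : pt (f.right t) t ∈ f.graph :=
  ⟨h1, h2, right_mem_uIcc⟩

/-- The order `⊑` on the interpolated graph of `f`. -/
def Le (f : CadlagPath) (z w : SpaceTime) : Prop := (z, w) ∈ f.graph₂

theorem le_iff {z w : SpaceTime} : f.Le z w ↔ z ∈ f.graph ∧ w ∈ f.graph ∧ f.Before z w := Iff.rfl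

theorem Le.left_mem {z w : SpaceTime} (h : f.Le z w) : z ∈ f.graph := h.1

theorem Le.right_mem {z w : SpaceTime} (h : f.Le z w) : w ∈ f.graph := h.2.1

theorem Le.time_le {z w : SpaceTime} (h : f.Le z w) : z.time ≤ w.time := by
  have h3 := h.2.2
  cases z <;> cases w <;> simp_all [Before]
  rcases h3 with h3 | h3
  · exact h3.le
  · exact h3.1.le

theorem le_of_time_lt {z w : SpaceTime} (hz : z ∈ f.graph) (hw : w ∈ f.graph)
    (h : z.time < w.time) : f.Le z w := by
  refine ⟨hz, hw, ?_⟩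
  cases z <;> cases w <;> simp_all [Before]

theorem le_pt {x y : EReal} {t : ℝ} :
    f.Le (pt x t) (pt y t) ↔ f.σ ≤ t ∧ t ≤ f.τ ∧ y ∈ uIcc (f.left t) (f.right t) ∧
      x ∈ uIcc (f.left t) y := by
  simp only [le_iff, mem_graph_pt, Before, lt_irrefl, false_or, true_and]
  constructor
  · rintro ⟨-, ⟨h1, h2, h3⟩, h4⟩
    exact ⟨h1, h2, h3, h4⟩
  · rintro ⟨h1, h2, h3, h4⟩
    exact ⟨⟨h1, h2, uIcc_trans h4 h3⟩, ⟨h1, h2, h3⟩, h4⟩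

theorem le_refl {z : SpaceTime} (h : z ∈ f.graph) : f.Le z z := by
  refine ⟨h, h, ?_⟩
  cases z <;> simp [Before]

theorem eq_or_pt_of_time_eq {z w : SpaceTime} (h : z.time = w.time) :
    z = w ∨ ∃ x y t, z = pt x t ∧ w = pt y t := by
  cases z <;> cases w <;> simp_all

theorem le_total {z w : SpaceTime} (hz : z ∈ f.graph) (hw : w ∈ f.graph) :
    f.Le z w ∨ f.Le w z := by
  rcases lt_trichotomy z.time w.time with h | h | h
  · exact .inl (le_of_time_lt hz hw h)
  · obtain rfl | ⟨x, y, t, rfl, rfl⟩ := eq_or_pt_of_time_eq h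
    · exact .inl (le_refl hz)
    · rw [le_pt, le_pt]
      rcases uIcc_total hz.2.2 hw.2.2 with h | h
      · exact .inl ⟨hz.1, hz.2.1, hw.2.2, h⟩
      · exact .inr ⟨hz.1, hz.2.1, hz.2.2, h⟩
  · exact .inr (le_of_time_lt hw hz h)

theorem Le.antisymm {z w : SpaceTime} (h : f.Le z w) (h' : f.Le w z) : z = w := by
  obtain rfl | ⟨x, y, t, rfl, rfl⟩ := eq_or_pt_of_time_eq (h.time_le.antisymm h'.time_le)
  · rfl
  · rw [le_pt] at h h'
    rw [uIcc_antisymm h.2.2.2 h'.2.2.2]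

theorem Le.trans {z w v : SpaceTime} (h : f.Le z w) (h' : f.Le w v) : f.Le z v := by
  rcases (h.time_le.trans h'.time_le).lt_or_eq with hlt | heq
  · exact le_of_time_lt h.left_mem h'.right_mem hlt
  have h1 : z.time = w.time := h.time_le.antisymm (h'.time_le.trans heq.ge)
  obtain rfl | ⟨x, y, t, rfl, rfl⟩ := eq_or_pt_of_time_eq h1
  · exact h'
  obtain rfl | ⟨x', y', t', h2, rfl⟩ := eq_or_pt_of_time_eq (h1.symm.trans heq)
  · exact h
  · obtain ⟨rfl, rfl⟩ : y = x' ∧ t = t' := by simpa using h2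
    rw [le_pt] at *
    exact ⟨h.1, h.2.1, h'.2.2.1, uIcc_trans h.2.2.2 h'.2.2.2⟩

theorem left_le {x : EReal} {t : ℝ} (h : pt x t ∈ f.graph) : f.Le (pt (f.left t) t) (pt x t) :=
  le_pt.2 ⟨h.1, h.2.1, h.2.2, left_mem_uIcc⟩

theorem le_right {x : EReal} {t : ℝ} (h : pt x t ∈ f.graph) : f.Le (pt x t) (pt (f.right t) t) :=
  le_pt.2 ⟨h.1, h.2.1, right_mem_uIcc, h.2.2⟩

/-! ### Points of one graph close to a fixed time. -/

section Limits
variable {ι : Type*} {l : Filter ι} {z w : ι → SpaceTime} {t : ℝ}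

theorem tendsto_toReal_time (h : Tendsto (fun i => (z i).time) l (𝓝 (t : EReal))) :
    Tendsto (fun i => (z i).time.toReal) l (𝓝 t) :=
  (EReal.tendsto_toReal (EReal.coe_ne_top t) (EReal.coe_ne_bot t)).comp h

theorem eventually_coe_toReal_time (h : Tendsto (fun i => (z i).time) l (𝓝 (t : EReal))) :
    ∀ᶠ i in l, z i = pt (z i).space (z i).time.toReal := by
  filter_upwards [h.eventually_ne (EReal.coe_ne_top t), h.eventually_ne (EReal.coe_ne_bot t)]
    with i h1 h2
  exact eq_pt_of_time (EReal.coe_toReal h1 h2).symm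

theorem tendsto_of_mem_uIcc {a b x : ι → EReal} {c : EReal} (ha : Tendsto a l (𝓝 c))
    (hb : Tendsto b l (𝓝 c)) (hx : ∀ᶠ i in l, x i ∈ uIcc (a i) (b i)) : Tendsto x l (𝓝 c) := by
  refine tendsto_of_tendsto_of_tendsto_of_le_of_le' (g := fun i => a i ⊓ b i)
    (h := fun i => a i ⊔ b i) ?_ ?_ (hx.mono fun i h => h.1) (hx.mono fun i h => h.2)
  · simpa using ha.inf_nhds hb
  · simpa using ha.sup_nhds hb

/-- A point of the graph at time s lies between f(s-) and f(s+), and both tend to f(t-) as s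
increases to t. -/
theorem tendsto_space_left (h1 : f.σ < t) (h2 : t ≤ f.τ) (hz : ∀ᶠ i in l, z i ∈ f.graph)
    (ht : Tendsto (fun i => (z i).time) l (𝓝 (t : EReal))) (hlt : ∀ᶠ i in l, (z i).time < t) :
    Tendsto (fun i => (z i).space) l (𝓝 (f.left t)) := by
  have hT : Tendsto (fun i => (z i).time.toReal) l (𝓝[<] t) := by
    refine tendsto_nhdsWithin_iff.2 ⟨tendsto_toReal_time ht, ?_⟩
    filter_upwards [hlt, eventually_coe_toReal_time ht] with i hi hi'
    rw [hi'] at hi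
    simpa using hi
  refine tendsto_of_mem_uIcc ((f.left_tendsto_left h1 h2).comp hT)
    ((f.tendsto_left t h1 h2).comp hT) ?_
  filter_upwards [hz, eventually_coe_toReal_time ht] with i hi hi'
  rw [hi'] at hi
  exact hi.2.2

theorem tendsto_space_right (h1 : f.σ ≤ t) (h2 : t < f.τ) (hz : ∀ᶠ i in l, z i ∈ f.graph)
    (ht : Tendsto (fun i => (z i).time) l (𝓝 (t : EReal))) (hlt : ∀ᶠ i in l, t < (z i).time) :
    Tendsto (fun i => (z i).space) l (𝓝 (f.right t)) := by
  have hT : Tendsto (fun i => (z i).time.toReal) l (𝓝[>] t) := by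
    refine tendsto_nhdsWithin_iff.2 ⟨tendsto_toReal_time ht, ?_⟩
    filter_upwards [hlt, eventually_coe_toReal_time ht] with i hi hi'
    rw [hi'] at hi
    simpa using hi
  refine tendsto_of_mem_uIcc ((f.left_tendsto_right h1 h2).comp hT)
    ((f.tendsto_right t h1 h2).comp hT) ?_
  filter_upwards [hz, eventually_coe_toReal_time ht] with i hi hi'
  rw [hi'] at hi
  exact hi.2.2

end Limits

section Ultra
variable {ι : Type*} {U : Ultrafilter ι} {z w : ι → SpaceTime} {a b : SpaceTime}

/-- This is the gain from ultrafilters: an approach to time t is purely from before, purely at t, or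
purely from after. -/
theorem ultra_cases (U : Ultrafilter ι) (u : ι → EReal) (t : EReal) :
    (∀ᶠ i in U, u i < t) ∨ (∀ᶠ i in U, u i = t) ∨ (∀ᶠ i in U, t < u i) := by
  rw [← Ultrafilter.eventually_or, ← Ultrafilter.eventually_or]
  exact .of_forall fun i => lt_trichotomy _ _

theorem time_mem_of_tendsto (hz : ∀ᶠ i in U, z i ∈ f.graph) (h : Tendsto z U (𝓝 a)) :
    f.σ ≤ a.time ∧ a.time ≤ f.τ := by
  have ht := (continuous_time.tendsto a).comp h
  exact ⟨ge_of_tendsto ht (hz.mono fun i hi => (time_mem hi).1),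
    le_of_tendsto ht (hz.mono fun i hi => (time_mem hi).2)⟩

theorem eq_left_of_tendsto {x : EReal} {t : ℝ} (hz : ∀ᶠ i in U, z i ∈ f.graph)
    (h : Tendsto z U (𝓝 (pt x t))) (hlt : ∀ᶠ i in U, (z i).time < t) : x = f.left t := by
  have hT := time_mem_of_tendsto hz h
  obtain ⟨i, hi, hi'⟩ := (hz.and hlt).exists
  exact tendsto_nhds_unique (tendsto_pt.1 h).2
    (tendsto_space_left ((time_mem hi).1.trans_lt hi') hT.2 hz (tendsto_pt.1 h).1 hlt)

theorem eq_right_of_tendsto {x : EReal} {t : ℝ} (hz : ∀ᶠ i in U, z i ∈ f.graph)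
    (h : Tendsto z U (𝓝 (pt x t))) (hlt : ∀ᶠ i in U, t < (z i).time) : x = f.right t := by
  have hT := time_mem_of_tendsto hz h
  obtain ⟨i, hi, hi'⟩ := (hz.and hlt).exists
  exact tendsto_nhds_unique (tendsto_pt.1 h).2
    (tendsto_space_right hT.1 (hi'.trans_le (time_mem hi).2) hz (tendsto_pt.1 h).1 hlt)

theorem mem_graph_of_tendsto (hz : ∀ᶠ i in U, z i ∈ f.graph) (h : Tendsto z U (𝓝 a)) :
    a ∈ f.graph := by
  have hT := time_mem_of_tendsto hz h
  cases a with
  | bot => simpa using hT.1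
  | top => simpa using hT.2
  | pt x t =>
    refine ⟨hT.1, hT.2, ?_⟩
    rcases ultra_cases U (fun i => (z i).time) t with hc | hc | hc
    · rw [eq_left_of_tendsto hz h hc]
      exact left_mem_uIcc
    · refine isClosed_Icc.mem_of_tendsto (tendsto_pt.1 h).2 ?_
      filter_upwards [hz, hc] with i hi hi'
      rw [eq_pt_of_time hi'] at hi
      exact hi.2.2
    · rw [eq_right_of_tendsto hz h hc]
      exact right_mem_uIcc

/-- Approach from earlier times can only reach f(t-), the first point of the slice at t; approach
from later times only f(t+), the last one. At constant time t the order is a closed betweenness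
condition. -/
theorem le_of_tendsto (hz : ∀ᶠ i in U, f.Le (z i) (w i)) (h : Tendsto z U (𝓝 a))
    (h' : Tendsto w U (𝓝 b)) : f.Le a b := by
  have hz1 := hz.mono fun i hi => hi.left_mem
  have hz2 := hz.mono fun i hi => hi.right_mem
  have ha := mem_graph_of_tendsto hz1 h
  have hb := mem_graph_of_tendsto hz2 h'
  have ht := le_of_tendsto_of_tendsto ((continuous_time.tendsto a).comp h)
    ((continuous_time.tendsto b).comp h') (hz.mono fun i hi => hi.time_le)
  rcases ht.lt_or_eq with hlt | heq
  · exact le_of_time_lt ha hb hlt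
  obtain rfl | ⟨x, y, t, rfl, rfl⟩ := eq_or_pt_of_time_eq heq
  · exact le_refl ha
  rcases ultra_cases U (fun i => (z i).time) t with hc | hc | hc
  · rw [eq_left_of_tendsto hz1 h hc]
    exact left_le hb
  · rcases ultra_cases U (fun i => (w i).time) t with hd | hd | hd
    · obtain ⟨i, h1, h2, h3⟩ := (hz.and (hc.and hd)).exists
      exact absurd h1.time_le (by rw [h2]; exact h3.not_ge)
    · refine le_pt.2 ⟨ha.1, ha.2.1, hb.2.2, ?_⟩
      have hx := (tendsto_pt.1 h).2
      have hy := (tendsto_pt.1 h').2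
      have hev : ∀ᶠ i in U, (z i).space ∈ uIcc (f.left t) (w i).space := by
        filter_upwards [hz, hc, hd] with i h1 h2 h3
        rw [eq_pt_of_time h2, eq_pt_of_time h3] at h1
        exact (le_pt.1 h1).2.2.2
      exact ⟨le_of_tendsto_of_tendsto (tendsto_const_nhds.inf_nhds hy) hx
          (hev.mono fun i hi => hi.1),
        le_of_tendsto_of_tendsto hx (tendsto_const_nhds.sup_nhds hy)
          (hev.mono fun i hi => hi.2)⟩
    · rw [eq_right_of_tendsto hz2 h' hd]
      exact le_right ha
  · have hd : ∀ᶠ i in U, (t : EReal) < (w i).time :=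
      (hc.and hz).mono fun i hi => hi.1.trans_le hi.2.time_le
    rw [eq_right_of_tendsto hz2 h' hd]
    exact le_right ha

end Ultra

theorem isClosed_graph₂ (f : CadlagPath) : IsClosed f.graph₂ :=
  isClosed_iff_ultrafilter.2 fun p U hU hp =>
    le_of_tendsto (U := U) (z := Prod.fst) (w := Prod.snd) hp
      ((continuous_fst.tendsto p).mono_left hU) ((continuous_snd.tendsto p).mono_left hU)

theorem isCompact_graph₂ (f : CadlagPath) : IsCompact f.graph₂ := f.isClosed_graph₂.isCompact

theorem isClosed_graph (f : CadlagPath) : IsClosed f.graph :=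
  isClosed_iff_ultrafilter.2 fun _ U hU hp => mem_graph_of_tendsto (U := U) (z := id) hp hU

theorem time_initialPoint (f : CadlagPath) : f.initialPoint.time = f.σ := by
  unfold initialPoint
  split_ifs with h1 h2
  · simp [h1]
  · simp [h2]
  · simp [EReal.coe_toReal h2 h1]

theorem initialPoint_of_eq {t : ℝ} (h : f.σ = t) : f.initialPoint = pt (f.left t) t := by
  simp [initialPoint, h]

theorem initialPoint_mem (f : CadlagPath) : f.initialPoint ∈ f.graph := by
  have h := f.time_initialPoint
  cases hz : f.initialPoint with
  | bot => rw [hz] at h; exact h.symm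
  | top => rw [hz] at h; exact top_le_iff.1 (h.le.trans f.le)
  | pt x t =>
    rw [hz] at h
    have h' := initialPoint_of_eq h.symm
    rw [hz] at h'
    rw [h']
    exact pt_left_mem h.ge (h.le.trans f.le)

theorem initialPoint_le {z : SpaceTime} (h : z ∈ f.graph) : f.Le f.initialPoint z := by
  rcases (time_mem h).1.lt_or_eq with hlt | heq
  · exact le_of_time_lt f.initialPoint_mem h (by rwa [time_initialPoint])
  · rw [← time_initialPoint] at heq
    obtain h1 | ⟨x, y, t, h1, rfl⟩ := eq_or_pt_of_time_eq heq
    · rw [h1]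
      exact le_refl h
    · rw [initialPoint_of_eq (by rw [← time_initialPoint, h1, time_pt])]
      exact left_le h

theorem graph₂_nonempty (f : CadlagPath) : f.graph₂.Nonempty :=
  ⟨_, le_refl f.initialPoint_mem⟩

end CadlagPath
end

section

/-! ### Convergence of compact sets and of paths -/

/-- A convergent family of compact sets: every limit of elements is in the limit set. -/
theorem mem_of_tendsto_compacts {X ι : Type*} [EMetricSpace X] {l : Filter ι} [l.NeBot]
    {K : ι → NonemptyCompacts X} {L : NonemptyCompacts X} (h : Tendsto K l (𝓝 L))
    {q : ι → X} (hq : ∀ᶠ i in l, q i ∈ K i) {p : X} (hp : Tendsto q l (𝓝 p)) : p ∈ L := by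
  have h1 : p ∈ (L : Set X) := by
    rw [Metric.mem_iff_infEDist_zero_of_closed L.isCompact.isClosed]
    have ha := tendsto_iff_edist_tendsto_0.1 h
    have hb := tendsto_iff_edist_tendsto_0.1 hp
    refine le_antisymm (ge_of_tendsto (by simpa using hb.add ha) ?_) zero_le
    filter_upwards [hq] with i hi
    refine Metric.infEDist_le_edist_add_infEDist (y := q i).trans ?_
    rw [edist_comm]
    gcongr
    exact Metric.infEDist_le_hausdorffEDist_of_mem hi
  exact h1

/-- A convergent family of compact sets: every element of the limit set is a limit of elements. -/
theorem exists_tendsto_compacts {X ι : Type*} [EMetricSpace X] {l : Filter ι}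
    {K : ι → NonemptyCompacts X} {L : NonemptyCompacts X} (h : Tendsto K l (𝓝 L))
    {p : X} (hp : p ∈ L) : ∃ q : ι → X, (∀ i, q i ∈ K i) ∧ Tendsto q l (𝓝 p) := by
  choose q hq hq' using fun i => (K i).isCompact.exists_infEDist_eq_edist (K i).nonempty p
  refine ⟨q, hq, tendsto_iff_edist_tendsto_0.2 ?_⟩
  refine tendsto_of_tendsto_of_tendsto_of_le_of_le tendsto_const_nhds
    (tendsto_iff_edist_tendsto_0.1 h) (fun _ => zero_le) fun i => ?_
  dsimp only
  rw [edist_comm (q i), ← hq', edist_comm (K i)]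
  exact Metric.infEDist_le_hausdorffEDist_of_mem hp

open SpaceTime

namespace CadlagPath
variable {f g : CadlagPath}

theorem mem_graph_iff_le {z : SpaceTime} : z ∈ f.graph ↔ f.Le z z := ⟨le_refl, fun h => h.1⟩

theorem exists_mem_graph_time {T : EReal} (h1 : f.σ ≤ T) (h2 : T ≤ f.τ) :
    ∃ z ∈ f.graph, z.time = T := by
  induction T with
  | bot => exact ⟨bot, le_bot_iff.1 h1, rfl⟩
  | top => exact ⟨top, top_le_iff.1 h2, rfl⟩
  | coe t => exact ⟨_, pt_right_mem h1 h2, rfl⟩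

/-- The order recorded in the second order graph singles out f(t-) and f(t+) as the first and the
last point of the slice at t. -/
theorem graph₂_injective : Function.Injective graph₂ := by
  intro f g h
  have hle : ∀ z w, f.Le z w ↔ g.Le z w := fun z w => by unfold Le; rw [h]
  have hm : ∀ z, z ∈ f.graph ↔ z ∈ g.graph := fun z => by
    rw [mem_graph_iff_le, mem_graph_iff_le, hle]
  have hσ : f.σ = g.σ := le_antisymm
    (by simpa using (time_mem ((hm _).2 g.initialPoint_mem)).1.trans_eq g.time_initialPoint)
    (by simpa using (time_mem ((hm _).1 f.initialPoint_mem)).1.trans_eq f.time_initialPoint)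
  have hτ : f.τ = g.τ := by
    obtain ⟨z, hz, hz'⟩ := f.exists_mem_graph_time f.le le_rfl
    obtain ⟨w, hw, hw'⟩ := g.exists_mem_graph_time g.le le_rfl
    exact le_antisymm (hz'.symm.trans_le (time_mem ((hm _).1 hz)).2)
      (hw'.symm.trans_le (time_mem ((hm _).2 hw)).2)
  have hT : ∀ t : ℝ, f.left t = g.left t ∧ f.right t = g.right t := fun t => by
    by_cases ht : f.σ ≤ t ∧ t ≤ f.τ
    · have ht' : g.σ ≤ t ∧ t ≤ g.τ := by rwa [← hσ, ← hτ]
      have a1 := left_le ((hm _).2 (pt_left_mem ht'.1 ht'.2))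
      have a2 := left_le ((hm _).1 (pt_left_mem ht.1 ht.2))
      have a3 := le_right ((hm _).2 (pt_right_mem ht'.1 ht'.2))
      have a4 := le_right ((hm _).1 (pt_right_mem ht.1 ht.2))
      rw [hle] at a1 a3
      have b1 := a1.antisymm a2
      have b2 := a3.antisymm a4
      simp only [pt.injEq, and_true] at b1 b2
      exact ⟨b1, b2.symm⟩
    · have ht' : ¬(g.σ ≤ t ∧ t ≤ g.τ) := by rwa [← hσ, ← hτ]
      rw [f.left_off t ht, f.right_off t ht, g.left_off t ht', g.right_off t ht']
      exact ⟨rfl, rfl⟩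
  exact CadlagPath.ext hσ hτ (funext fun t => (hT t).1) (funext fun t => (hT t).2)

instance : EMetricSpace CadlagPath where
  eq_of_edist_eq_zero {f g} h := graph₂_injective <|
    (f.isClosed_graph₂.hausdorffEDist_zero_iff g.isClosed_graph₂).1 h

/-- The second order interpolated graph as a nonempty compact set. -/
def graphCompact (f : CadlagPath) : NonemptyCompacts (SpaceTime × SpaceTime) :=
  ⟨⟨f.graph₂, f.isCompact_graph₂⟩, f.graph₂_nonempty⟩

theorem isometry_graphCompact : Isometry graphCompact := fun _ _ => rfl

instance : SecondCountableTopology CadlagPath :=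
  isometry_graphCompact.isEmbedding.secondCountableTopology

section Ultra
variable {ι : Type*} {U : Ultrafilter ι} {F : ι → CadlagPath}

theorem tendsto_graphCompact {l : Filter ι} :
    Tendsto F l (𝓝 f) ↔ Tendsto (fun i => (F i).graphCompact) l (𝓝 f.graphCompact) :=
  isometry_graphCompact.isEmbedding.tendsto_nhds_iff

theorem le_of_tendsto_path {l : Filter ι} [l.NeBot] (h : Tendsto F l (𝓝 f))
    {z w : ι → SpaceTime} (hle : ∀ᶠ i in l, (F i).Le (z i) (w i)) {a b : SpaceTime}
    (ha : Tendsto z l (𝓝 a)) (hb : Tendsto w l (𝓝 b)) : f.Le a b :=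
  mem_of_tendsto_compacts (tendsto_graphCompact.1 h) (q := fun i => (z i, w i)) hle
    (ha.prodMk_nhds hb)

theorem mem_graph_of_tendsto_path {l : Filter ι} [l.NeBot] (h : Tendsto F l (𝓝 f))
    {z : ι → SpaceTime} (hz : ∀ᶠ i in l, z i ∈ (F i).graph) {a : SpaceTime}
    (ha : Tendsto z l (𝓝 a)) : a ∈ f.graph :=
  (le_of_tendsto_path h (hz.mono fun _ hi => le_refl hi) ha ha).left_mem

theorem exists_tendsto_le {l : Filter ι} (h : Tendsto F l (𝓝 f)) {a b : SpaceTime}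
    (hab : f.Le a b) : ∃ z w : ι → SpaceTime, (∀ i, (F i).Le (z i) (w i)) ∧
      Tendsto z l (𝓝 a) ∧ Tendsto w l (𝓝 b) := by
  obtain ⟨q, hq, hq'⟩ := exists_tendsto_compacts (tendsto_graphCompact.1 h) (p := (a, b)) hab
  exact ⟨fun i => (q i).1, fun i => (q i).2, hq, hq'.fst_nhds, hq'.snd_nhds⟩

theorem exists_tendsto_mem_graph {l : Filter ι} (h : Tendsto F l (𝓝 f)) {a : SpaceTime}
    (ha : a ∈ f.graph) : ∃ z : ι → SpaceTime, (∀ i, z i ∈ (F i).graph) ∧ Tendsto z l (𝓝 a) := by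
  obtain ⟨z, w, h1, h2, -⟩ := exists_tendsto_le h (le_refl ha)
  exact ⟨z, fun i => (h1 i).left_mem, h2⟩

end Ultra

/-! ### The intermediate value property -/

theorem uIcc_left_of_mem {α : Type*} [LinearOrder α] {l r x m : α} (hx : x ∈ uIcc l r)
    (hm : m ∈ uIcc x r) : x ∈ uIcc l m ∧ m ∈ uIcc l r := by
  simp only [mem_uIcc] at *
  grind

theorem uIcc_mid_of_mem {α : Type*} [LinearOrder α] {l x y m : α} (hx : x ∈ uIcc l y)
    (hm : m ∈ uIcc x y) : x ∈ uIcc l m ∧ m ∈ uIcc l y := by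
  simp only [mem_uIcc] at *
  grind

/-- `P` and `Q` are the two sides of the level `m`, in either orientation, so that upward and
downward crossings share one proof. The crossing time is the first one at which the right value
satisfies `Q`; there the left value still satisfies `P`, and the jump covers `m`. -/
theorem exists_between_of_sep {P Q : EReal → Prop} {m x y : EReal} {s u : ℝ}
    (hP : IsClosed {v | P v}) (hQ : IsClosed {v | Q v}) (hPQ : ∀ v, P v ∨ Q v)
    (hm : ∀ a b, P a → Q b → m ∈ uIcc a b) (h : f.Le (pt x s) (pt y u)) (hx : P x) (hy : Q y) :
    ∃ r, f.Le (pt x s) (pt m r) ∧ f.Le (pt m r) (pt y u) := by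
  have hsu : s ≤ u := by simpa using h.time_le
  have h1 := h.left_mem
  have h2 := h.right_mem
  -- The alternative `r = u` keeps `T` nonempty: f(u+) may already have moved past `y`, back to the
  -- side `P`.
  let T : Set ℝ := {r | s ≤ r ∧ r ≤ u ∧ (Q (f.right r) ∨ r = u)}
  have huT : u ∈ T := ⟨hsu, le_rfl, .inr rfl⟩
  have hbd : BddBelow T := ⟨s, fun r hr => hr.1⟩
  obtain ⟨r, hr⟩ : ∃ r, r = sInf T := ⟨_, rfl⟩
  have hglb : IsGLB T r := hr ▸ isGLB_csInf ⟨u, huT⟩ hbd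
  have hsr : s ≤ r := hglb.2 fun r hr => hr.1
  have hru : r ≤ u := hglb.1 huT
  have hσr : f.σ ≤ r := h1.1.trans (EReal.coe_le_coe_iff.2 hsr)
  have hrτ : (r : EReal) ≤ f.τ := (EReal.coe_le_coe_iff.2 hru).trans h2.2.1
  have hleft : s < r → P (f.left r) := fun hlt => by
    refine hP.mem_of_tendsto (f.tendsto_left r (h1.1.trans_lt (EReal.coe_lt_coe_iff.2 hlt)) hrτ) ?_
    filter_upwards [Ioo_mem_nhdsLT hlt] with r' hr'
    refine (hPQ _).resolve_right fun hq => ?_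
    exact absurd (hglb.1 (show r' ∈ T from ⟨hr'.1.le, hr'.2.le.trans hru, .inl hq⟩))
      (not_le.2 hr'.2)
  have hright : r < u → Q (f.right r) := fun hlt => by
    by_contra hq
    have hev := (f.tendsto_right r hσr ((EReal.coe_lt_coe_iff.2 hlt).trans_le h2.2.1)).eventually
      (hQ.isOpen_compl.mem_nhds hq)
    obtain ⟨b, hb, hb'⟩ := (nhdsGT_basis r).eventually_iff.1 hev
    have hlb : min b u ∈ lowerBounds T := fun c hc => by
      by_contra hlt'
      rcases (hglb.1 hc).lt_or_eq with hrc | rfl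
      · rcases hc.2.2 with hc' | rfl
        · exact hb' ⟨hrc, (not_le.1 hlt').trans_le (min_le_left _ _)⟩ hc'
        · exact hlt' (min_le_right _ _)
      · rcases hc.2.2 with hc' | hc'
        · exact hq hc'
        · exact hlt.ne hc'
    exact absurd (hglb.2 hlb) (not_le.2 (lt_min hb hlt))
  rcases hsr.lt_or_eq with hs | rfl
  · rcases hru.lt_or_eq with hu | rfl
    · have hmem : pt m r ∈ f.graph := ⟨hσr, hrτ, hm _ _ (hleft hs) (hright hu)⟩
      exact ⟨r, le_of_time_lt h1 hmem (by simpa using hs), le_of_time_lt hmem h2 (by simpa using hu)⟩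
    · have hle : f.Le (pt m r) (pt y r) := le_pt.2 ⟨hσr, hrτ, h2.2.2, hm _ _ (hleft hs) hy⟩
      exact ⟨r, le_of_time_lt h1 hle.left_mem (by simpa using hs), hle⟩
  · rcases hru.lt_or_eq with hu | rfl
    · have hmm := uIcc_left_of_mem h1.2.2 (hm _ _ hx (hright hu))
      have hle : f.Le (pt x s) (pt m s) := le_pt.2 ⟨hσr, hrτ, hmm.2, hmm.1⟩
      exact ⟨s, hle, le_of_time_lt hle.right_mem h2 (by simpa using hu)⟩
    · have hmm := uIcc_mid_of_mem (le_pt.1 h).2.2.2 (hm _ _ hx hy)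
      have hle : f.Le (pt m s) (pt y s) := le_pt.2 ⟨hσr, hrτ, h2.2.2, hmm.2⟩
      exact ⟨s, le_pt.2 ⟨hσr, hrτ, hle.left_mem.2.2, hmm.1⟩, hle⟩

/-- Between two points of its interpolated graph, a path passes every spatial level in between. -/
theorem exists_between {m x y : EReal} {s u : ℝ} (h : f.Le (pt x s) (pt y u))
    (hm : m ∈ uIcc x y) : ∃ r, f.Le (pt x s) (pt m r) ∧ f.Le (pt m r) (pt y u) := by
  rcases mem_uIcc.1 hm with hm | hm
  · exact exists_between_of_sep (P := fun v => v ≤ m) (Q := fun v => m ≤ v) isClosed_Iic isClosed_Ici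
      (fun v => _root_.le_total _ _) (fun a b ha hb => mem_uIcc.2 (.inl ⟨ha, hb⟩)) h hm.1 hm.2
  · exact exists_between_of_sep (P := fun v => m ≤ v) (Q := fun v => v ≤ m) isClosed_Ici isClosed_Iic
      (fun v => _root_.le_total _ _) (fun a b ha hb => mem_uIcc.2 (.inr ⟨hb, ha⟩)) h hm.2 hm.1

end CadlagPath
end

section

/-! ### Limits of paths -/

/-- A nonempty compact set with a closed total preorder has a least element. -/
theorem IsCompact.exists_least_of_total {X : Type*} [TopologicalSpace X] {S : Set X}
    (hS : IsCompact S) (hne : S.Nonempty) {R : X → X → Prop}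
    (hcl : ∀ y ∈ S, IsClosed {x | x ∈ S ∧ R x y}) (htot : ∀ x ∈ S, ∀ y ∈ S, R x y ∨ R y x)
    (htr : ∀ x ∈ S, ∀ y ∈ S, ∀ z ∈ S, R x y → R y z → R x z) : ∃ x ∈ S, ∀ y ∈ S, R x y := by
  have : Nonempty S := hne.to_subtype
  suffices h : (⋂ y : S, {x | x ∈ S ∧ R x y}).Nonempty by
    obtain ⟨x, hx⟩ := h
    rw [mem_iInter] at hx
    exact ⟨x, (hx ⟨_, hne.some_mem⟩).1, fun y hy => (hx ⟨y, hy⟩).2⟩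
  refine IsCompact.nonempty_iInter_of_directed_nonempty_isCompact_isClosed
    (fun y : S => {x | x ∈ S ∧ R x y}) ?_ ?_ ?_ ?_
  · intro y z
    rcases htot y y.2 z z.2 with h | h
    · exact ⟨y, subset_rfl, fun x hx => ⟨hx.1, htr x hx.1 y y.2 z z.2 hx.2 h⟩⟩
    · exact ⟨z, fun x hx => ⟨hx.1, htr x hx.1 z z.2 y y.2 hx.2 h⟩, subset_rfl⟩
  · exact fun y => ⟨y, y.2, (htot y y.2 y y.2).elim id id⟩
  · exact fun y => hS.of_isClosed_subset (hcl y y.2) fun x hx => hx.1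
  · exact fun y => hcl y y.2

theorem uIcc_of_not_mem {α : Type*} [LinearOrder α] {l r x : α} (hx : x ∉ uIcc l r) :
    r ∈ uIcc l x ∨ l ∈ uIcc x r := by
  simp only [mem_uIcc] at *
  grind

open SpaceTime

namespace CadlagPath

/-- A closed relation on compactified space-time that is the graph of a half-infinite path. -/
structure IsPathOrder (G : SpaceTime → SpaceTime → Prop) : Prop where
  closed : ∀ {ι : Type} (U : Ultrafilter ι) (z w : ι → SpaceTime) (a b : SpaceTime),
    (∀ᶠ i in U, G (z i) (w i)) → Tendsto z U (𝓝 a) → Tendsto w U (𝓝 b) → G a b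
  refl_left : ∀ {a b}, G a b → G a a
  refl_right : ∀ {a b}, G a b → G b b
  total : ∀ {a b}, G a a → G b b → G a b ∨ G b a
  trans : ∀ {a b c}, G a b → G b c → G a c
  antisymm : ∀ {a b}, G a b → G b a → a = b
  time_le : ∀ {a b}, G a b → a.time ≤ b.time
  ivt : ∀ {x y m : EReal} {t : ℝ}, G (pt x t) (pt y t) → m ∈ uIcc x y →
    G (pt x t) (pt m t) ∧ G (pt m t) (pt y t)
  top : G top top
  bottom : ∃ z, G z z ∧ (∀ a, G a a → G z a) ∧ ∀ t : ℝ, z.time < t → ∃ x, G (pt x t) (pt x t)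

namespace IsPathOrder

variable {G : SpaceTime → SpaceTime → Prop}

theorem le_of_time_lt (hG : IsPathOrder G) {a b : SpaceTime} (ha : G a a) (hb : G b b)
    (h : a.time < b.time) : G a b :=
  (hG.total ha hb).resolve_right fun h' => (hG.time_le h').not_gt h

theorem isClosed_left (hG : IsPathOrder G) (t : ℝ) (y : EReal) :
    IsClosed {x | G (pt x t) (pt y t)} :=
  isClosed_iff_ultrafilter.2 fun x U hU hx =>
    hG.closed U (fun x => pt x t) (fun _ => pt y t) _ _ hx
      (((continuous_pt.comp (Continuous.prodMk_left t)).tendsto x).mono_left hU)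
      tendsto_const_nhds

theorem isClosed_right (hG : IsPathOrder G) (t : ℝ) (y : EReal) :
    IsClosed {x | G (pt y t) (pt x t)} :=
  isClosed_iff_ultrafilter.2 fun x U hU hx =>
    hG.closed U (fun _ => pt y t) (fun x => pt x t) _ _ hx tendsto_const_nhds
      (((continuous_pt.comp (Continuous.prodMk_left t)).tendsto x).mono_left hU)

theorem isClosed_slice (hG : IsPathOrder G) (t : ℝ) : IsClosed {x | G (pt x t) (pt x t)} :=
  isClosed_iff_ultrafilter.2 fun x U hU hx =>
    have h := ((continuous_pt.comp (Continuous.prodMk_left t)).tendsto x).mono_left hU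
    hG.closed U (fun x => pt x t) (fun x => pt x t) _ _ hx h h

theorem exists_first (hG : IsPathOrder G) {t : ℝ} (hne : ∃ x, G (pt x t) (pt x t)) :
    ∃ x, ∀ y, G (pt y t) (pt y t) → G (pt x t) (pt y t) := by
  obtain ⟨x, -, hx⟩ := (hG.isClosed_slice t).isCompact.exists_least_of_total hne
    (R := fun x y => G (pt x t) (pt y t))
    (fun y _ => (hG.isClosed_slice t).inter (hG.isClosed_left t y))
    (fun x hx y hy => hG.total hx hy) (fun x _ y _ z _ h h' => hG.trans h h')
  exact ⟨x, hx⟩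

theorem exists_last (hG : IsPathOrder G) {t : ℝ} (hne : ∃ x, G (pt x t) (pt x t)) :
    ∃ x, ∀ y, G (pt y t) (pt y t) → G (pt y t) (pt x t) := by
  obtain ⟨x, -, hx⟩ := (hG.isClosed_slice t).isCompact.exists_least_of_total hne
    (R := fun x y => G (pt y t) (pt x t))
    (fun y _ => (hG.isClosed_slice t).inter (hG.isClosed_right t y))
    (fun x hx y hy => hG.total hy hx) (fun x _ y _ z _ h h' => hG.trans h' h)
  exact ⟨x, hx⟩

/-- The values are the first and last points `L` and `R` of the time slices. A limit of `R s` as s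
decreases to t comes after `R t` by closedness, hence equals it; as s increases to t the limit comes
before `L t`, hence equals it. -/
theorem exists_path (hG : IsPathOrder G) :
    ∃ f : CadlagPath, f.τ = ⊤ ∧ ∀ a b, f.Le a b ↔ G a b := by
  classical
  obtain ⟨z₀, hz₀, hbot, htime⟩ := hG.bottom
  have hne : ∀ t : ℝ, z₀.time ≤ t → ∃ x, G (pt x t) (pt x t) := fun t ht => by
    rcases ht.lt_or_eq with h | h
    · exact htime t h
    · exact ⟨z₀.space, by rwa [← eq_pt_of_time h]⟩
  choose! L hL using fun t ht => hG.exists_first (hne t ht)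
  choose! R hR using fun t ht => hG.exists_last (hne t ht)
  have hLm : ∀ t : ℝ, z₀.time ≤ t → G (pt (L t) t) (pt (L t) t) := fun t ht =>
    let ⟨_, hx⟩ := hne t ht
    hG.refl_left (hL t ht _ hx)
  have hRm : ∀ t : ℝ, z₀.time ≤ t → G (pt (R t) t) (pt (R t) t) := fun t ht =>
    let ⟨_, hx⟩ := hne t ht
    hG.refl_right (hR t ht _ hx)
  have hpt : ∀ (V : Ultrafilter ℝ) (t : ℝ) (y : EReal), (V : Filter ℝ) ≤ 𝓝 t →
      Tendsto R V (𝓝 y) → Tendsto (fun s => pt (R s) s) V (𝓝 (pt y t)) := fun V t y hV hy =>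
    tendsto_pt.2 ⟨(continuous_coe_real_ereal.tendsto t).comp hV, hy⟩
  have hlim : ∀ V : Ultrafilter ℝ, ∃ y, Tendsto R V (𝓝 y) := fun V => by
    obtain ⟨a, -, ha⟩ := isCompact_univ.ultrafilter_le_nhds (V.map R) (by simp)
    exact ⟨a, ha⟩
  have hright : ∀ t : ℝ, z₀.time ≤ t → Tendsto R (𝓝[>] t) (𝓝 (R t)) := fun t ht => by
    refine (tendsto_iff_ultrafilter _ _ _).2 fun V hV => ?_
    obtain ⟨y, hy⟩ := hlim V
    have hp := hpt V t y (hV.trans nhdsWithin_le_nhds) hy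
    have hev : ∀ᶠ s in (V : Filter ℝ), t < s := hV self_mem_nhdsWithin
    have hle : ∀ s, t < s → z₀.time ≤ s := fun s hs => ht.trans (EReal.coe_le_coe_iff.2 hs.le)
    have h1 : G (pt (R t) t) (pt y t) := hG.closed V _ _ _ _ (hev.mono fun s hs =>
      hG.le_of_time_lt (hRm t ht) (hRm s (hle s hs)) (by simpa using hs)) tendsto_const_nhds hp
    have h2 := hG.antisymm h1 (hR t ht y (hG.refl_right h1))
    simp only [pt.injEq, and_true] at h2
    rwa [h2]
  have hleft : ∀ t : ℝ, z₀.time < t → Tendsto R (𝓝[<] t) (𝓝 (L t)) := fun t ht => by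
    refine (tendsto_iff_ultrafilter _ _ _).2 fun V hV => ?_
    obtain ⟨y, hy⟩ := hlim V
    have hp := hpt V t y (hV.trans nhdsWithin_le_nhds) hy
    have hev : ∀ᶠ s in (V : Filter ℝ), s < t := hV self_mem_nhdsWithin
    have hev' : ∀ᶠ s : ℝ in (V : Filter ℝ), z₀.time < s :=
      (hV.trans nhdsWithin_le_nhds) (eventually_lt_of_lt ht)
    have h1 : G (pt y t) (pt (L t) t) := hG.closed V _ _ _ _ ((hev.and hev').mono fun s hs =>
      hG.le_of_time_lt (hRm s hs.2.le) (hLm t ht.le) (by simpa using hs.1)) hp tendsto_const_nhds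
    have h2 := hG.antisymm h1 (hL t ht.le y (hG.refl_left h1))
    simp only [pt.injEq, and_true] at h2
    rwa [← h2]
  let f : CadlagPath :=
    { σ := z₀.time
      τ := ⊤
      left := fun t => if z₀.time ≤ t then L t else 0
      right := fun t => if z₀.time ≤ t then R t else 0
      le := le_top
      tendsto_right := fun t h1 _ => by
        rw [if_pos h1]
        refine (hright t h1).congr' ?_
        filter_upwards [self_mem_nhdsWithin] with s hs
        rw [if_pos (h1.trans (EReal.coe_le_coe_iff.2 (le_of_lt hs)))]
      tendsto_left := fun t h1 _ => by
        rw [if_pos h1.le]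
        refine (hleft t h1).congr' ?_
        filter_upwards [nhdsWithin_le_nhds (eventually_lt_of_lt h1)] with s hs
        rw [if_pos hs.le]
      left_off := fun t h => if_neg fun h' => h ⟨h', le_top⟩
      right_off := fun t h => if_neg fun h' => h ⟨h', le_top⟩ }
  have hfl : ∀ t : ℝ, z₀.time ≤ t → f.left t = L t := fun t h => if_pos h
  have hfr : ∀ t : ℝ, z₀.time ≤ t → f.right t = R t := fun t h => if_pos h
  -- If a point x of the slice lay outside the segment, intermediate values would place the last
  -- point before x, or x before the first point.
  have hslice : ∀ t : ℝ, z₀.time ≤ t → ∀ x, x ∈ uIcc (L t) (R t) ↔ G (pt x t) (pt x t) := by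
    intro t ht x
    have hLR := hL t ht _ (hRm t ht)
    refine ⟨fun hx => hG.refl_right (hG.ivt hLR hx).1, fun hx => ?_⟩
    by_contra hx'
    rcases uIcc_of_not_mem hx' with h | h
    · have := hG.antisymm (hG.ivt (hL t ht x hx) h).2 (hR t ht x hx)
      simp only [pt.injEq, and_true] at this
      exact hx' (this ▸ right_mem_uIcc)
    · have := hG.antisymm (hG.ivt (hR t ht x hx) h).1 (hL t ht x hx)
      simp only [pt.injEq, and_true] at this
      exact hx' (this ▸ left_mem_uIcc)
  have hmem : ∀ a, a ∈ f.graph ↔ G a a := fun a => by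
    cases a with
    | bot =>
      refine ⟨fun h => ?_, fun h => le_bot_iff.1 (hG.time_le (hbot _ h))⟩
      rwa [eq_bot_of_time (show z₀.time = ⊥ from h)] at hz₀
    | top => exact ⟨fun _ => hG.top, fun _ => rfl⟩
    | pt x t =>
      refine ⟨fun h => ?_, fun h => ?_⟩
      · have ht : z₀.time ≤ t := h.1
        rw [mem_graph_pt, hfl t ht, hfr t ht] at h
        exact (hslice t ht x).1 h.2.2
      · have ht : z₀.time ≤ t := hG.time_le (hbot _ h)
        rw [mem_graph_pt, hfl t ht, hfr t ht]
        exact ⟨ht, le_top, (hslice t ht x).2 h⟩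
  refine ⟨f, rfl, fun a b => ?_⟩
  by_cases hab : G a a ∧ G b b
  swap
  · exact ⟨fun h => absurd ⟨(hmem a).1 h.left_mem, (hmem b).1 h.right_mem⟩ hab,
      fun h => absurd ⟨hG.refl_left h, hG.refl_right h⟩ hab⟩
  obtain ⟨ha, hb⟩ := hab
  have ha' := (hmem a).2 ha
  have hb' := (hmem b).2 hb
  rcases lt_trichotomy a.time b.time with h | h | h
  · exact ⟨fun _ => hG.le_of_time_lt ha hb h, fun _ => f.le_of_time_lt ha' hb' h⟩
  · obtain rfl | ⟨x, y, t, rfl, rfl⟩ := eq_or_pt_of_time_eq h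
    · exact ⟨fun _ => ha, fun _ => le_refl ha'⟩
    · have ht : z₀.time ≤ t := ha'.1
      have hLx := hL t ht x ha
      have hLy := hL t ht y hb
      rw [le_pt, hfl t ht]
      refine ⟨fun h' => (hG.ivt hLy h'.2.2.2).2, fun h' =>
        ⟨ht, le_top, by have := hb'.2.2; rwa [hfl t ht] at this, ?_⟩⟩
      have ha2 := ha'.2.2
      have hb2 := hb'.2.2
      rw [hfl t ht] at ha2 hb2
      rcases uIcc_total ha2 hb2 with h3 | h3
      · exact h3
      · have := hG.antisymm h' (hG.ivt hLx h3).2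
        simp only [pt.injEq, and_true] at this
        rw [this]
        exact right_mem_uIcc
  · exact ⟨fun h' => absurd h'.time_le h.not_ge, fun h' => absurd (hG.time_le h') h.not_ge⟩

end IsPathOrder

/-- A family of half-infinite paths converges along an ultrafilter if no spatial segment is traversed
in both directions in the limit. -/
theorem exists_tendsto_of_no_oscillation {ι : Type*} {U : Ultrafilter ι} {F : ι → CadlagPath}
    (hτ : ∀ i, (F i).τ = ⊤)
    (hosc : ∀ (z w z' w' : ι → SpaceTime) (x y : EReal) (t : ℝ), x < y →
      (∀ i, (F i).Le (z i) (w i)) → (∀ i, (F i).Le (w' i) (z' i)) →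
      Tendsto z U (𝓝 (pt x t)) → Tendsto w U (𝓝 (pt y t)) →
      Tendsto w' U (𝓝 (pt y t)) → Tendsto z' U (𝓝 (pt x t)) → False) :
    ∃ f : CadlagPath, f.τ = ⊤ ∧ Tendsto F U (𝓝 f) := by
  -- The hyperspace of a compact space is compact, so the second order graphs have a limit `K`. All
  -- properties of a path order survive the limit by themselves except antisymmetry, which is what
  -- `hosc` provides.
  obtain ⟨K, -, hK⟩ := isCompact_univ.ultrafilter_le_nhds
    (U.map fun i => (F i).graphCompact) (by simp)
  replace hK : Tendsto (fun i => (F i).graphCompact) U (𝓝 K) := hK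
  let G : SpaceTime → SpaceTime → Prop := fun a b => (a, b) ∈ K
  have hin : ∀ {z w : ι → SpaceTime} {a b : SpaceTime}, (∀ᶠ i in U, (F i).Le (z i) (w i)) →
      Tendsto z U (𝓝 a) → Tendsto w U (𝓝 b) → G a b := fun h ha hb =>
    mem_of_tendsto_compacts hK (q := fun i => (_, _)) h (ha.prodMk_nhds hb)
  have hap : ∀ {a b : SpaceTime}, G a b → ∃ z w : ι → SpaceTime, (∀ i, (F i).Le (z i) (w i)) ∧
      Tendsto z U (𝓝 a) ∧ Tendsto w U (𝓝 b) := fun {a b} h => by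
    obtain ⟨q, hq, hq'⟩ := exists_tendsto_compacts hK (p := (a, b)) h
    exact ⟨fun i => (q i).1, fun i => (q i).2, hq, hq'.fst_nhds, hq'.snd_nhds⟩
  have hgr : ∀ {a : SpaceTime}, G a a → ∃ z : ι → SpaceTime, (∀ i, z i ∈ (F i).graph) ∧
      Tendsto z U (𝓝 a) := fun h => by
    obtain ⟨z, w, h1, h2, -⟩ := hap h
    exact ⟨z, fun i => (h1 i).left_mem, h2⟩
  have hmem : ∀ {z : ι → SpaceTime} {a : SpaceTime}, (∀ᶠ i in U, z i ∈ (F i).graph) →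
      Tendsto z U (𝓝 a) → G a a := fun h ha => hin (h.mono fun i hi => le_refl hi) ha ha
  have hor : ∀ {z w : ι → SpaceTime}, (∀ i, z i ∈ (F i).graph) → (∀ i, w i ∈ (F i).graph) →
      (∀ᶠ i in U, (F i).Le (z i) (w i)) ∨ (∀ᶠ i in U, (F i).Le (w i) (z i)) := fun hz hw => by
    rw [← Ultrafilter.eventually_or]
    exact .of_forall fun i => le_total (hz i) (hw i)
  have htime : ∀ {a b}, G a b → a.time ≤ b.time := fun {a b} h => by
    obtain ⟨z, w, h1, h2, h3⟩ := hap h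
    exact le_of_tendsto_of_tendsto ((continuous_time.tendsto a).comp h2)
      ((continuous_time.tendsto b).comp h3) (.of_forall fun i => (h1 i).time_le)
  have hanti : ∀ {a b}, G a b → G b a → a = b := fun {a b} h h' => by
    obtain rfl | ⟨x, y, t, rfl, rfl⟩ := eq_or_pt_of_time_eq ((htime h).antisymm (htime h'))
    · rfl
    obtain ⟨z, w, h1, h2, h3⟩ := hap h
    obtain ⟨w', z', h1', h2', h3'⟩ := hap h'
    rcases lt_trichotomy x y with hxy | rfl | hxy
    · exact (hosc z w z' w' x y t hxy h1 h1' h2 h3 h2' h3').elim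
    · rfl
    · exact (hosc w' z' w z y x t hxy h1' h1 h2' h3' h2 h3).elim
  have hG : IsPathOrder G :=
    { closed := fun V z w a b hV ha hb =>
        K.isCompact.isClosed.mem_of_tendsto (ha.prodMk_nhds hb) hV
      refl_left := fun h =>
        let ⟨_, _, h1, h2, _⟩ := hap h
        hmem (.of_forall fun i => (h1 i).left_mem) h2
      refl_right := fun h =>
        let ⟨_, _, h1, _, h3⟩ := hap h
        hmem (.of_forall fun i => (h1 i).right_mem) h3
      total := fun ha hb => by
        obtain ⟨z, h1, h2⟩ := hgr ha
        obtain ⟨w, h3, h4⟩ := hgr hb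
        exact (hor h1 h3).imp (fun h => hin h h2 h4) (fun h => hin h h4 h2)
      trans := fun {a b c} h h' => by
        obtain ⟨z, w, h1, h2, h3⟩ := hap h
        obtain ⟨w', v, h1', h2', h3'⟩ := hap h'
        rcases hor (fun i => (h1 i).left_mem) (fun i => (h1' i).right_mem) with ho | ho
        · exact hin ho h2 h3'
        -- If the approximants of `c` come before those of `a`, then `b` precedes `a`, so `a = b` by
        -- antisymmetry.
        · have : G b a := hin (ho.mono fun i hi => (h1' i).trans hi) h2' h2
          rwa [hanti h this]
      antisymm := hanti
      time_le := htime
      ivt := fun {x y m t} h hm => by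
        obtain ⟨z, w, h1, h2, h3⟩ := hap h
        by_cases hmx : m = x
        · subst hmx
          exact ⟨hmem (.of_forall fun i => (h1 i).left_mem) h2, h⟩
        by_cases hmy : m = y
        · subst hmy
          exact ⟨h, hmem (.of_forall fun i => (h1 i).right_mem) h3⟩
        -- For `m` different from both ends, the approximants are eventually on opposite sides of
        -- `m`; the paths pass `m` in between, at times squeezed to t.
        obtain ⟨hz1, hz2⟩ := tendsto_pt.1 h2
        obtain ⟨hw1, hw2⟩ := tendsto_pt.1 h3
        have hev : ∀ᶠ i in U, m ∈ uIcc (z i).space (w i).space := by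
          rcases mem_uIcc.1 hm with hm | hm
          · filter_upwards [hz2.eventually_lt_const (lt_of_le_of_ne hm.1 (Ne.symm hmx)),
              hw2.eventually_const_lt (lt_of_le_of_ne hm.2 hmy)] with i h1 h2
            exact mem_uIcc.2 (.inl ⟨h1.le, h2.le⟩)
          · filter_upwards [hw2.eventually_lt_const (lt_of_le_of_ne hm.1 (Ne.symm hmy)),
              hz2.eventually_const_lt (lt_of_le_of_ne hm.2 hmx)] with i h1 h2
            exact mem_uIcc.2 (.inr ⟨h1.le, h2.le⟩)
        have hex : ∀ᶠ i in U, ∃ r, (F i).Le (z i) (pt m r) ∧ (F i).Le (pt m r) (w i) := by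
          filter_upwards [hev, eventually_coe_toReal_time hz1, eventually_coe_toReal_time hw1]
            with i hi hzi hwi
          have h1i := h1 i
          rw [hzi, hwi] at h1i ⊢
          exact exists_between h1i hi
        choose! r hr using fun i (hi : ∃ r, (F i).Le (z i) (pt m r) ∧ (F i).Le (pt m r) (w i)) => hi
        have hrt : Tendsto (fun i => pt m (r i)) U (𝓝 (pt m t)) := by
          refine tendsto_pt.2 ⟨?_, tendsto_const_nhds⟩
          exact tendsto_of_tendsto_of_tendsto_of_le_of_le' hz1 hw1
            (hex.mono fun i hi => (hr i hi).1.time_le) (hex.mono fun i hi => (hr i hi).2.time_le)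
        exact ⟨hin (hex.mono fun i hi => (hr i hi).1) h2 hrt,
          hin (hex.mono fun i hi => (hr i hi).2) hrt h3⟩
      top := hmem (z := fun _ => .top) (.of_forall fun i => hτ i) tendsto_const_nhds
      bottom := by
        obtain ⟨z, hz⟩ := exists_tendsto U fun i => (F i).initialPoint
        refine ⟨z, hmem (.of_forall fun i => (F i).initialPoint_mem) hz, fun a ha => ?_,
          fun t ht => ?_⟩
        · obtain ⟨w, h1, h2⟩ := hgr ha
          exact hin (.of_forall fun i => initialPoint_le (h1 i)) hz h2
        · have hev : ∀ᶠ i in U, (F i).σ < t := by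
            have := ((continuous_time.tendsto z).comp hz).eventually_lt_const ht
            filter_upwards [this] with i hi
            rwa [← time_initialPoint]
          obtain ⟨w, hw⟩ := exists_tendsto U fun i => pt ((F i).right t) t
          have hwt : w.time = t := tendsto_nhds_unique ((continuous_time.tendsto w).comp hw)
            (by simp [Function.comp_def])
          refine ⟨w.space, ?_⟩
          rw [← eq_pt_of_time hwt]
          exact hmem (hev.mono fun i hi => pt_right_mem hi.le (by simp [hτ])) hw }
  obtain ⟨f, hf, hle⟩ := hG.exists_path
  refine ⟨f, hf, tendsto_graphCompact.2 ?_⟩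
  have : f.graphCompact = K := by
    refine SetLike.ext fun p => ?_
    exact hle p.1 p.2
  rwa [this]

end CadlagPath
end

section

/-! ### Extension and restriction of paths -/

open SpaceTime

namespace CadlagPath

variable {f g h : CadlagPath}

theorem ExtendsTo.le (hgf : g.ExtendsTo f) {z w : SpaceTime} (hzw : g.Le z w) : f.Le z w :=
  hgf hzw

theorem ExtendsTo.mem (hgf : g.ExtendsTo f) {z : SpaceTime} (hz : z ∈ g.graph) : z ∈ f.graph :=
  (hgf.le (le_refl hz)).left_mem

theorem ExtendsTo.refl (f : CadlagPath) : f.ExtendsTo f := subset_rfl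

theorem ExtendsTo.trans (h1 : f.ExtendsTo g) (h2 : g.ExtendsTo h) : f.ExtendsTo h :=
  Subset.trans h1 h2

theorem ExtendsTo.antisymm (h1 : f.ExtendsTo g) (h2 : g.ExtendsTo f) : f = g :=
  graph₂_injective (Subset.antisymm h1 h2)

theorem ExtendsTo.top (hgf : g.ExtendsTo f) (hg : g.τ = ⊤) : f.τ = ⊤ :=
  hgf.mem (mem_graph_top.2 hg)

theorem ExtendsTo.σ_le (hgf : g.ExtendsTo f) : f.σ ≤ g.σ := by
  rw [← g.time_initialPoint]
  exact (time_mem (hgf.mem g.initialPoint_mem)).1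

theorem ExtendsTo.right_eq (hgf : g.ExtendsTo f) (hg : g.τ = ⊤) {t : ℝ} (ht : g.σ ≤ t) :
    g.right t = f.right t := by
  have hf := hgf.top hg
  have h1 := g.tendsto_right t ht (by simp [hg])
  refine tendsto_nhds_unique h1 (tendsto_space_right (z := fun s => pt (g.right s) s)
    (hgf.σ_le.trans ht) (by simp [hf]) ?_ ?_ ?_)
  · filter_upwards [self_mem_nhdsWithin] with s hs
    exact hgf.mem (pt_right_mem (ht.trans (EReal.coe_le_coe_iff.2 (le_of_lt hs))) (by simp [hg]))
  · exact (continuous_coe_real_ereal.tendsto t).mono_left nhdsWithin_le_nhds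
  · filter_upwards [self_mem_nhdsWithin] with s hs
    simpa using hs

/-- The strict inequality matters: at its initial time g may start in the middle of a jump of f. -/
theorem ExtendsTo.left_eq (hgf : g.ExtendsTo f) (hg : g.τ = ⊤) {t : ℝ} (ht : g.σ < t) :
    g.left t = f.left t := by
  have hf := hgf.top hg
  have h1 := g.tendsto_left t ht (by simp [hg])
  refine tendsto_nhds_unique h1 (tendsto_space_left (z := fun s => pt (g.right s) s)
    (hgf.σ_le.trans_lt ht) (by simp [hf]) ?_ ?_ ?_)
  · filter_upwards [nhdsWithin_le_nhds (eventually_lt_of_lt ht)] with s hs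
    exact hgf.mem (pt_right_mem hs.le (by simp [hg]))
  · exact (continuous_coe_real_ereal.tendsto t).mono_left nhdsWithin_le_nhds
  · filter_upwards [self_mem_nhdsWithin] with s hs
    simpa using hs

theorem ExtendsTo.left_mem (hgf : g.ExtendsTo f) (hg : g.τ = ⊤) {t : ℝ} (ht : g.σ = t) :
    g.left t ∈ uIcc (f.left t) (f.right t) :=
  (hgf.mem (pt_left_mem ht.le (by simp [hg]))).2.2

theorem uIcc_of_left {α : Type*} [LinearOrder α] {l l' r x y : α} (hl : l' ∈ uIcc l r)
    (hy : y ∈ uIcc l' r) (hx : x ∈ uIcc l' y) : x ∈ uIcc l y := by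
  simp only [mem_uIcc] at *
  grind

theorem extendsTo_of (hf : f.τ = ⊤) (hσ : f.σ ≤ g.σ)
    (hr : ∀ t : ℝ, g.σ ≤ t → g.right t = f.right t)
    (hl : ∀ t : ℝ, g.σ < t → g.left t = f.left t)
    (hi : ∀ t : ℝ, g.σ = t → g.left t ∈ uIcc (f.left t) (f.right t)) :
    g.ExtendsTo f := by
  have hsub : ∀ z ∈ g.graph, z ∈ f.graph := fun z hz => by
    cases z with
    | bot => exact le_bot_iff.1 (hσ.trans_eq hz)
    | top => exact hf
    | pt x t =>
      have ht : g.σ ≤ t := hz.1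
      refine ⟨hσ.trans ht, by simp [hf], ?_⟩
      have hx := hz.2.2
      rw [hr t ht] at hx
      rcases ht.lt_or_eq with h | h
      · rwa [hl t h] at hx
      · exact (uIcc_left_of_mem (hi t h) hx).2
  rintro ⟨z, w⟩ hzw
  replace hzw : g.Le z w := hzw
  change f.Le z w
  have hz := hsub z hzw.left_mem
  have hw := hsub w hzw.right_mem
  rcases hzw.time_le.lt_or_eq with h | h
  · exact le_of_time_lt hz hw h
  obtain rfl | ⟨x, y, t, rfl, rfl⟩ := eq_or_pt_of_time_eq h
  · exact le_refl hz
  refine le_pt.2 ⟨hz.1, hz.2.1, hw.2.2, ?_⟩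
  have h1 := (le_pt.1 hzw).2.2
  have ht : g.σ ≤ t := hzw.left_mem.1
  rw [hr t ht] at h1
  rcases ht.lt_or_eq with h | h
  · rw [hl t h] at h1
    exact h1.2
  · exact uIcc_of_left (hi t h) h1.1 h1.2

theorem ExtendsTo.le_iff (hgf : g.ExtendsTo f) {z w : SpaceTime} (hz : z ∈ g.graph)
    (hw : w ∈ g.graph) : g.Le z w ↔ f.Le z w := by
  refine ⟨hgf.le, fun h => ?_⟩
  rcases le_total hz hw with h' | h'
  · exact h'
  · rw [h.antisymm (hgf.le h')]
    exact le_refl hw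

theorem uIcc_right_of_mem {α : Type*} [LinearOrder α] {l r x y : α} (hx : x ∈ uIcc l y)
    (hy : y ∈ uIcc l r) : y ∈ uIcc x r := by
  simp only [mem_uIcc] at *
  grind

/-- A half-infinite restriction of f is the final segment of f from its initial point on. Hence it
is determined by that point, and two restrictions of one path are comparable. -/
theorem ExtendsTo.mem_iff (hgf : g.ExtendsTo f) (hg : g.τ = ⊤) {w : SpaceTime} :
    w ∈ g.graph ↔ f.Le g.initialPoint w := by
  refine ⟨fun h => hgf.le (initialPoint_le h), fun h => ?_⟩
  have ht := h.time_le
  rw [time_initialPoint] at ht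
  cases w with
  | bot => exact le_bot_iff.1 ht
  | top => exact hg
  | pt y t =>
    refine ⟨ht, by simp [hg], ?_⟩
    rw [hgf.right_eq hg ht]
    have hy := h.right_mem.2.2
    rcases ht.lt_or_eq with h' | h'
    · rwa [hgf.left_eq hg h']
    · rw [initialPoint_of_eq h', le_pt] at h
      exact uIcc_right_of_mem h.2.2.2 hy

theorem eq_of_extendsTo_of_initialPoint (hg : g.τ = ⊤) (hh : h.τ = ⊤) (hgf : g.ExtendsTo f)
    (hhf : h.ExtendsTo f) (hi : g.initialPoint = h.initialPoint) : g = h := by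
  have hm : ∀ w, w ∈ g.graph ↔ w ∈ h.graph := fun w => by
    rw [hgf.mem_iff hg, hhf.mem_iff hh, hi]
  refine ExtendsTo.antisymm ?_ ?_
  · rintro ⟨z, w⟩ hzw
    have hzw' : g.Le z w := hzw
    exact (hhf.le_iff ((hm _).1 hzw'.left_mem) ((hm _).1 hzw'.right_mem)).2 (hgf.le hzw')
  · rintro ⟨z, w⟩ hzw
    have hzw' : h.Le z w := hzw
    exact (hgf.le_iff ((hm _).2 hzw'.left_mem) ((hm _).2 hzw'.right_mem)).2 (hhf.le hzw')

/-- Two restrictions of the same path are comparable. -/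
theorem comparable_of_extendsTo (hg : g.τ = ⊤) (hh : h.τ = ⊤) (hgf : g.ExtendsTo f)
    (hhf : h.ExtendsTo f) : g.ExtendsTo h ∨ h.ExtendsTo g := by
  have key : ∀ {g h : CadlagPath}, g.τ = ⊤ → h.τ = ⊤ → g.ExtendsTo f → h.ExtendsTo f →
      f.Le h.initialPoint g.initialPoint → g.ExtendsTo h := by
    intro g h hg hh hgf hhf hle
    rintro ⟨z, w⟩ hzw
    have hzw' : g.Le z w := hzw
    refine (hhf.le_iff ?_ ?_).2 (hgf.le hzw')
    · exact (hhf.mem_iff hh).2 (hle.trans ((hgf.mem_iff hg).1 hzw'.left_mem))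
    · exact (hhf.mem_iff hh).2 (hle.trans ((hgf.mem_iff hg).1 hzw'.right_mem))
  rcases le_total (hgf.mem g.initialPoint_mem) (hhf.mem h.initialPoint_mem) with h1 | h1
  · exact .inr (key hh hg hhf hgf h1)
  · exact .inl (key hg hh hgf hhf h1)

/-- A half-infinite path can be restricted to start at any point of its graph. -/
theorem exists_restrict (hf : f.τ = ⊤) {z : SpaceTime} (hz : z ∈ f.graph) :
    ∃ g : CadlagPath, g.τ = ⊤ ∧ g.ExtendsTo f ∧ g.initialPoint = z := by
  have hσ := (time_mem hz).1
  let g : CadlagPath :=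
    { σ := z.time
      τ := ⊤
      left := fun t => if t < z.time then 0 else if t = z.time then z.space else f.left t
      right := fun t => if t < z.time then 0 else f.right t
      le := le_top
      tendsto_right := fun t h1 _ => by
        rw [if_neg h1.not_gt]
        refine (f.tendsto_right t (hσ.trans h1) (by simp [hf])).congr' ?_
        filter_upwards [self_mem_nhdsWithin] with s hs
        rw [if_neg (h1.trans (EReal.coe_le_coe_iff.2 (le_of_lt hs))).not_gt]
      tendsto_left := fun t h1 _ => by
        rw [if_neg h1.not_gt, if_neg h1.ne']
        refine (f.tendsto_left t (hσ.trans_lt h1) (by simp [hf])).congr' ?_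
        filter_upwards [nhdsWithin_le_nhds (eventually_lt_of_lt h1)] with s hs
        rw [if_neg hs.not_gt]
      left_off := fun t h => if_pos (not_le.1 fun h' => h ⟨h', le_top⟩)
      right_off := fun t h => if_pos (not_le.1 fun h' => h ⟨h', le_top⟩) }
  have hgl : ∀ t : ℝ, z.time = t → g.left t = z.space := fun t ht => by simp [g, ht]
  refine ⟨g, rfl, extendsTo_of hf hσ (fun t ht => if_neg (not_lt.2 ht))
    (fun t ht => ?_) (fun t ht => ?_), ?_⟩
  · exact (if_neg ht.not_gt).trans (if_neg ht.ne')
  · rw [hgl t ht]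
    rw [eq_pt_of_time ht] at hz
    exact hz.2.2
  · cases z with
    | bot => exact eq_bot_of_time g.time_initialPoint
    | top => exact eq_top_of_time g.time_initialPoint
    | pt x t => rw [initialPoint_of_eq (f := g) rfl, hgl t rfl, space_pt]

section Limits
variable {ι : Type*} {U : Ultrafilter ι} {F G : ι → CadlagPath}

theorem extendsTo_of_tendsto {l : Filter ι} [l.NeBot] (hG : Tendsto G l (𝓝 g))
    (hF : Tendsto F l (𝓝 f)) (h : ∀ᶠ i in l, (G i).ExtendsTo (F i)) : g.ExtendsTo f := by
  rintro ⟨a, b⟩ hab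
  obtain ⟨z, w, h1, h2, h3⟩ := exists_tendsto_le hG (show g.Le a b from hab)
  exact le_of_tendsto_path hF (h.mono fun i hi => hi.le (h1 i)) h2 h3

theorem top_of_tendsto {l : Filter ι} [l.NeBot] (hF : Tendsto F l (𝓝 f))
    (h : ∀ᶠ i in l, (F i).τ = ⊤) : f.τ = ⊤ :=
  mem_graph_of_tendsto_path (z := fun _ => top) hF h tendsto_const_nhds

theorem bot_of_tendsto {l : Filter ι} [l.NeBot] (hF : Tendsto F l (𝓝 f))
    (h : ∀ᶠ i in l, (F i).σ = ⊥) : f.σ = ⊥ :=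
  mem_graph_of_tendsto_path (z := fun _ => bot) hF h tendsto_const_nhds

/-- Initial points are least elements, so their limit precedes every point of the limit graph,
including the initial point of f; antisymmetry then identifies the two. -/
theorem tendsto_initialPoint (hF : Tendsto F U (𝓝 f)) :
    Tendsto (fun i => (F i).initialPoint) U (𝓝 f.initialPoint) := by
  obtain ⟨z, hz⟩ := exists_tendsto U fun i => (F i).initialPoint
  obtain ⟨w, h1, h2⟩ := exists_tendsto_mem_graph hF f.initialPoint_mem
  have h3 : f.Le z f.initialPoint :=
    le_of_tendsto_path hF (.of_forall fun i => initialPoint_le (h1 i)) hz h2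
  rwa [h3.antisymm (initialPoint_le h3.left_mem)] at hz

/-- Restrictions of the elements of a convergent family of paths converge. -/
theorem exists_tendsto_of_extendsTo (hG : ∀ i, (G i).τ = ⊤) (hF : Tendsto F U (𝓝 f))
    (h : ∀ i, (G i).ExtendsTo (F i)) :
    ∃ g : CadlagPath, g.τ = ⊤ ∧ Tendsto G U (𝓝 g) ∧ g.ExtendsTo f := by
  -- An oscillation of the restrictions is one of the paths `F i`, and would contradict antisymmetry
  -- of the order along their limit f.
  obtain ⟨g, hg, hg'⟩ := exists_tendsto_of_no_oscillation (U := U) hG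
    (fun z w z' w' x y t hxy h1 h2 h3 h4 h5 h6 => by
      have ha := le_of_tendsto_path hF (.of_forall fun i => (h i).le (h1 i)) h3 h4
      have hb := le_of_tendsto_path hF (.of_forall fun i => (h i).le (h2 i)) h5 h6
      have := ha.antisymm hb
      simp only [pt.injEq, and_true] at this
      exact hxy.ne this)
  exact ⟨g, hg, hg', extendsTo_of_tendsto hg' hF (.of_forall h)⟩

/-- Restriction is continuous in the path and in the starting point. -/
theorem tendsto_restrict (hG : ∀ i, (G i).τ = ⊤) (hF : Tendsto F U (𝓝 f))
    (h : ∀ i, (G i).ExtendsTo (F i)) (hg : g.τ = ⊤) (hgf : g.ExtendsTo f)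
    (hi : Tendsto (fun i => (G i).initialPoint) U (𝓝 g.initialPoint)) : Tendsto G U (𝓝 g) := by
  obtain ⟨g', h1, h2, h3⟩ := exists_tendsto_of_extendsTo hG hF h
  rwa [eq_of_extendsTo_of_initialPoint hg h1 hgf h3
    (tendsto_nhds_unique hi (tendsto_initialPoint h2))]

/-- A restriction of a limit of paths is a limit of restrictions. -/
theorem exists_tendsto_restrict (hτ : ∀ i, (F i).τ = ⊤) (hF : Tendsto F U (𝓝 f)) (hg : g.τ = ⊤)
    (hgf : g.ExtendsTo f) : ∃ G : ι → CadlagPath, (∀ i, (G i).τ = ⊤ ∧ (G i).ExtendsTo (F i)) ∧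
      Tendsto G U (𝓝 g) := by
  obtain ⟨z, h1, h2⟩ := exists_tendsto_mem_graph hF (hgf.mem g.initialPoint_mem)
  choose G hG hGF hGi using fun i => exists_restrict (hτ i) (h1 i)
  refine ⟨G, fun i => ⟨hG i, hGF i⟩, tendsto_restrict hG hF hGF hg hgf ?_⟩
  simpa only [hGi] using h2

end Limits

end CadlagPath
end

section

/-! ### Reflection of space -/

open SpaceTime

namespace SpaceTime

/-- The reflection of space. -/
def reflect : SpaceTime → SpaceTime
  | pt x t => pt (-x) t
  | bot => bot
  | top => top

@[simp] theorem reflect_pt (x : EReal) (t : ℝ) : (pt x t).reflect = pt (-x) t := rfl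

@[simp] theorem time_reflect (z : SpaceTime) : z.reflect.time = z.time := by cases z <;> rfl

@[simp] theorem reflect_reflect (z : SpaceTime) : z.reflect.reflect = z := by
  cases z <;> simp [reflect]

theorem space_reflect (z : SpaceTime) : z.reflect.space = -z.space := by
  cases z <;> simp [reflect, space]

theorem continuous_reflect : Continuous reflect := by
  refine continuous_iff_continuousAt.2 fun w => ?_
  have h := tendsto_id (x := 𝓝 w)
  cases w with
  | pt x t =>
    refine tendsto_pt.2 ?_
    simp only [time_reflect, space_reflect]
    exact ⟨(tendsto_pt.1 h).1, ((continuous_neg (G := EReal)).tendsto x).comp (tendsto_pt.1 h).2⟩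
  | bot => exact tendsto_bot.2 (by simpa using tendsto_bot.1 h)
  | top => exact tendsto_top.2 (by simpa using tendsto_top.1 h)

end SpaceTime

theorem neg_mem_uIcc {x a b : EReal} : -x ∈ uIcc (-a) (-b) ↔ x ∈ uIcc a b := by
  simp only [mem_uIcc, EReal.neg_le_neg_iff]
  tauto

namespace CadlagPath

variable {f g : CadlagPath}

/-- The reflection of a path. -/
def reflect (f : CadlagPath) : CadlagPath where
  σ := f.σ
  τ := f.τ
  left t := -f.left t
  right t := -f.right t
  le := f.le
  tendsto_right t h1 h2 := ((continuous_neg (G := EReal)).tendsto _).comp (f.tendsto_right t h1 h2)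
  tendsto_left t h1 h2 := ((continuous_neg (G := EReal)).tendsto _).comp (f.tendsto_left t h1 h2)
  left_off t h := by rw [f.left_off t h, neg_zero]
  right_off t h := by rw [f.right_off t h, neg_zero]

@[simp] theorem reflect_σ : f.reflect.σ = f.σ := rfl
@[simp] theorem reflect_τ : f.reflect.τ = f.τ := rfl
@[simp] theorem reflect_left (t : ℝ) : f.reflect.left t = -f.left t := rfl
@[simp] theorem reflect_right (t : ℝ) : f.reflect.right t = -f.right t := rfl

@[simp] theorem reflect_reflect (f : CadlagPath) : f.reflect.reflect = f := by
  ext <;> simp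

theorem mem_graph_reflect {z : SpaceTime} : z ∈ f.reflect.graph ↔ z.reflect ∈ f.graph := by
  cases z with
  | pt x t =>
    simp only [mem_graph_pt, SpaceTime.reflect_pt, reflect_σ, reflect_τ, reflect_left,
      reflect_right]
    rw [← neg_mem_uIcc (x := -x), neg_neg]
  | bot => exact Iff.rfl
  | top => exact Iff.rfl

theorem le_reflect {z w : SpaceTime} : f.reflect.Le z w ↔ f.Le z.reflect w.reflect := by
  rw [le_iff, le_iff, mem_graph_reflect, mem_graph_reflect]
  have : f.reflect.Before z w ↔ f.Before z.reflect w.reflect := by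
    cases z <;> cases w <;> simp only [Before, SpaceTime.reflect, reflect_left]
    rw [← neg_mem_uIcc, neg_neg]
  rw [this]

theorem le_reflect_iff {z w : SpaceTime} : f.reflect.Le z.reflect w.reflect ↔ f.Le z w := by
  rw [le_reflect, SpaceTime.reflect_reflect, SpaceTime.reflect_reflect]

theorem ExtendsTo.reflect (h : f.ExtendsTo g) : f.reflect.ExtendsTo g.reflect := by
  rintro ⟨z, w⟩ hzw
  exact le_reflect.2 (h.le (le_reflect.1 (show f.reflect.Le z w from hzw)))

theorem nonCrossing_reflect (h : f.NonCrossing g) : f.reflect.NonCrossing g.reflect := by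
  obtain ⟨f', g', h1, h2, h3, h4, h5, h6, h7⟩ := h
  refine ⟨f'.reflect, g'.reflect, h1, h2, h3, h4, h5.reflect, h6.reflect, h7.symm.imp ?_ ?_⟩ <;>
  · intro h t
    simpa using h t

theorem tendsto_reflect {ι : Type*} {U : Ultrafilter ι} {F : ι → CadlagPath}
    (h : Tendsto F U (𝓝 f)) : Tendsto (fun i => (F i).reflect) U (𝓝 f.reflect) := by
  have hc : Continuous fun p : SpaceTime × SpaceTime => (p.1.reflect, p.2.reflect) := by
    exact (continuous_reflect.comp continuous_fst).prodMk (continuous_reflect.comp continuous_snd)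
  have key : ∀ f : CadlagPath, f.reflect.graphCompact = f.graphCompact.map _ hc := fun f => by
    refine SetLike.ext fun p => ?_
    change f.reflect.Le p.1 p.2 ↔ p ∈ (fun p : SpaceTime × SpaceTime => _) '' f.graph₂
    rw [le_reflect]
    refine ⟨fun h => ⟨_, h, by simp⟩, ?_⟩
    rintro ⟨q, hq, rfl⟩
    simpa using! hq
  rw [tendsto_graphCompact] at h ⊢
  simp only [key]
  exact ((hc.nonemptyCompacts_map).tendsto _).comp h

/-! ### Paths on the left of other paths -/

/-- The half-infinite path `f` lies on the left of `g`, also when the jumps at the initial times are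
taken into account. -/
def LeftOf (f g : CadlagPath) : Prop :=
  (∀ t : ℝ, f.σ ≤ t → g.σ ≤ t → f.right t ≤ g.right t) ∧
  ∀ t : ℝ, f.σ ≤ t → g.σ ≤ t → (f.σ < t ∨ f.right t < f.left t) →
    (g.σ < t ∨ g.left t < g.right t) → f.left t ≤ g.left t

theorem LeftOf.reflect (h : f.LeftOf g) : g.reflect.LeftOf f.reflect := by
  refine ⟨fun t h1 h2 => by simpa using h.1 t h2 h1, fun t h1 h2 h3 h4 => ?_⟩
  simp only [reflect_left, reflect_right, reflect_σ, EReal.neg_lt_neg_iff, EReal.neg_le_neg_iff]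
    at *
  exact h.2 t h2 h1 h4 h3

theorem leftOf_reflect : g.reflect.LeftOf f.reflect ↔ f.LeftOf g :=
  ⟨fun h => by simpa using h.reflect, fun h => h.reflect⟩

theorem LeftOf.refl (f : CadlagPath) : f.LeftOf f := ⟨fun _ _ _ => le_rfl, fun _ _ _ _ _ => le_rfl⟩

/-- Only the right limits and the values at the later of the two initial times matter. -/
theorem leftOf_of (hf : f.τ = ⊤) (hg : g.τ = ⊤)
    (hr : ∀ t : ℝ, f.σ ≤ t → g.σ ≤ t → f.right t ≤ g.right t)
    (hl : ∀ t : ℝ, f.σ ≤ t → g.σ ≤ t → (f.σ = t ∨ g.σ = t) →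
      (f.σ < t ∨ f.right t < f.left t) → (g.σ < t ∨ g.left t < g.right t) → f.left t ≤ g.left t) :
    f.LeftOf g := by
  refine ⟨hr, fun t h1 h2 h3 h4 => ?_⟩
  by_cases h : f.σ = t ∨ g.σ = t
  · exact hl t h1 h2 h h3 h4
  · rw [not_or] at h
    have h1' := lt_of_le_of_ne h1 h.1
    have h2' := lt_of_le_of_ne h2 h.2
    refine le_of_tendsto_of_tendsto (f.tendsto_left t h1' (by simp [hf]))
      (g.tendsto_left t h2' (by simp [hg])) ?_
    filter_upwards [nhdsWithin_le_nhds (eventually_lt_of_lt h1'),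
      nhdsWithin_le_nhds (eventually_lt_of_lt h2')] with s hs hs'
    exact hr s hs.le hs'.le

/-- This explains the side conditions in `LeftOf`. If f starts at t with a jump to the left, its
initial point lies between f(t+) and f'(t-), so f(t-) ≤ f'(t-). If it starts with a jump to the
right, f' may come from arbitrarily far left and nothing can be said about f(t-). -/
theorem leftOf_of_extends {f' g' : CadlagPath} (hf : f.τ = ⊤) (hg : g.τ = ⊤) (hff : f.ExtendsTo f')
    (hgg : g.ExtendsTo g') (h : ∀ t, f'.left t ≤ g'.left t ∧ f'.right t ≤ g'.right t) :
    f.LeftOf g := by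
  refine ⟨fun t h1 h2 => ?_, fun t h1 h2 h3 h4 => ?_⟩
  · rw [hff.right_eq hf h1, hgg.right_eq hg h2]
    exact (h t).2
  · have ha : f.left t ≤ f'.left t := by
      rcases h1.lt_or_eq with h' | h'
      · exact (hff.left_eq hf h').le
      · have h3' := h3.resolve_left h'.not_lt
        have := hff.left_mem hf h'
        rw [hff.right_eq hf h1] at h3'
        rcases mem_uIcc.1 this with h5 | h5
        · exact absurd h5.2 h3'.not_ge
        · exact h5.2
    have hb : g'.left t ≤ g.left t := by
      rcases h2.lt_or_eq with h' | h'
      · exact (hgg.left_eq hg h').ge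
      · have h4' := h4.resolve_left h'.not_lt
        have := hgg.left_mem hg h'
        rw [hgg.right_eq hg h2] at h4'
        rcases mem_uIcc.1 this with h5 | h5
        · exact h5.1
        · exact absurd h5.1 h4'.not_ge
    exact ha.trans ((h t).1.trans hb)

theorem NonCrossing.leftOf (h : f.NonCrossing g) (hf : f.τ = ⊤) (hg : g.τ = ⊤) :
    f.LeftOf g ∨ g.LeftOf f := by
  obtain ⟨f', g', -, -, -, -, h5, h6, h7⟩ := h
  exact h7.imp (leftOf_of_extends hf hg h5 h6) (leftOf_of_extends hg hf h6 h5)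

theorem NonCrossing.symm (h : f.NonCrossing g) : g.NonCrossing f := by
  obtain ⟨f', g', h1, h2, h3, h4, h5, h6, h7⟩ := h
  exact ⟨g', f', h3, h4, h1, h2, h6, h5, h7.symm⟩

theorem NonCrossing.mono {f₁ g₁ : CadlagPath} (h : f.NonCrossing g) (hf : f₁.ExtendsTo f)
    (hg : g₁.ExtendsTo g) : f₁.NonCrossing g₁ := by
  obtain ⟨f', g', h1, h2, h3, h4, h5, h6, h7⟩ := h
  exact ⟨f', g', h1, h2, h3, h4, hf.trans h5, hg.trans h6, h7⟩

/-- The bi-infinite path that has right limits `R` and left limits `L` before the initial time of `f`,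
and is equal to `f` afterwards. -/
def glue (f : CadlagPath) (hf : f.τ = ⊤) (L R : ℝ → EReal)
    (hR : ∀ t : ℝ, t < f.σ → Tendsto R (𝓝[>] t) (𝓝 (R t)))
    (hL : ∀ t : ℝ, t ≤ f.σ → Tendsto R (𝓝[<] t) (𝓝 (L t))) : CadlagPath where
  σ := ⊥
  τ := ⊤
  left t := if t ≤ f.σ then L t else f.left t
  right t := if t < f.σ then R t else f.right t
  le := bot_le
  tendsto_right t _ _ := by
    split_ifs with h
    · refine (hR t h).congr' ?_
      filter_upwards [nhdsWithin_le_nhds (eventually_gt_of_gt h)] with s hs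
      rw [if_pos hs]
    · refine (f.tendsto_right t (not_lt.1 h) (by simp [hf])).congr' ?_
      filter_upwards [self_mem_nhdsWithin] with s hs
      rw [if_neg ((not_lt.1 h).trans (EReal.coe_le_coe_iff.2 (le_of_lt hs))).not_gt]
  tendsto_left t _ _ := by
    split_ifs with h
    · refine (hL t h).congr' ?_
      filter_upwards [self_mem_nhdsWithin] with s hs
      rw [if_pos ((EReal.coe_lt_coe_iff.2 hs).trans_le h)]
    · refine (f.tendsto_left t (not_le.1 h) (by simp [hf])).congr' ?_
      filter_upwards [nhdsWithin_le_nhds (eventually_lt_of_lt (not_le.1 h))] with s hs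
      rw [if_neg hs.le.not_gt]
  left_off t h := absurd ⟨bot_le, le_top⟩ h
  right_off t h := absurd ⟨bot_le, le_top⟩ h

section Glue
variable {hf : f.τ = ⊤} {L R : ℝ → EReal} {hR : ∀ t : ℝ, t < f.σ → Tendsto R (𝓝[>] t) (𝓝 (R t))}
  {hL : ∀ t : ℝ, t ≤ f.σ → Tendsto R (𝓝[<] t) (𝓝 (L t))} {t : ℝ}

@[simp] theorem glue_σ : (f.glue hf L R hR hL).σ = ⊥ := rfl
@[simp] theorem glue_τ : (f.glue hf L R hR hL).τ = ⊤ := rfl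

theorem glue_left_of_le (h : t ≤ f.σ) : (f.glue hf L R hR hL).left t = L t := if_pos h

theorem glue_left_of_gt (h : f.σ < t) : (f.glue hf L R hR hL).left t = f.left t := if_neg h.not_ge

theorem glue_right_of_lt (h : t < f.σ) : (f.glue hf L R hR hL).right t = R t := if_pos h

theorem glue_right_of_ge (h : f.σ ≤ t) : (f.glue hf L R hR hL).right t = f.right t :=
  if_neg h.not_gt

theorem extendsTo_glue (h : ∀ t : ℝ, f.σ = t → f.left t ∈ uIcc (L t) (f.right t)) :
    f.ExtendsTo (f.glue hf L R hR hL) := by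
  refine extendsTo_of rfl bot_le (fun t ht => (glue_right_of_ge ht).symm)
    (fun t ht => (glue_left_of_gt ht).symm) (fun t ht => ?_)
  rw [glue_left_of_le ht.ge, glue_right_of_ge ht.le]
  exact h t ht

end Glue

/-- The bi-infinite path that is constant before the initial time of `f`. -/
def glueConst (f : CadlagPath) (hf : f.τ = ⊤) (c : EReal) : CadlagPath :=
  f.glue hf (fun _ => c) (fun _ => c) (fun _ _ => tendsto_const_nhds) fun _ _ => tendsto_const_nhds

theorem glueConst_left {hf : f.τ = ⊤} {c : EReal} {t : ℝ} (h : t ≤ f.σ) :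
    (f.glueConst hf c).left t = c := glue_left_of_le h

theorem glueConst_right {hf : f.τ = ⊤} {c : EReal} {t : ℝ} (h : t < f.σ) :
    (f.glueConst hf c).right t = c := glue_right_of_lt h

/-- Before the start of f, the extension of f runs along that of g if f starts with a jump to the
left, and along -∞ otherwise. -/
theorem LeftOf.nonCrossing_of_lt (h : f.LeftOf g) (hf : f.τ = ⊤) (hg : g.τ = ⊤)
    (hlt : g.σ < f.σ) : f.NonCrossing g := by
  -- When g starts at -∞ there are no earlier times, and 0 is a dummy.
  let g' := g.glueConst hg (if g.σ = ⊥ then 0 else g.left g.σ.toReal)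
  have hgg : g.ExtendsTo g' := extendsTo_glue fun t ht => by simp [ht]
  by_cases hj : ∃ t : ℝ, f.σ = t ∧ f.right t < f.left t
  · obtain ⟨a, ha, hj⟩ := hj
    have hle : f.left a ≤ g.left a :=
      h.2 a ha.le (hlt.le.trans_eq ha) (.inr hj) (.inl (hlt.trans_eq ha))
    let f' := f.glue hf g'.left g'.right (fun t _ => g'.tendsto_right t bot_le (by simp [g', glueConst]))
      (fun t _ => g'.tendsto_left t (by simp [g', glueConst]) le_top)
    have hff : f.ExtendsTo f' := extendsTo_glue fun t ht => by
      obtain rfl : a = t := by rw [ha] at ht; exact_mod_cast ht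
      rw [← hgg.left_eq hg (hlt.trans_eq ha)]
      exact mem_uIcc.2 (.inr ⟨hj.le, hle⟩)
    refine ⟨f', g', rfl, rfl, rfl, rfl, hff, hgg, .inl fun t => ⟨?_, ?_⟩⟩
    · rcases le_or_gt (t : EReal) f.σ with ht | ht
      · exact (glue_left_of_le ht).le
      · rw [← hff.left_eq hf ht, ← hgg.left_eq hg (hlt.trans ht)]
        exact h.2 t ht.le (hlt.trans ht).le (.inl ht) (.inl (hlt.trans ht))
    · rcases lt_or_ge (t : EReal) f.σ with ht | ht
      · exact (glue_right_of_lt ht).le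
      · rw [← hff.right_eq hf ht, ← hgg.right_eq hg (hlt.le.trans ht)]
        exact h.1 t ht (hlt.le.trans ht)
  · push Not at hj
    let f' := f.glueConst hf ⊥
    have hff : f.ExtendsTo f' := extendsTo_glue fun t ht => by simp [hj t ht]
    refine ⟨f', g', rfl, rfl, rfl, rfl, hff, hgg, .inl fun t => ⟨?_, ?_⟩⟩
    · rcases le_or_gt (t : EReal) f.σ with ht | ht
      · exact (glue_left_of_le ht).le.trans bot_le
      · rw [← hff.left_eq hf ht, ← hgg.left_eq hg (hlt.trans ht)]
        exact h.2 t ht.le (hlt.trans ht).le (.inl ht) (.inl (hlt.trans ht))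
    · rcases lt_or_ge (t : EReal) f.σ with ht | ht
      · exact (glue_right_of_lt ht).le.trans bot_le
      · rw [← hff.right_eq hf ht, ← hgg.right_eq hg (hlt.le.trans ht)]
        exact h.1 t ht (hlt.le.trans ht)

/-- Constant extensions `c ≤ d` suffice. If the initial points are in the wrong order, `LeftOf`
excludes that f starts with a jump to the left while g starts with one to the right, so `c = ⊥` or
`d = ⊤` is available. -/
theorem LeftOf.nonCrossing_of_eq (h : f.LeftOf g) (hf : f.τ = ⊤) (hg : g.τ = ⊤)
    (heq : f.σ = g.σ) : f.NonCrossing g := by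
  obtain ⟨c, d, hcd, hc, hd⟩ : ∃ c d : EReal, c ≤ d ∧
      (∀ t : ℝ, f.σ = t → f.left t ∈ uIcc c (f.right t)) ∧
      (∀ t : ℝ, g.σ = t → g.left t ∈ uIcc d (g.right t)) := by
    by_cases hr : ∃ a : ℝ, f.σ = a
    · obtain ⟨a, ha⟩ := hr
      have ha' := heq.symm.trans ha
      have hall : ∀ t : ℝ, f.σ = t → t = a := fun t ht => by
        rw [ha] at ht; exact_mod_cast ht.symm
      suffices hs : ∃ c d : EReal, c ≤ d ∧ f.left a ∈ uIcc c (f.right a) ∧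
          g.left a ∈ uIcc d (g.right a) by
        obtain ⟨c, d, h1, h2, h3⟩ := hs
        refine ⟨c, d, h1, fun t ht => ?_, fun t ht => ?_⟩
        · rwa [hall t ht]
        · rwa [hall t (heq.trans ht)]
      rcases le_or_gt (f.left a) (g.left a) with hle | hlt
      · exact ⟨_, _, hle, left_mem_uIcc, left_mem_uIcc⟩
      · rcases le_or_gt (f.left a) (f.right a) with h1 | h1
        · exact ⟨⊥, _, bot_le, mem_uIcc.2 (.inl ⟨bot_le, h1⟩), left_mem_uIcc⟩
        · rcases le_or_gt (g.right a) (g.left a) with h2 | h2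
          · exact ⟨_, ⊤, le_top, left_mem_uIcc, mem_uIcc.2 (.inr ⟨h2, le_top⟩)⟩
          · exact absurd (h.2 a ha.le ha'.le (.inr h1) (.inr h2)) hlt.not_ge
    · exact ⟨0, 0, le_rfl, fun t ht => absurd ⟨t, ht⟩ hr,
        fun t ht => absurd ⟨t, heq.trans ht⟩ hr⟩
  have hff : f.ExtendsTo (f.glueConst hf c) := extendsTo_glue hc
  have hgg : g.ExtendsTo (g.glueConst hg d) := extendsTo_glue hd
  refine ⟨_, _, rfl, rfl, rfl, rfl, hff, hgg, .inl fun t => ⟨?_, ?_⟩⟩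
  · rcases le_or_gt (t : EReal) f.σ with ht | ht
    · rwa [glueConst_left ht, glueConst_left (ht.trans_eq heq)]
    · rw [← hff.left_eq hf ht, ← hgg.left_eq hg (heq ▸ ht)]
      exact h.2 t ht.le (heq ▸ ht.le) (.inl ht) (.inl (heq ▸ ht))
  · rcases lt_or_ge (t : EReal) f.σ with ht | ht
    · rwa [glueConst_right ht, glueConst_right (ht.trans_eq heq)]
    · rw [← hff.right_eq hf ht, ← hgg.right_eq hg (heq ▸ ht)]
      exact h.1 t ht (heq ▸ ht)

theorem LeftOf.nonCrossing (h : f.LeftOf g) (hf : f.τ = ⊤) (hg : g.τ = ⊤) : f.NonCrossing g := by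
  rcases lt_trichotomy f.σ g.σ with hlt | heq | hlt
  · have := nonCrossing_reflect (h.reflect.nonCrossing_of_lt hg hf hlt)
    rw [reflect_reflect, reflect_reflect] at this
    exact this.symm
  · exact h.nonCrossing_of_eq hf hg heq
  · exact h.nonCrossing_of_lt hf hg hlt

theorem nonCrossing_iff (hf : f.τ = ⊤) (hg : g.τ = ⊤) :
    f.NonCrossing g ↔ f.LeftOf g ∨ g.LeftOf f :=
  ⟨fun h => h.leftOf hf hg, fun h => h.elim (fun h => h.nonCrossing hf hg)
    fun h => (h.nonCrossing hg hf).symm⟩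

end CadlagPath
end

section

/-! ### Limits of paths that do not cross a pervasive family -/

open SpaceTime CadlagPath

namespace CadlagPath

variable {f g h k l : CadlagPath}

/-- Two non-crossing paths cannot traverse the same spatial interval at the same time in opposite
directions. -/
theorem NonCrossing.not_opposite (h : l.NonCrossing k) (hl : l.τ = ⊤) (hk : k.τ = ⊤) {t : ℝ}
    {a b c d u v : EReal} (hab : l.Le (pt a t) (pt b t)) (hcd : k.Le (pt c t) (pt d t))
    (huv : u < v) (ha : a ≤ u) (hb : v ≤ b) (hc : v ≤ c) (hd : d ≤ u) : False := by
  have h1 := le_pt.1 hab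
  have h2 := le_pt.1 hcd
  have a1 : l.left t ≤ u := by
    rcases mem_uIcc.1 h1.2.2.2 with h | h
    · exact h.1.trans ha
    · exact absurd (huv.trans_le hb) (h.1.trans ha).not_gt
  have a2 : v ≤ l.right t := by
    rcases mem_uIcc.1 h1.2.2.1 with h | h
    · exact hb.trans h.2
    · exact absurd (huv.trans_le hb) (h.2.trans a1).not_gt
  have b1 : v ≤ k.left t := by
    rcases mem_uIcc.1 h2.2.2.2 with h | h
    · exact absurd (huv.trans_le hc) (h.2.trans hd).not_gt
    · exact hc.trans h.2
  have b2 : k.right t ≤ u := by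
    rcases mem_uIcc.1 h2.2.2.1 with h | h
    · exact absurd (huv.trans_le b1) (h.1.trans hd).not_gt
    · exact h.1.trans hd
  rcases h.leftOf hl hk with h | h
  · exact huv.not_ge (a2.trans ((h.1 t h1.1 h2.1).trans b2))
  -- Here k jumps to the left and l to the right, so left values are comparable even if t is an
  -- initial time of one of them.
  · refine huv.not_ge (b1.trans ((h.2 t h2.1 h1.1 (.inr ?_) (.inr ?_)).trans a1))
    · exact b2.trans_lt (huv.trans_le b1)
    · exact a1.trans_lt (huv.trans_le a2)

/-- One strict comparison decides the side. Were f on the left of k, then k(s+) would exceed `m`, so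
k would jump to the right at s from k(s-) ≤ `m`; the left values are then comparable and give f(s-)
≤ `m`. -/
theorem NonCrossing.leftOf_of_lt (h : k.NonCrossing f) (hk : k.τ = ⊤) (hf : f.τ = ⊤) {s : ℝ}
    {m : EReal} (hs : f.σ < s) (hm : pt m s ∈ k.graph) (h1 : m < f.left s) (h2 : m < f.right s) :
    k.LeftOf f := by
  refine (h.leftOf hk hf).resolve_right fun hc => ?_
  have h3 := h2.trans_le (hc.1 s hs.le hm.1)
  have h4 : k.left s ≤ m := by
    rcases mem_uIcc.1 hm.2.2 with h | h
    · exact h.1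
    · exact absurd h3 h.1.not_gt
  exact h1.not_ge ((hc.2 s hs.le hm.1 (.inl hs) (.inr (h4.trans_lt h3))).trans h4)

theorem NonCrossing.leftOf_of_gt (h : k.NonCrossing f) (hk : k.τ = ⊤) (hf : f.τ = ⊤) {s : ℝ}
    {m : EReal} (hs : f.σ < s) (hm : pt m s ∈ k.graph) (h1 : f.left s < m) (h2 : f.right s < m) :
    f.LeftOf k := by
  rw [← leftOf_reflect]
  refine (nonCrossing_reflect h).leftOf_of_lt (m := -m) hk hf hs ?_ (by simpa) (by simpa)
  rw [mem_graph_reflect]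
  simpa using hm

/-- A move of a path to the right is shared by a path of any pervasive family that it does not cross,
starting from any intermediate point. -/
theorem exists_move_right {A : Set CadlagPath} (hf : f ∈ biInfinite) (hA : A ⊆ halfInfinite)
    (hperv : IsPervasive A) (hnc : ∀ k ∈ A, f.NonCrossing k) {x y m : EReal} {s u ε : ℝ}
    (hε : 0 < ε) (hle : f.Le (pt x s) (pt y u)) (hx : x < m) (hy : m < y) :
    ∃ l ∈ A, ∃ r y', s - ε < r ∧ y ≤ y' ∧ l.Le (pt m r) (pt y' u) := by
  have hσ : ∀ t : ℝ, f.σ < t := fun t => by simp [hf.1]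
  have hτ : ∀ t : ℝ, t < f.τ := fun t => by simp [hf.2]
  have hsu : s ≤ u := by simpa using hle.time_le
  -- A time at which f is entirely below `m`: just before s if f(s-) < `m`; otherwise f jumps at s
  -- down below `m`, so the ascent takes place after s and a time just after s works.
  obtain ⟨r, hr1, hr2, hr3, hr4⟩ : ∃ r, s - ε < r ∧ r < u ∧ f.left r < m ∧ f.right r < m := by
    by_cases hl : f.left s < m
    · have h1 := (f.left_tendsto_left (hσ s) (hτ s).le).eventually_lt_const hl
      have h2 := (f.tendsto_left s (hσ s) (hτ s).le).eventually_lt_const hl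
      obtain ⟨r, h1, h2, h3⟩ := (h1.and (h2.and (Ioo_mem_nhdsLT (sub_lt_self s hε)))).exists
      exact ⟨r, h3.1, h3.2.trans_le hsu, h1, h2⟩
    · have hl' := not_lt.1 hl
      have hr : f.right s < m := by
        rcases mem_uIcc.1 hle.left_mem.2.2 with h | h
        · exact absurd (hx.trans_le hl') h.1.not_gt
        · exact h.1.trans_lt hx
      have hsu' : s < u := by
        refine lt_of_le_of_ne hsu ?_
        rintro rfl
        rcases mem_uIcc.1 (le_pt.1 hle).2.2.2 with h | h
        · exact (hx.trans_le hl').not_ge h.1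
        · exact (hx.trans hy).not_ge h.1
      have h1 := (f.left_tendsto_right (hσ s).le (hτ s)).eventually_lt_const hr
      have h2 := (f.tendsto_right s (hσ s).le (hτ s)).eventually_lt_const hr
      obtain ⟨r, h1, h2, h3⟩ := (h1.and (h2.and (Ioo_mem_nhdsGT hsu'))).exists
      exact ⟨r, (sub_lt_self s hε).trans h3.1, h3.2, h1, h2⟩
  -- A path of the family through (`m`, r) is on the right of f, so by time u it has been pushed at
  -- least as far as `y`.
  obtain ⟨l, hlA, hl⟩ := hperv (pt m r)
  have hlo := (hnc l hlA).symm.leftOf_of_gt (hA hlA) hf.2 (hσ r) hl hr3 hr4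
  have hru : (r : EReal) < u := EReal.coe_lt_coe_iff.2 hr2
  have hlu : l.σ < u := hl.1.trans_lt hru
  have hlτ : (u : EReal) ≤ l.τ := by simp [show l.τ = ⊤ from hA hlA]
  have hL := hlo.2 u (hσ u).le hlu.le (.inl (hσ u)) (.inl hlu)
  have hR := hlo.1 u (hσ u).le hlu.le
  refine ⟨l, hlA, r, l.left u ⊔ l.right u, hr1,
    hle.right_mem.2.2.2.trans (sup_le_sup hL hR), ?_⟩
  refine le_of_time_lt hl ⟨hlu.le, hlτ, ?_⟩ (by simpa using hr2)
  exact ⟨inf_le_sup, le_rfl⟩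

end CadlagPath

theorem exists_tendsto_pt_of_time {ι : Type*} {U : Ultrafilter ι} {z : ι → SpaceTime} {t : ℝ}
    (h : Tendsto (fun i => (z i).time) U (𝓝 (t : EReal))) :
    ∃ x, Tendsto z U (𝓝 (pt x t)) ∧ Tendsto (fun i => (z i).space) U (𝓝 x) := by
  obtain ⟨w, hw⟩ := exists_tendsto U z
  have ht := tendsto_nhds_unique ((continuous_time.tendsto w).comp hw) h
  rw [eq_pt_of_time ht] at hw
  exact ⟨w.space, hw, (tendsto_pt.1 hw).2⟩

/-- Bi-infinite paths `F i` that do not cross the pervasive families `A i`, where limits of elements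
of `A i` along `U` belong to the non-crossing set `B`. -/
structure IsFlowFamily {ι : Type*} (U : Ultrafilter ι) (A : ι → Set CadlagPath)
    (B : Set CadlagPath) (F : ι → CadlagPath) : Prop where
  exists_small : ∃ ε : ι → ℝ, (∀ i, 0 < ε i) ∧ Tendsto ε U (𝓝 0)
  half : ∀ i, A i ⊆ halfInfinite
  pervasive : ∀ i, IsPervasive (A i)
  biInf : ∀ i, F i ∈ biInfinite
  nonCrossing : ∀ i, ∀ k ∈ A i, (F i).NonCrossing k
  lim : ∀ h : ι → CadlagPath, (∀ i, h i ∈ A i) → ∃ h' ∈ B, Tendsto h U (𝓝 h')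
  half_lim : B ⊆ halfInfinite
  nonCrossing_lim : IsNonCrossing B

namespace IsFlowFamily

variable {ι : Type*} {U : Ultrafilter ι} {A : ι → Set CadlagPath} {B : Set CadlagPath}
  {F : ι → CadlagPath}

theorem reflect (H : IsFlowFamily U A B F) :
    IsFlowFamily U (fun i => CadlagPath.reflect ⁻¹' A i) (CadlagPath.reflect ⁻¹' B)
      fun i => (F i).reflect where
  exists_small := H.exists_small
  half i k hk :=
    have h : k.reflect ∈ halfInfinite := H.half i hk
    h
  pervasive i z := by
    obtain ⟨k, hk, hz⟩ := H.pervasive i z.reflect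
    exact ⟨k.reflect, by simpa using hk, mem_graph_reflect.2 hz⟩
  biInf i := H.biInf i
  nonCrossing i k hk := by
    simpa using nonCrossing_reflect (H.nonCrossing i _ hk)
  lim h hh := by
    obtain ⟨h', h1, h2⟩ := H.lim (fun i => (h i).reflect) hh
    exact ⟨h'.reflect, by simpa using h1, by simpa using tendsto_reflect h2⟩
  half_lim k hk :=
    have h : k.reflect ∈ halfInfinite := H.half_lim hk
    h
  nonCrossing_lim f hf g hg := by
    simpa using nonCrossing_reflect (H.nonCrossing_lim _ hf _ hg)

/-- When the moves of `F i` become instantaneous, so do the shared moves in `A i`: these start at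
most `ε i` earlier. A limit of the sharing paths therefore jumps at time t. -/
theorem exists_lim_move_right (H : IsFlowFamily U A B F) {z w : ι → SpaceTime} {x y m : EReal}
    {t : ℝ} (hle : ∀ᶠ i in U, (F i).Le (z i) (w i)) (hz : Tendsto z U (𝓝 (pt x t)))
    (hw : Tendsto w U (𝓝 (pt y t))) (hx : x < m) (hy : m < y) :
    ∃ h ∈ B, ∃ y', y ≤ y' ∧ h.Le (pt m t) (pt y' t) := by
  obtain ⟨ε, hε, hε0⟩ := H.exists_small
  obtain ⟨hz1, hz2⟩ := tendsto_pt.1 hz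
  obtain ⟨hw1, hw2⟩ := tendsto_pt.1 hw
  have hev : ∀ᶠ i in U, ∃ l ∈ A i, ∃ r y', (z i).time.toReal - ε i < r ∧ (w i).space ≤ y' ∧
      l.Le (pt m r) (pt y' (w i).time.toReal) := by
    filter_upwards [hle, eventually_coe_toReal_time hz1, eventually_coe_toReal_time hw1,
      hz2.eventually_lt_const hx, hw2.eventually_const_lt hy] with i h1 h2 h3 h4 h5
    rw [h2, h3] at h1
    exact exists_move_right (H.biInf i) (H.half i) (H.pervasive i) (H.nonCrossing i) (hε i) h1 h4 h5
  -- For indices without such a move an arbitrary element of `A i` is a dummy, so that `H.lim`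
  -- applies to the whole family.
  have hex : ∀ i, ∃ l ∈ A i, (∃ l ∈ A i, ∃ r y', (z i).time.toReal - ε i < r ∧ (w i).space ≤ y' ∧
      l.Le (pt m r) (pt y' (w i).time.toReal)) → ∃ r y', (z i).time.toReal - ε i < r ∧
      (w i).space ≤ y' ∧ l.Le (pt m r) (pt y' (w i).time.toReal) := fun i => by
    by_cases hi : ∃ l ∈ A i, ∃ r y', (z i).time.toReal - ε i < r ∧ (w i).space ≤ y' ∧
      l.Le (pt m r) (pt y' (w i).time.toReal)
    · obtain ⟨l, hl, h⟩ := hi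
      exact ⟨l, hl, fun _ => h⟩
    · obtain ⟨l, hl, -⟩ := H.pervasive i top
      exact ⟨l, hl, fun h => absurd h hi⟩
  choose l hlA hl using hex
  choose! r y' h1 h2 h3 using hl
  obtain ⟨h, hB, hlim⟩ := H.lim l hlA
  have hrt : Tendsto r U (𝓝 t) := by
    have ha := (tendsto_toReal_time hz1).sub hε0
    rw [sub_zero] at ha
    refine tendsto_of_tendsto_of_tendsto_of_le_of_le' ha (tendsto_toReal_time hw1) ?_ ?_
    · exact hev.mono fun i hi => (h1 i hi).le
    · exact hev.mono fun i hi => by simpa using (h3 i hi).time_le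
  have hp : Tendsto (fun i => pt m (r i)) U (𝓝 (pt m t)) :=
    tendsto_pt.2 ⟨(continuous_coe_real_ereal.tendsto t).comp hrt, tendsto_const_nhds⟩
  obtain ⟨y₀, hq1, hq2⟩ := exists_tendsto_pt_of_time (U := U)
    (z := fun i => pt (y' i) (w i).time.toReal) (t := t)
    ((continuous_coe_real_ereal.tendsto t).comp (tendsto_toReal_time hw1))
  exact ⟨h, hB, y₀, le_of_tendsto_of_tendsto hw2 hq2 (hev.mono h2),
    le_of_tendsto_path hlim (hev.mono h3) hp hq1⟩

theorem exists_lim_move_left (H : IsFlowFamily U A B F) {z w : ι → SpaceTime} {x y m : EReal}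
    {t : ℝ} (hle : ∀ᶠ i in U, (F i).Le (z i) (w i)) (hz : Tendsto z U (𝓝 (pt x t)))
    (hw : Tendsto w U (𝓝 (pt y t))) (hx : m < x) (hy : y < m) :
    ∃ h ∈ B, ∃ y', y' ≤ y ∧ h.Le (pt m t) (pt y' t) := by
  obtain ⟨h, hB, y', h1, h2⟩ := H.reflect.exists_lim_move_right (z := fun i => (z i).reflect)
    (w := fun i => (w i).reflect) (x := -x) (y := -y) (m := -m) (t := t)
    (hle.mono fun i hi => le_reflect_iff.2 hi) ((continuous_reflect.tendsto _).comp hz)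
    ((continuous_reflect.tendsto _).comp hw) (by simpa) (by simpa)
  refine ⟨h.reflect, hB, -y', EReal.neg_le_of_neg_le h1, ?_⟩
  rw [le_reflect]
  simpa using h2

/-- An oscillation of `F i` between x and y yields two elements of `B` that traverse `[m', m]` in
opposite directions at time t. -/
theorem exists_tendsto (H : IsFlowFamily U A B F) : ∃ f ∈ biInfinite, Tendsto F U (𝓝 f) := by
  obtain ⟨f, hf, hf'⟩ := exists_tendsto_of_no_oscillation (U := U) (fun i => (H.biInf i).2)
    (fun z w z' w' x y t hxy h1 h2 h3 h4 h5 h6 => by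
      obtain ⟨m, hm, hmy⟩ := _root_.exists_between hxy
      obtain ⟨m', hm', hmm⟩ := _root_.exists_between hm
      obtain ⟨l, hl, y', hy', hl'⟩ :=
        H.exists_lim_move_right (.of_forall h1) h3 h4 hm' (hmm.trans hmy)
      obtain ⟨k, hk, x', hx', hk'⟩ := H.exists_lim_move_left (.of_forall h2) h5 h6 hmy hm
      exact (H.nonCrossing_lim l hl k hk).not_opposite (H.half_lim hl) (H.half_lim hk) hl' hk' hmm
        le_rfl (hmy.le.trans hy') le_rfl (hx'.trans hm'.le))
  exact ⟨f, ⟨bot_of_tendsto hf' (.of_forall fun i => (H.biInf i).1), hf⟩, hf'⟩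

end IsFlowFamily

namespace CadlagPath

variable {ι : Type*} {U : Ultrafilter ι} {F : ι → CadlagPath} {f : CadlagPath}

/-- M1 convergence does not give convergence of the values at s, but all limits of them lie in the
segment between f(s-) and f(s+). -/
theorem eventually_right_lt (hF : Tendsto F U (𝓝 f)) {s : ℝ} {c : EReal}
    (hσ : ∀ᶠ i in U, (F i).σ ≤ s) (hτ : ∀ᶠ i in U, (F i).τ = ⊤) (h1 : f.left s < c)
    (h2 : f.right s < c) : ∀ᶠ i in U, (F i).right s < c := by
  by_contra hc
  rw [← Ultrafilter.eventually_not] at hc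
  obtain ⟨x, hx1, hx2⟩ := exists_tendsto_pt_of_time (U := U)
    (z := fun i => pt ((F i).right s) s) (t := s) tendsto_const_nhds
  have hmem := mem_graph_of_tendsto_path hF
    ((hσ.and hτ).mono fun i hi => pt_right_mem hi.1 (by simp [hi.2])) hx1
  have hcx : c ≤ x := ge_of_tendsto hx2 (hc.mono fun i hi => not_lt.1 hi)
  exact (hmem.2.2.2.trans_lt (max_lt h1 h2)).not_ge hcx

theorem eventually_lt_right (hF : Tendsto F U (𝓝 f)) {s : ℝ} {c : EReal}
    (hσ : ∀ᶠ i in U, (F i).σ ≤ s) (hτ : ∀ᶠ i in U, (F i).τ = ⊤) (h1 : c < f.left s)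
    (h2 : c < f.right s) : ∀ᶠ i in U, c < (F i).right s := by
  have := eventually_right_lt (c := -c) (tendsto_reflect hF) hσ hτ (by simpa) (by simpa)
  simpa using this

theorem eventually_σ_lt (hF : Tendsto F U (𝓝 f)) {s : EReal} (hs : f.σ < s) :
    ∀ᶠ i in U, (F i).σ < s := by
  have h := (continuous_time.tendsto _).comp (tendsto_initialPoint hF)
  rw [time_initialPoint] at h
  filter_upwards [h.eventually_lt_const hs] with i hi
  rwa [← time_initialPoint]

/-- If f(t+) > c > g(t+), then at some time s shortly after t the whole jump segments of f and g are
on different sides of c. This separation at s passes to `F i` and `G i`. -/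
theorem right_le_of_tendsto {G : ι → CadlagPath} {g : CadlagPath} (hF : Tendsto F U (𝓝 f))
    (hG : Tendsto G U (𝓝 g)) (hFτ : ∀ i, (F i).τ = ⊤) (hGτ : ∀ i, (G i).τ = ⊤)
    (h : ∀ᶠ i in U, (F i).LeftOf (G i)) {t : ℝ} (hft : f.σ ≤ t) (hgt : g.σ ≤ t) :
    f.right t ≤ g.right t := by
  by_contra hc
  obtain ⟨c, hc1, hc2⟩ := _root_.exists_between (not_le.1 hc)
  have hfτ : (t : EReal) < f.τ := by simp [top_of_tendsto hF (.of_forall hFτ)]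
  have hgτ : (t : EReal) < g.τ := by simp [top_of_tendsto hG (.of_forall hGτ)]
  obtain ⟨s, h1, h2, h3, h4, h5⟩ := ((f.left_tendsto_right hft hfτ).eventually_const_lt hc2 |>.and
    ((f.tendsto_right t hft hfτ).eventually_const_lt hc2 |>.and
    ((g.left_tendsto_right hgt hgτ).eventually_lt_const hc1 |>.and
    ((g.tendsto_right t hgt hgτ).eventually_lt_const hc1 |>.and self_mem_nhdsWithin)))).exists
  have hts : (t : EReal) < s := EReal.coe_lt_coe_iff.2 h5
  have hFσ := eventually_σ_lt hF (hft.trans_lt hts)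
  have hGσ := eventually_σ_lt hG (hgt.trans_lt hts)
  obtain ⟨i, a, b, c, d, e⟩ := (h.and (hFσ.and (hGσ.and
    ((eventually_lt_right hF (hFσ.mono fun _ h => h.le) (.of_forall hFτ) h1 h2).and
    (eventually_right_lt hG (hGσ.mono fun _ h => h.le) (.of_forall hGτ) h3 h4))))).exists
  exact (e.trans d).not_ge (a.1 s b.le c.le)

end CadlagPath

namespace IsFlowFamily

variable {ι : Type*} {U : Ultrafilter ι} {A : ι → Set CadlagPath} {B : Set CadlagPath}
  {F : ι → CadlagPath}

/-- Left values are at stake only where g starts with a jump to the right. If f(t-) were beyond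
g(t-), f would have to move left at time t in order to meet a point not beyond g(t-); the weave path
in `B` sharing that move would be opposite to the jump of g. -/
theorem leftOf_of_tendsto (H : IsFlowFamily U A B F) {f g : CadlagPath} {G : ι → CadlagPath}
    (hF : Tendsto F U (𝓝 f)) (hG : Tendsto G U (𝓝 g)) (hGA : ∀ i, G i ∈ A i) (hgB : g ∈ B)
    (h : ∀ᶠ i in U, (F i).LeftOf (G i)) : f.LeftOf g := by
  have hfσ : f.σ = ⊥ := bot_of_tendsto hF (.of_forall fun i => (H.biInf i).1)
  have hfτ : f.τ = ⊤ := top_of_tendsto hF (.of_forall fun i => (H.biInf i).2)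
  have hgτ : g.τ = ⊤ := H.half_lim hgB
  refine leftOf_of hfτ hgτ (fun t h1 h2 => right_le_of_tendsto hF hG (fun i => (H.biInf i).2)
    (fun i => H.half i (hGA i)) h h1 h2) fun t h1 h2 h3 _ h5 => ?_
  have hgt : g.σ = t := h3.resolve_left (by simp [hfσ])
  have hlr := h5.resolve_left hgt.not_lt
  by_contra hc
  rw [not_le] at hc
  have hi := CadlagPath.tendsto_initialPoint hG
  rw [initialPoint_of_eq hgt] at hi
  obtain ⟨hi1, hi2⟩ := tendsto_pt.1 hi
  -- Whatever the direction of the initial jump of `G i`, one of the two values of `F i` at that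
  -- time is not on the right of its initial point.
  have hex : ∀ᶠ i in U, ∃ x, x ≤ (G i).initialPoint.space ∧
      pt x (G i).initialPoint.time.toReal ∈ (F i).graph := by
    filter_upwards [h, eventually_coe_toReal_time hi1] with i hi hi'
    generalize hz : (G i).initialPoint = z at hi' ⊢
    generalize z.time.toReal = s at hi' ⊢
    generalize z.space = y at hi' ⊢
    subst hi'
    have hs : (G i).σ = s := by rw [← time_initialPoint, hz, time_pt]
    rw [initialPoint_of_eq hs] at hz
    simp only [pt.injEq, and_true] at hz
    rw [← hz]
    have hFσ : (F i).σ < s := by simp [(H.biInf i).1]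
    have hFτ : (s : EReal) ≤ (F i).τ := by simp [(H.biInf i).2]
    rcases lt_or_ge ((G i).left s) ((G i).right s) with hlt | hge
    · exact ⟨_, hi.2 s hFσ.le hs.le (.inl hFσ) (.inr hlt), pt_left_mem hFσ.le hFτ⟩
    · exact ⟨_, (hi.1 s hFσ.le hs.le).trans hge, pt_right_mem hFσ.le hFτ⟩
  choose! p hp1 hp2 using fun i (hi : ∃ x, x ≤ (G i).initialPoint.space ∧
      pt x (G i).initialPoint.time.toReal ∈ (F i).graph) => hi
  obtain ⟨x, hx1, hx2⟩ := exists_tendsto_pt_of_time (U := U)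
    (z := fun i => pt (p i) (G i).initialPoint.time.toReal) (t := t)
    ((continuous_coe_real_ereal.tendsto t).comp (tendsto_toReal_time hi1))
  have hxg : x ≤ g.left t := le_of_tendsto_of_tendsto hx2 hi2 (hex.mono hp1)
  have hxf := mem_graph_of_tendsto_path hF (hex.mono hp2) hx1
  obtain ⟨m, hm1, hm2⟩ := _root_.exists_between (lt_min hc hlr)
  obtain ⟨z, w, hzw, hz, hw⟩ := exists_tendsto_le hF (left_le hxf)
  obtain ⟨k, hk, y', hy', hk'⟩ := H.exists_lim_move_left (.of_forall hzw) hz hw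
    (hm2.trans_le (min_le_left _ _)) (hxg.trans_lt hm1)
  exact (H.nonCrossing_lim g hgB k hk).not_opposite hgτ (H.half_lim hk)
    (left_le (pt_right_mem hgt.le (by simp [hgτ]))) hk' hm1 le_rfl
    (hm2.le.trans (min_le_right _ _)) le_rfl (hy'.trans hxg)

theorem nonCrossing_of_tendsto (H : IsFlowFamily U A B F) {f g : CadlagPath} {G : ι → CadlagPath}
    (hF : Tendsto F U (𝓝 f)) (hG : Tendsto G U (𝓝 g)) (hGA : ∀ i, G i ∈ A i) (hgB : g ∈ B) :
    f.NonCrossing g := by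
  have hfτ : f.τ = ⊤ := top_of_tendsto hF (.of_forall fun i => (H.biInf i).2)
  have hor : (∀ᶠ i in U, (F i).LeftOf (G i)) ∨ ∀ᶠ i in U, (G i).LeftOf (F i) := by
    rw [← Ultrafilter.eventually_or]
    exact .of_forall fun i =>
      (H.nonCrossing i _ (hGA i)).leftOf (H.biInf i).2 (H.half i (hGA i))
  rw [nonCrossing_iff hfτ (H.half_lim hgB)]
  refine hor.imp (H.leftOf_of_tendsto hF hG hGA hgB) fun h => ?_
  rw [← leftOf_reflect]
  exact H.reflect.leftOf_of_tendsto (tendsto_reflect hF) (tendsto_reflect hG)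
    (fun i => by simpa using hGA i) (by simpa using hgB) (h.mono fun i hi => hi.reflect)

end IsFlowFamily
end

section

/-! ### Bi-infinite extensions -/

open SpaceTime CadlagPath

/-- A set of paths that is a deterministic weave. -/
structure IsDetWeave (A : Set CadlagPath) : Prop where
  compact : IsCompact A
  half : A ⊆ halfInfinite
  nonCrossing : IsNonCrossing A
  pervasive : IsPervasive A

theorem exists_lim_le {ι : Type*} {U : Ultrafilter ι} {A : Set CadlagPath} (hA : IsCompact A)
    {h : ι → CadlagPath} (hh : ∀ i, h i ∈ A) {p q : ι → SpaceTime}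
    (hle : ∀ i, (h i).Le (p i) (q i)) {t : ℝ}
    (hp : Tendsto (fun i => (p i).time) U (𝓝 (t : EReal)))
    (hq : Tendsto (fun i => (q i).time) U (𝓝 (t : EReal))) :
    ∃ h' ∈ A, ∃ x y, h'.Le (pt x t) (pt y t) ∧ Tendsto (fun i => (p i).space) U (𝓝 x) ∧
      Tendsto (fun i => (q i).space) U (𝓝 y) := by
  obtain ⟨h', h1, h2⟩ := hA.ultrafilter_le_nhds (U.map h)
    (le_principal_iff.2 (mem_map.2 (mem_of_superset univ_mem fun i _ => hh i)))
  obtain ⟨x, hx, hx'⟩ := exists_tendsto_pt_of_time hp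
  obtain ⟨y, hy, hy'⟩ := exists_tendsto_pt_of_time hq
  exact ⟨h', h1, x, y, le_of_tendsto_path h2 (.of_forall hle) hx hy, hx', hy'⟩

/-- In a compact non-crossing set of paths, the interval `[u, v]` is not traversed in both directions
during arbitrarily small time intervals around `t`. -/
theorem not_opposite_of_compact {A : Set CadlagPath} (hA : IsCompact A) (hhalf : A ⊆ halfInfinite)
    (hnc : IsNonCrossing A) {t : ℝ} {u v : EReal} (huv : u < v)
    (H : ∀ ε : ℝ, 0 < ε → ∃ l ∈ A, ∃ k ∈ A, ∃ a b c d : EReal, ∃ r s r' s' : ℝ,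
      l.Le (pt a r) (pt b s) ∧ k.Le (pt c r') (pt d s') ∧ a ≤ u ∧ v ≤ b ∧ v ≤ c ∧ d ≤ u ∧
      |r - t| < ε ∧ |s - t| < ε ∧ |r' - t| < ε ∧ |s' - t| < ε) : False := by
  choose l hl k hk a b c d r s r' s' h1 h2 h3 h4 h5 h6 h7 h8 h9 h10 using
    fun n : ℕ => H (1 / ((n : ℝ) + 1)) Nat.one_div_pos_of_nat
  have hlim : ∀ w : ℕ → ℝ, (∀ n, |w n - t| < 1 / ((n : ℝ) + 1)) →
      Tendsto (fun n => ((w n : ℝ) : EReal)) (hyperfilter ℕ) (𝓝 (t : EReal)) := fun w hw => by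
    refine (continuous_coe_real_ereal.tendsto t).comp (Tendsto.mono_left ?_ Nat.hyperfilter_le_atTop)
    rw [tendsto_iff_dist_tendsto_zero]
    exact squeeze_zero (fun n => dist_nonneg) (fun n => (hw n).le)
      tendsto_one_div_add_atTop_nhds_zero_nat
  obtain ⟨l', hl', x, y, hxy, hx, hy⟩ := exists_lim_le (U := hyperfilter ℕ) hA hl h1
    (hlim r h7) (hlim s h8)
  obtain ⟨k', hk', z, w, hzw, hz, hw⟩ := exists_lim_le (U := hyperfilter ℕ) hA hk h2
    (hlim r' h9) (hlim s' h10)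
  refine (hnc l' hl' k' hk').not_opposite (hhalf hl') (hhalf hk') hxy hzw huv ?_ ?_ ?_ ?_
  · exact _root_.le_of_tendsto hx (.of_forall h3)
  · exact ge_of_tendsto hy (.of_forall h4)
  · exact ge_of_tendsto hz (.of_forall h5)
  · exact _root_.le_of_tendsto hw (.of_forall h6)

/-- The elements of `A` that do not lie on the right of `f`. -/
def strictLeft (A : Set CadlagPath) (f : CadlagPath) : Set CadlagPath := {l ∈ A | ¬f.LeftOf l}

/-- The right boundary at time `s` of the region that is passed by the elements of `A` that do not
lie on the right of `f`. -/
def leftFront (A : Set CadlagPath) (f : CadlagPath) (s : ℝ) : EReal :=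
  sSup {x | ∃ l ∈ strictLeft A f, pt x s ∈ l.graph}

section Extension

variable {A : Set CadlagPath} {f l k : CadlagPath}

/-- Otherwise k would lie between f and l. As k starts before f, no comparison through k is lost at
an initial time of k, so `LeftOf` is transitive here and f would be on the left of l. -/
theorem leftOf_of_strictLeft (hhalf : A ⊆ halfInfinite) (hnc : IsNonCrossing A)
    (hl : l ∈ strictLeft A f) (hk : k ∈ A) (hfk : f.LeftOf k) (hσ : k.σ < f.σ) : l.LeftOf k := by
  refine ((hnc l hl.1 k hk).leftOf (hhalf hl.1) (hhalf hk)).resolve_right fun hc => ?_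
  refine hl.2 ⟨fun t h1 h2 => ?_, fun t h1 h2 h3 h4 => ?_⟩
  · have hkt := (hσ.trans_le h1).le
    exact (hfk.1 t h1 hkt).trans (hc.1 t hkt h2)
  · have hkt := hσ.trans_le h1
    exact (hfk.2 t h1 hkt.le h3 (.inl hkt)).trans (hc.2 t hkt.le h2 (.inl hkt) h4)

theorem le_leftFront (hl : l ∈ strictLeft A f) {x : EReal} {s : ℝ} (hx : pt x s ∈ l.graph) :
    x ≤ leftFront A f s := le_sSup ⟨l, hl, hx⟩

theorem exists_of_lt_leftFront {b : EReal} {s : ℝ} (h : b < leftFront A f s) :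
    ∃ l ∈ strictLeft A f, ∃ x, b < x ∧ pt x s ∈ l.graph := by
  obtain ⟨x, ⟨l, hl, hx⟩, hb⟩ := lt_sSup_iff.1 h
  exact ⟨l, hl, x, hb, hx⟩

theorem leftOf_of_leftFront_lt {m : EReal} {s : ℝ} (h : leftFront A f s < m) (hk : k ∈ A)
    (hm : pt m s ∈ k.graph) : f.LeftOf k := by
  by_contra hc
  exact h.not_ge (le_leftFront ⟨hk, hc⟩ hm)

theorem leftFront_le (hhalf : A ⊆ halfInfinite) (hnc : IsNonCrossing A) (hk : k ∈ A)
    (hfk : f.LeftOf k) (hσ : k.σ < f.σ) {s : ℝ} (hs : k.σ < s) :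
    leftFront A f s ≤ k.left s ⊔ k.right s := by
  refine sSup_le ?_
  rintro x ⟨l, hl, hx⟩
  have h := leftOf_of_strictLeft hhalf hnc hl hk hfk hσ
  rcases le_or_gt x (l.right s) with h1 | h1
  · exact (h1.trans (h.1 s hx.1 hs.le)).trans le_sup_right
  · have h2 : x ≤ l.left s := (le_sup_iff.1 hx.2.2.2).resolve_right h1.not_ge
    exact (h2.trans (h.2 s hx.1 hs.le (.inr (h1.trans_le h2)) (.inl hs))).trans le_sup_left

/-- A path through a level m in (a, b) at `r₁` is beyond the front, hence on the right of f, and is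
pushed beyond b by the front at `r₂`. A path near the front at `r₂` must be back below a at `r₃`.
These two are opposite moves. -/
theorem leftFront_no_oscillation (hA : IsDetWeave A) {t : ℝ} {a b : EReal} (hab : a < b)
    (H : ∀ ε : ℝ, 0 < ε → ∃ r₁ r₂ r₃ : ℝ, t - ε < r₁ ∧ r₁ < r₂ ∧ r₂ < r₃ ∧ r₃ < t + ε ∧
      (r₃ : EReal) < f.σ ∧ leftFront A f r₁ < a ∧ b < leftFront A f r₂ ∧ leftFront A f r₃ < a) :
    False := by
  obtain ⟨m, hm1, hm2⟩ := _root_.exists_between hab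
  refine not_opposite_of_compact hA.compact hA.half hA.nonCrossing (t := t) hm2 fun ε hε => ?_
  obtain ⟨r₁, r₂, r₃, h1, h2, h3, h4, h5, h6, h7, h8⟩ := H ε hε
  obtain ⟨k, hk, hkm⟩ := hA.pervasive (pt m r₁)
  have hfk := leftOf_of_leftFront_lt (h6.trans hm1) hk hkm
  have h12 : (r₁ : EReal) < r₂ := EReal.coe_lt_coe_iff.2 h2
  have h23 : (r₂ : EReal) < r₃ := EReal.coe_lt_coe_iff.2 h3
  have hk2 : k.σ < r₂ := hkm.1.trans_lt h12
  have hkf := leftFront_le hA.half hA.nonCrossing hk hfk (hk2.trans (h23.trans h5)) hk2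
  have hkmem : pt (k.left r₂ ⊔ k.right r₂) r₂ ∈ k.graph :=
    ⟨hk2.le, by simp [show k.τ = ⊤ from hA.half hk], inf_le_sup, le_rfl⟩
  obtain ⟨l, hl, x, hx, hxl⟩ := exists_of_lt_leftFront h7
  have hl3 : pt (l.right r₃) r₃ ∈ l.graph :=
    pt_right_mem (hxl.1.trans h23.le) (by simp [show l.τ = ⊤ from hA.half hl.1])
  refine ⟨k, hk, l, hl.1, m, _, x, _, r₁, r₂, r₂, r₃, le_of_time_lt hkm hkmem (by simpa using h2),
    le_of_time_lt hxl hl3 (by simpa using h3), le_rfl, (h7.trans_le hkf).le, hx.le,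
    (le_leftFront hl hl3).trans (h8.trans hm1).le, ?_, ?_, ?_, ?_⟩ <;>
  · rw [abs_lt]
    constructor <;> linarith

theorem exists_leftFront_tendsto_left (hA : IsDetWeave A) {t : ℝ} (ht : t ≤ f.σ) :
    ∃ L, Tendsto (leftFront A f) (𝓝[<] t) (𝓝 L) := by
  refine tendsto_of_no_upcrossings dense_univ fun a _ b _ hab ⟨h1, h2⟩ =>
    leftFront_no_oscillation hA (f := f) (t := t) hab fun ε hε => ?_
  obtain ⟨r₁, h3, h4⟩ := (h1.and_eventually (Ioo_mem_nhdsLT (sub_lt_self t hε))).exists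
  obtain ⟨r₂, h5, h6⟩ := (h2.and_eventually (Ioo_mem_nhdsLT h4.2)).exists
  obtain ⟨r₃, h7, h8⟩ := (h1.and_eventually (Ioo_mem_nhdsLT h6.2)).exists
  exact ⟨r₁, r₂, r₃, h4.1, h6.1, h8.1, h8.2.trans (lt_add_of_pos_right t hε),
    (EReal.coe_lt_coe_iff.2 h8.2).trans_le ht, h3, h5, h7⟩

theorem exists_leftFront_tendsto_right (hA : IsDetWeave A) {t : ℝ} (ht : t < f.σ) :
    ∃ R, Tendsto (leftFront A f) (𝓝[>] t) (𝓝 R) := by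
  refine tendsto_of_no_upcrossings dense_univ fun a _ b _ hab ⟨h1, h2⟩ =>
    leftFront_no_oscillation hA (f := f) (t := t) hab fun ε hε => ?_
  obtain ⟨r₃, ⟨h3, h4⟩, h4'⟩ := ((h1.and_eventually (Ioo_mem_nhdsGT (lt_add_of_pos_right t hε))
    ).and_eventually (nhdsWithin_le_nhds (eventually_gt_of_gt ht))).exists
  obtain ⟨r₂, h5, h6⟩ := (h2.and_eventually (Ioo_mem_nhdsGT h4.1)).exists
  obtain ⟨r₁, h7, h8⟩ := (h1.and_eventually (Ioo_mem_nhdsGT h6.1)).exists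
  exact ⟨r₁, r₂, r₃, (sub_lt_self t hε).trans h8.1, h8.2, h6.2, h4.2, h4', h7, h5, h3⟩

/-- If L were smaller, a path through a level m slightly before t, beyond the front, would be pushed
up to l(t-), while l jumps down across m. The hypothesis `hlk` covers both the elements of
`strictLeft A f` and f itself. -/
theorem le_of_leftFront_tendsto_left (hA : IsDetWeave A) {t : ℝ} {L : EReal} (ht : t ≤ f.σ)
    (hL : Tendsto (leftFront A f) (𝓝[<] t) (𝓝 L)) (hl : l ∈ A) (hlt : l.σ ≤ t)
    (hlk : ∀ k ∈ A, f.LeftOf k → k.σ < f.σ → l.LeftOf k) (hj : l.right t < l.left t) :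
    l.left t ≤ L := by
  by_contra hc
  obtain ⟨m, hm1, hm2⟩ := _root_.exists_between (max_lt (not_le.1 hc) hj)
  refine not_opposite_of_compact hA.compact hA.half hA.nonCrossing (t := t) hm2 fun ε hε => ?_
  obtain ⟨r, h1, h2⟩ := ((hL.eventually_lt_const ((le_max_left _ _).trans_lt hm1)).and
    (Ioo_mem_nhdsLT (sub_lt_self t hε))).exists
  obtain ⟨k, hk, hkm⟩ := hA.pervasive (pt m r)
  have hfk := leftOf_of_leftFront_lt h1 hk hkm
  have hrt : (r : EReal) < t := EReal.coe_lt_coe_iff.2 h2.2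
  have hkt := hkm.1.trans_lt hrt
  have hle := (hlk k hk hfk (hkt.trans_le ht)).2 t hlt hkt.le (.inr hj) (.inl hkt)
  have hkmem : pt (k.left t) t ∈ k.graph :=
    pt_left_mem hkt.le (by simp [show k.τ = ⊤ from hA.half hk])
  refine ⟨k, hk, l, hl, m, _, l.left t, l.right t, r, t, t, t,
    le_of_time_lt hkm hkmem (by simpa using h2.2),
    left_le (pt_right_mem hlt (by simp [show l.τ = ⊤ from hA.half hl])), le_rfl, hle, le_rfl,
    ((le_max_right _ _).trans_lt hm1).le, ?_, ?_, ?_, ?_⟩ <;>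
  · rw [abs_lt]
    constructor <;> linarith [h2.1, h2.2]

/-- If L were larger, a path near the front just before t would have to come down to k(t-) at time
t, opposite to the initial jump of k. -/
theorem leftFront_tendsto_left_le (hA : IsDetWeave A) {t : ℝ} {L : EReal} (ht : t ≤ f.σ)
    (hL : Tendsto (leftFront A f) (𝓝[<] t) (𝓝 L)) (hk : k ∈ A) (hkt : k.σ = t)
    (hfk : f.LeftOf k) (hj : k.left t < k.right t) : L ≤ k.left t := by
  by_contra hc
  obtain ⟨m, hm1, hm2⟩ := _root_.exists_between (lt_min (not_le.1 hc) hj)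
  refine not_opposite_of_compact hA.compact hA.half hA.nonCrossing (t := t) hm1 fun ε hε => ?_
  obtain ⟨r, h1, h2⟩ := ((hL.eventually_const_lt (hm2.trans_le (min_le_left _ _))).and
    (Ioo_mem_nhdsLT (sub_lt_self t hε))).exists
  obtain ⟨l, hl, x, hx, hxl⟩ := exists_of_lt_leftFront h1
  have hrt : (r : EReal) < t := EReal.coe_lt_coe_iff.2 h2.2
  have hlt := hxl.1.trans_lt hrt
  have hle : l.left t ≤ k.left t := by
    rcases (hA.nonCrossing l hl.1 k hk).leftOf (hA.half hl.1) (hA.half hk) with h | h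
    · exact h.2 t hlt.le hkt.le (.inl hlt) (.inr hj)
    · rcases ht.lt_or_eq with ht' | ht'
      · exact (leftOf_of_strictLeft hA.half hA.nonCrossing hl hk hfk (hkt.trans_lt ht')).2 t hlt.le hkt.le
          (.inl hlt) (.inr hj)
      -- If k and f start together, k on the left of l together with the failing comparison at t
      -- would put f on the left of l, which is excluded for elements of `strictLeft A f`.
      · by_contra hc'
        have hkf : k.σ = f.σ := hkt.trans ht'
        have hlf : l.σ < f.σ := hlt.trans_eq ht'
        refine hl.2 ⟨fun s h1 h2 => (hfk.1 s h1 (hkf.trans_le h1)).trans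
          (h.1 s (hkf.trans_le h1) h2), fun s h1 h2 h3 _ => ?_⟩
        have hls := hlf.trans_le h1
        rcases h1.lt_or_eq with h5 | h5
        · have hks := hkf.trans_lt h5
          exact (hfk.2 s h1 hks.le h3 (.inl hks)).trans (h.2 s hks.le h2 (.inl hks) (.inl hls))
        · obtain rfl : t = s := by rw [← ht'] at h5; exact_mod_cast h5
          exact (hfk.2 t h1 hkt.le h3 (.inr hj)).trans (not_le.1 hc').le
  refine ⟨k, hk, l, hl.1, k.left t, k.right t, x, _, t, t, r, t,
    left_le (pt_right_mem hkt.le (by simp [show k.τ = ⊤ from hA.half hk])),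
    le_of_time_lt hxl (pt_left_mem hlt.le (by simp [show l.τ = ⊤ from hA.half hl.1]))
      (by simpa using h2.2), le_rfl, (hm2.trans_le (min_le_right _ _)).le, hx.le, hle,
    ?_, ?_, ?_, ?_⟩ <;>
  · rw [abs_lt]
    constructor <;> linarith [h2.1, h2.2]

/-- Every element of a deterministic weave has a bi-infinite extension that does not cross the
weave. -/
theorem exists_extension (hA : IsDetWeave A) (hf : f ∈ A) : ∃ g ∈ flow A, f.ExtendsTo g := by
  have hfτ : f.τ = ⊤ := hA.half hf
  -- The extension uses the one-sided limits of `leftFront A f` before the start of f: paths on the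
  -- right of f stay on its right, and all others stay on its left.
  choose! L hL using fun (t : ℝ) (ht : (t : EReal) ≤ f.σ) =>
    exists_leftFront_tendsto_left hA ht
  choose! R hR using fun (t : ℝ) (ht : (t : EReal) < f.σ) =>
    exists_leftFront_tendsto_right hA ht
  have hRR : ∀ t : ℝ, (t : EReal) < f.σ → Tendsto R (𝓝[>] t) (𝓝 (R t)) := fun t ht => by
    refine tendsto_of_iterated (m := fun s => 𝓝[>] s) (l' := 𝓝[>] t) (fun P hP => ?_)
      (fun s => inferInstance) (hR t ht) ?_
    · exact (eventually_nhdsGT_nhds hP).mono fun s hs => hs.filter_mono nhdsWithin_le_nhds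
    · filter_upwards [nhdsWithin_le_nhds (eventually_gt_of_gt ht)] with s hs
      exact hR s hs
  have hRL : ∀ t : ℝ, (t : EReal) ≤ f.σ → Tendsto R (𝓝[<] t) (𝓝 (L t)) := fun t ht => by
    refine tendsto_of_iterated (m := fun s => 𝓝[>] s) (l' := 𝓝[<] t) (fun P hP => ?_)
      (fun s => inferInstance) (hL t ht) ?_
    · exact (eventually_nhdsLT_nhds hP).mono fun s hs => hs.filter_mono nhdsWithin_le_nhds
    · filter_upwards [self_mem_nhdsWithin] with s hs
      exact hR s ((EReal.coe_lt_coe_iff.2 hs).trans_le ht)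
  let g := f.glue hfτ L R hRR hRL
  have hright : ∀ k ∈ A, f.LeftOf k → g.LeftOf k := fun k hk hfk => by
    refine leftOf_of rfl (hA.half hk) (fun t _ ht => ?_) fun t _ _ h3 _ h5 => ?_
    · rcases lt_or_ge (t : EReal) f.σ with h | h
      · refine (glue_right_of_lt h).trans_le ?_
        have hkt : (t : EReal) < k.τ := by simp [show k.τ = ⊤ from hA.half hk]
        have h1 := (k.left_tendsto_right ht hkt).sup_nhds (k.tendsto_right t ht hkt)
        rw [sup_idem] at h1
        refine le_of_tendsto_of_tendsto (hR t h) h1 ?_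
        filter_upwards [self_mem_nhdsWithin] with s hs
        exact leftFront_le hA.half hA.nonCrossing hk hfk (ht.trans_lt h)
          (ht.trans_lt (EReal.coe_lt_coe_iff.2 hs))
      · exact (glue_right_of_ge h).trans_le (hfk.1 t h ht)
    · have hkt : k.σ = t := h3.resolve_left (by simp [g])
      have hj := h5.resolve_left hkt.not_lt
      rcases le_or_gt (t : EReal) f.σ with h | h
      · exact (glue_left_of_le h).trans_le
          (leftFront_tendsto_left_le hA h (hL t h) hk hkt hfk hj)
      · exact (glue_left_of_gt h).trans_le (hfk.2 t h.le hkt.le (.inl h) (.inr hj))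
  have hleft : ∀ l ∈ strictLeft A f, l.LeftOf g := fun l hl => by
    have hlf : l.LeftOf f :=
      ((hA.nonCrossing l hl.1 f hf).leftOf (hA.half hl.1) hfτ).resolve_right hl.2
    have hlτ : l.τ = ⊤ := hA.half hl.1
    refine leftOf_of hlτ rfl (fun t ht _ => ?_) fun t _ _ h3 h4 _ => ?_
    · rcases lt_or_ge (t : EReal) f.σ with h | h
      · refine le_of_le_of_eq ?_ (glue_right_of_lt h).symm
        refine le_of_tendsto_of_tendsto (l.tendsto_right t ht (by simp [hlτ])) (hR t h) ?_
        filter_upwards [self_mem_nhdsWithin] with s hs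
        exact le_leftFront hl (pt_right_mem (ht.trans (EReal.coe_lt_coe_iff.2 hs).le)
          (by simp [hlτ]))
      · exact (hlf.1 t ht h).trans_eq (glue_right_of_ge h).symm
    · have hlt : l.σ = t := h3.resolve_right (by simp [g])
      have hj := h4.resolve_left hlt.not_lt
      rcases le_or_gt (t : EReal) f.σ with h | h
      · exact (le_of_leftFront_tendsto_left hA h (hL t h) hl.1 hlt.le
          (fun k hk hfk hσ => leftOf_of_strictLeft hA.half hA.nonCrossing hl hk hfk hσ) hj).trans_eq
          (glue_left_of_le h).symm
      · exact (hlf.2 t hlt.le h.le (.inr hj) (.inl h)).trans_eq (glue_left_of_gt h).symm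
  refine ⟨g, ⟨⟨rfl, rfl⟩, fun k hk => ?_⟩, extendsTo_glue fun t ht => ?_⟩
  · rw [nonCrossing_iff rfl (hA.half hk)]
    by_cases h : f.LeftOf k
    · exact .inl (hright k hk h)
    · exact .inr (hleft k ⟨hk, h⟩)
  -- The initial point of f must lie in the jump of g. The direction of the initial jump decides
  -- which bound on `L t` is applied, with f itself in the role of the path.
  · rcases lt_trichotomy (f.left t) (f.right t) with h | h | h
    · have := leftFront_tendsto_left_le hA ht.ge (hL t ht.ge) hf ht (LeftOf.refl f) h
      exact mem_uIcc.2 (.inl ⟨this, h.le⟩)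
    · rw [h]
      exact right_mem_uIcc
    · have := le_of_leftFront_tendsto_left hA ht.ge (hL t ht.ge) hf ht.le
        (fun k _ hfk _ => hfk) h
      exact mem_uIcc.2 (.inr ⟨h.le, this⟩)

end Extension
end

section

/-! ### The flow of a deterministic weave -/

open SpaceTime CadlagPath

/-- A limit along a nonprincipal ultrafilter is a cluster point of the sequence, so compactness can
be checked without choosing subsequences. -/
theorem isCompact_of_hyperfilter {X : Type*} [PseudoEMetricSpace X] {S : Set X}
    (h : ∀ x : ℕ → X, (∀ n, x n ∈ S) → ∃ a ∈ S, Tendsto x (hyperfilter ℕ) (𝓝 a)) :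
    IsCompact S := by
  refine IsSeqCompact.isCompact fun x hx => ?_
  obtain ⟨a, ha, ha'⟩ := h x hx
  have hc : MapClusterPt a atTop x :=
    MapClusterPt.of_comp (φ := id) Nat.hyperfilter_le_atTop ha'.mapClusterPt
  exact ⟨a, ha, hc.tendsto_subseq⟩

theorem IsCompact.exists_tendsto_ultrafilter {X ι : Type*} [TopologicalSpace X] {S : Set X}
    (hS : IsCompact S) (U : Ultrafilter ι) {x : ι → X} (hx : ∀ i, x i ∈ S) :
    ∃ a ∈ S, Tendsto x U (𝓝 a) :=
  hS.ultrafilter_le_nhds (U.map x)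
    (le_principal_iff.2 (mem_map.2 (mem_of_superset univ_mem fun i _ => hx i)))

/-- Limits of elements of the flows of a convergent family of weaves. -/
theorem exists_tendsto_flow {ι : Type*} {U : Ultrafilter ι} {A : ι → Set CadlagPath}
    {B : Set CadlagPath} {F : ι → CadlagPath}
    (hε : ∃ ε : ι → ℝ, (∀ i, 0 < ε i) ∧ Tendsto ε U (𝓝 0))
    (hA : ∀ i, IsDetWeave (A i)) (hB : IsDetWeave B)
    (hlim : ∀ h : ι → CadlagPath, (∀ i, h i ∈ A i) → ∃ h' ∈ B, Tendsto h U (𝓝 h'))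
    (happ : ∀ g ∈ B, ∃ G : ι → CadlagPath, (∀ i, G i ∈ A i) ∧ Tendsto G U (𝓝 g))
    (hF : ∀ i, F i ∈ flow (A i)) : ∃ f ∈ flow B, Tendsto F U (𝓝 f) := by
  have H : IsFlowFamily U A B F :=
    { exists_small := hε
      half := fun i => (hA i).half
      pervasive := fun i => (hA i).pervasive
      biInf := fun i => (hF i).1
      nonCrossing := fun i => (hF i).2
      lim := hlim
      half_lim := hB.half
      nonCrossing_lim := hB.nonCrossing }
  obtain ⟨f, hf, hf'⟩ := H.exists_tendsto
  refine ⟨f, ⟨hf, fun g hg => ?_⟩, hf'⟩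
  obtain ⟨G, hG, hG'⟩ := happ g hg
  exact H.nonCrossing_of_tendsto hf' hG' hG hg

theorem exists_small_hyperfilter :
    ∃ ε : ℕ → ℝ, (∀ i, 0 < ε i) ∧ Tendsto ε (hyperfilter ℕ) (𝓝 0) :=
  ⟨fun n => 1 / ((n : ℝ) + 1), fun _ => Nat.one_div_pos_of_nat,
    tendsto_one_div_add_atTop_nhds_zero_nat.mono_left Nat.hyperfilter_le_atTop⟩

namespace CadlagPath

variable {f g h : CadlagPath}

theorem biInfinite_eq_of_right_eq (hf : f ∈ biInfinite) (hg : g ∈ biInfinite)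
    (h : ∀ t, f.right t = g.right t) : f = g := by
  have hR : f.right = g.right := funext h
  refine CadlagPath.ext (hf.1.trans hg.1.symm) (hf.2.trans hg.2.symm) (funext fun t => ?_) hR
  have h1 := f.tendsto_left t (by simp [hf.1]) (by simp [hf.2])
  have h2 := g.tendsto_left t (by simp [hg.1]) (by simp [hg.2])
  rw [hR] at h1
  exact tendsto_nhds_unique h1 h2

theorem LeftOf.pointwise (h : f.LeftOf g) (hf : f ∈ biInfinite) (hg : g ∈ biInfinite) (t : ℝ) :
    f.left t ≤ g.left t ∧ f.right t ≤ g.right t :=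
  ⟨h.2 t (by simp [hf.1]) (by simp [hg.1]) (.inl (by simp [hf.1])) (.inl (by simp [hg.1])),
    h.1 t (by simp [hf.1]) (by simp [hg.1])⟩

theorem eventually_separated (hf : f ∈ biInfinite) (hg : g ∈ biInfinite) {t : ℝ} {c : EReal}
    (h1 : f.right t < c) (h2 : c < g.right t) :
    ∀ᶠ s in 𝓝[>] t, f.left s < c ∧ f.right s < c ∧ c < g.left s ∧ c < g.right s := by
  have a1 : f.σ ≤ t := by simp [hf.1]
  have a2 : (t : EReal) < f.τ := by simp [hf.2]
  have b1 : g.σ ≤ t := by simp [hg.1]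
  have b2 : (t : EReal) < g.τ := by simp [hg.2]
  filter_upwards [(f.left_tendsto_right a1 a2).eventually_lt_const h1,
    (f.tendsto_right t a1 a2).eventually_lt_const h1,
    (g.left_tendsto_right b1 b2).eventually_const_lt h2,
    (g.tendsto_right t b1 b2).eventually_const_lt h2] with s c1 c2 c3 c4
  exact ⟨c1, c2, c3, c4⟩

/-- A path that passes between two bi-infinite paths that it does not cross stays between them. -/
theorem between_of_mem (hf : f ∈ biInfinite) (hg : g ∈ biInfinite) (hh : h.τ = ⊤)
    (hfh : h.NonCrossing f) (hgh : h.NonCrossing g) {s : ℝ} {c : EReal}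
    (hc : f.left s < c ∧ f.right s < c ∧ c < g.left s ∧ c < g.right s)
    (hm : pt c s ∈ h.graph) : f.LeftOf h ∧ h.LeftOf g :=
  ⟨hfh.leftOf_of_gt hh hf.2 (by simp [hf.1]) hm hc.1 hc.2.1,
    hgh.leftOf_of_lt hh hg.2 (by simp [hg.1]) hm hc.2.2.1 hc.2.2.2⟩

/-- If f < g at one time, some path of `A` enters the gap right afterwards. It crosses neither, so
it keeps f on the left of g at all later times and the order cannot reverse. -/
theorem nonCrossing_of_pervasive {A : Set CadlagPath} (hA : A ⊆ halfInfinite)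
    (hperv : IsPervasive A) (hf : f ∈ flow A) (hg : g ∈ flow A) : f.NonCrossing g := by
  have key : ∀ {f g : CadlagPath}, f ∈ flow A → g ∈ flow A → ∀ {t₁ t₂ : ℝ}, t₁ < t₂ →
      f.right t₁ < g.right t₁ → g.right t₂ < f.right t₂ → False := by
    intro f g hf hg t₁ t₂ ht h1 h2
    obtain ⟨c, hc1, hc2⟩ := _root_.exists_between h1
    obtain ⟨s, hs, hs'⟩ := ((eventually_separated hf.1 hg.1 hc1 hc2).and
      (Ioo_mem_nhdsGT ht)).exists
    obtain ⟨k, hk, hkm⟩ := hperv (pt c s)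
    obtain ⟨h3, h4⟩ := between_of_mem hf.1 hg.1 (hA hk) (hf.2 k hk).symm (hg.2 k hk).symm hs hkm
    have hkt : k.σ ≤ t₂ := hkm.1.trans (EReal.coe_le_coe_iff.2 hs'.2.le)
    exact h2.not_ge ((h3.1 t₂ (by simp [hf.1.1]) hkt).trans (h4.1 t₂ hkt (by simp [hg.1.1])))
  rw [nonCrossing_iff hf.1.2 hg.1.2]
  by_contra! hc
  have hex : ∀ {f g : CadlagPath}, f ∈ flow A → g ∈ flow A → ¬f.LeftOf g →
      ∃ t, g.right t < f.right t := fun {f g} hf hg hn => by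
    by_contra! hall
    exact hn (leftOf_of hf.1.2 hg.1.2 (fun t _ _ => hall t)
      fun t _ _ h _ _ => by simp [hf.1.1, hg.1.1] at h)
  obtain ⟨t₁, h1⟩ := hex hf hg hc.1
  obtain ⟨t₂, h2⟩ := hex hg hf hc.2
  rcases lt_trichotomy t₁ t₂ with ht | rfl | ht
  · exact key hg hf ht h1 h2
  · exact h1.not_gt h2
  · exact key hf hg ht h2 h1

end CadlagPath

namespace IsDetWeave

variable {A B : Set CadlagPath} {f g : CadlagPath}

theorem isCompact_flow (hA : IsDetWeave A) : IsCompact (flow A) :=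
  isCompact_of_hyperfilter fun _ hF =>
    exists_tendsto_flow exists_small_hyperfilter (fun _ => hA) hA
      (fun _ hh => hA.compact.exists_tendsto_ultrafilter _ hh)
      (fun g hg => ⟨fun _ => g, fun _ => hg, tendsto_const_nhds⟩) hF

theorem subset_downset_flow (hA : IsDetWeave A) : A ⊆ downset (flow A) := fun _ hf =>
  let ⟨g, hg, hfg⟩ := exists_extension hA hf
  ⟨hA.half hf, g, hg, hfg⟩

theorem flow_isDetWeave (hA : IsDetWeave A) : IsDetWeave (flow A) where
  compact := hA.isCompact_flow
  half _ hf := hf.1.2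
  nonCrossing _ hf _ hg := nonCrossing_of_pervasive hA.half hA.pervasive hf hg
  pervasive z := by
    obtain ⟨f, hf, hz⟩ := hA.pervasive z
    obtain ⟨g, hg, hfg⟩ := exists_extension hA hf
    exact ⟨g, hg, hfg.mem hz⟩

/-- Comparable weaves have the same flow. -/
theorem flow_eq_of_subset_downset (hA : IsDetWeave A) (hB : IsDetWeave B) (h : A ⊆ downset B) :
    flow A = flow B := by
  have hsub : flow B ⊆ flow A := fun f hf => ⟨hf.1, fun g hg => by
    obtain ⟨-, g', hg', hgg⟩ := h hg
    exact (hf.2 g' hg').mono (ExtendsTo.refl f) hgg⟩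
  -- The extension of g in flow(B) is also in flow(A), which is non-crossing; so f does not cross
  -- it, nor its restriction g.
  refine Subset.antisymm (fun f hf => ⟨hf.1, fun g hg => ?_⟩) hsub
  obtain ⟨g', hg', hgg⟩ := exists_extension hB hg
  exact (hA.flow_isDetWeave.nonCrossing f hf g' (hsub hg')).mono (ExtendsTo.refl f) hgg

/-- A restriction that starts at time -∞ is the whole path, because there is only one point of
space-time at that time. -/
theorem preceq_flow (hA : IsDetWeave A) : Preceq A (flow A) := by
  refine ⟨?_, hA.subset_downset_flow⟩
  rintro g ⟨⟨hg, f, hf, hgf⟩, hg'⟩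
  have hσ : f.σ = ⊥ := le_bot_iff.1 (hgf.σ_le.trans_eq hg'.1.1)
  have : g = f := by
    refine eq_of_extendsTo_of_initialPoint hg (hA.half hf) hgf (ExtendsTo.refl f) ?_
    rw [eq_bot_of_time (g.time_initialPoint.trans hg'.1.1),
      eq_bot_of_time (f.time_initialPoint.trans hσ)]
  rwa [this]

end IsDetWeave

theorem Preceq.antisymm {A B : Set CadlagPath} (h1 : Preceq A B) (h2 : Preceq B A) : A = B :=
  Subset.antisymm (fun _ hf => h2.1 ⟨h1.2 hf, hf⟩) fun _ hf => h1.1 ⟨h2.2 hf, hf⟩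

/-- A path between two bi-infinite paths passes their common points. -/
theorem mem_graph_of_between {f g h : CadlagPath} (hf : f ∈ biInfinite) (hg : g ∈ biInfinite)
    (hh : h ∈ biInfinite) (hfh : f.LeftOf h) (hhg : h.LeftOf g) {x : EReal} {t : ℝ}
    (h1 : pt x t ∈ f.graph) (h2 : pt x t ∈ g.graph) : pt x t ∈ h.graph := by
  obtain ⟨a1, a2⟩ := hfh.pointwise hf hh t
  obtain ⟨b1, b2⟩ := hhg.pointwise hh hg t
  exact ⟨by simp [hh.1], by simp [hh.2], (inf_le_inf b1 b2).trans h2.2.2.1,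
    h1.2.2.2.trans (sup_le_sup a1 a2)⟩

/-- If the graph contained a ball around (x₀, t₀), every x near x₀ would be a limit of graph points
at times decreasing to t₀, and hence equal to h(t₀+). -/
theorem dense_compl_graph (h : CadlagPath) (hh : h ∈ biInfinite) :
    Dense {z : ℝ × ℝ | pt (z.1 : EReal) z.2 ∈ h.graph}ᶜ := by
  rw [← interior_eq_empty_iff_dense_compl, eq_empty_iff_forall_notMem]
  rintro ⟨x₀, t₀⟩ hz
  obtain ⟨δ, hδ, hball⟩ := Metric.mem_nhds_iff.1 (mem_interior_iff_mem_nhds.1 hz)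
  have key : ∀ x : ℝ, |x - x₀| < δ → (x : EReal) = h.right t₀ := fun x hx => by
    have hev : ∀ᶠ s in 𝓝[>] t₀, pt (x : EReal) s ∈ h.graph := by
      filter_upwards [Ioo_mem_nhdsGT (lt_add_of_pos_right t₀ hδ)] with s hs
      refine hball (show (x, s) ∈ Metric.ball (x₀, t₀) δ from ?_)
      rw [Metric.mem_ball, Prod.dist_eq, Real.dist_eq, Real.dist_eq, max_lt_iff]
      exact ⟨hx, abs_lt.2 ⟨by linarith [hs.1], by linarith [hs.2]⟩⟩
    refine tendsto_nhds_unique (f := fun _ : ℝ => (x : EReal)) (l := 𝓝[>] t₀) tendsto_const_nhds ?_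
    refine tendsto_space_right (z := fun s => pt (x : EReal) s) (by simp [hh.1]) (by simp [hh.2])
      hev ((continuous_coe_real_ereal.tendsto t₀).mono_left nhdsWithin_le_nhds) ?_
    filter_upwards [self_mem_nhdsWithin] with s hs
    simpa using hs
  have h1 := key x₀ (by simpa using hδ)
  have h2 := key (x₀ + δ / 2) (by rw [add_sub_cancel_left, abs_of_pos (by positivity)]; linarith)
  have h3 : x₀ = x₀ + δ / 2 := by exact_mod_cast h1.trans h2.symm
  linarith

/-- The non-ramified points of a weave of bi-infinite paths are dense. -/
theorem dense_nonRamified_of_biInfinite {F : Set CadlagPath} (hF : IsDetWeave F)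
    (hbi : F ⊆ biInfinite) : Dense (nonRamified F) := by
  -- Baire: remove the graphs of one path through each rational point. Two different paths through a
  -- remaining z would be strictly apart at some rational point, and the path chosen there, squeezed
  -- between them, would pass z.
  choose h hhF hh using fun p : ℚ × ℚ => hF.pervasive (pt ((p.1 : ℝ) : EReal) (p.2 : ℝ))
  have hd : Dense (⋂ p, {z : ℝ × ℝ | pt (z.1 : EReal) z.2 ∈ (h p).graph}ᶜ) := by
    refine dense_iInter_of_isOpen (fun p => ?_) fun p => dense_compl_graph _ (hbi (hhF p))
    refine ((h p).isClosed_graph.preimage ?_).isOpen_compl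
    exact continuous_pt.comp ((continuous_coe_real_ereal.comp continuous_fst).prodMk continuous_snd)
  refine hd.mono fun z hz f hf g hg hzf hzg => ?_
  by_contra hc
  rw [mem_iInter] at hz
  have key : ∀ {f g : CadlagPath}, f ∈ F → g ∈ F → pt (z.1 : EReal) z.2 ∈ f.graph →
      pt (z.1 : EReal) z.2 ∈ g.graph → f.LeftOf g → f = g := by
    intro f g hf hg hzf hzg hfg
    by_contra hne
    have hfb := hbi hf
    have hgb := hbi hg
    obtain ⟨t, ht⟩ : ∃ t, f.right t ≠ g.right t := by
      by_contra! hall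
      exact hne (biInfinite_eq_of_right_eq hfb hgb hall)
    obtain ⟨q, hq1, hq2⟩ := EReal.lt_iff_exists_rat_btwn.1
      (lt_of_le_of_ne (hfg.pointwise hfb hgb t).2 ht)
    obtain ⟨b, hb, hb'⟩ := (nhdsGT_basis t).eventually_iff.1
      (eventually_separated hfb hgb hq1 hq2)
    obtain ⟨s, hs1, hs2⟩ := exists_rat_btwn hb
    obtain ⟨h1, h2⟩ := between_of_mem hfb hgb (hF.half (hhF (q, s)))
      (hF.nonCrossing _ (hhF _) f hf) (hF.nonCrossing _ (hhF _) g hg) (hb' ⟨hs1, hs2⟩) (hh (q, s))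
    exact hz (q, s) (mem_graph_of_between hfb hgb (hbi (hhF _)) h1 h2 hzf hzg)
  rcases (hF.nonCrossing f hf g hg).leftOf (hF.half hf) (hF.half hg) with h1 | h1
  · exact hc (.inl (key hf hg hzf hzg h1 ▸ ExtendsTo.refl _))
  · exact hc (.inl (key hg hf hzg hzf h1 ▸ ExtendsTo.refl _))

/-- Points that are non-ramified in the flow are non-ramified in the weave. -/
theorem nonRamified_subset_of_subset_downset {A F : Set CadlagPath} (h : A ⊆ downset F)
    (hbi : F ⊆ biInfinite) : nonRamified F ⊆ nonRamified A := by
  intro z hz f hf g hg hzf hzg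
  obtain ⟨hfτ, f', hf', hff⟩ := h hf
  obtain ⟨hgτ, g', hg', hgg⟩ := h hg
  have key : ∀ {a b : CadlagPath}, a ∈ F → b ∈ F → a.ExtendsTo b → a = b := fun {a b} ha hb hab =>
    biInfinite_eq_of_right_eq (hbi ha) (hbi hb) fun t =>
      hab.right_eq (hbi ha).2 (by simp [(hbi ha).1])
  -- Between bi-infinite paths extension is equality, so f and g are restrictions of one path and
  -- hence comparable.
  have : f' = g' := by
    rcases hz f' hf' g' hg' (hff.mem hzf) (hgg.mem hzg) with h1 | h1
    · exact key hf' hg' h1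
    · exact (key hg' hf' h1).symm
  subst this
  exact comparable_of_extendsTo hfτ hgτ hff hgg

namespace IsDetWeave

variable {A B : Set CadlagPath} {f g : CadlagPath}

theorem flow_subset (A : Set CadlagPath) : flow A ⊆ biInfinite := fun _ hf => hf.1

theorem dense_nonRamified_flow (hA : IsDetWeave A) : Dense (nonRamified (flow A)) :=
  dense_nonRamified_of_biInfinite hA.flow_isDetWeave (flow_subset A)

theorem nonRamified_flow_subset (hA : IsDetWeave A) : nonRamified (flow A) ⊆ nonRamified A :=
  nonRamified_subset_of_subset_downset hA.subset_downset_flow (flow_subset A)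

theorem dense_nonRamified (hA : IsDetWeave A) : Dense (nonRamified A) :=
  hA.dense_nonRamified_flow.mono hA.nonRamified_flow_subset

/-- A weave of bi-infinite paths is its own flow. -/
theorem eq_flow_of_biInfinite (hA : IsDetWeave A) (hbi : A ⊆ biInfinite) : A = flow A := by
  refine Subset.antisymm (fun f hf => ⟨hbi hf, fun g hg => hA.nonCrossing f hf g hg⟩) fun f hf => ?_
  have hfb := hf.1
  have hclosed : ∀ g : CadlagPath, g ∈ biInfinite → IsClosed {h | h ∈ A ∧ h.LeftOf g} := by
    refine fun g hg => isClosed_iff_ultrafilter.2 fun h U hU hm => ?_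
    have hhA : h ∈ A := hA.compact.isClosed.mem_of_tendsto hU
      (mem_of_superset hm fun k hk => hk.1)
    refine ⟨hhA, leftOf_of (hbi hhA).2 hg.2 (fun t h1 h2 => ?_)
      fun t _ _ h3 _ _ => by simp [(hbi hhA).1, hg.1] at h3⟩
    by_contra hc
    obtain ⟨c, hc1, hc2⟩ := _root_.exists_between (not_le.1 hc)
    obtain ⟨s, hs⟩ := (eventually_separated hg (hbi hhA) hc1 hc2).exists
    have hev : ∀ᶠ k : CadlagPath in U, k ∈ A ∧ k.LeftOf g := hm
    obtain ⟨k, hk1, hk2⟩ := (hev.and (eventually_lt_right (F := id) hU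
      (hev.mono fun k hk => by simp [(hbi hk.1).1]) (hev.mono fun k hk => (hbi hk.1).2)
      hs.2.2.1 hs.2.2.2)).exists
    exact (hs.2.1.trans hk2).not_ge (hk1.2.pointwise (hbi hk1.1) hg s).2
  have hclosed' : ∀ g : CadlagPath, g ∈ biInfinite → IsClosed {h | h ∈ A ∧ g.LeftOf h} := by
    refine fun g hg => isClosed_iff_ultrafilter.2 fun h U hU hm => ?_
    have hhA : h ∈ A := hA.compact.isClosed.mem_of_tendsto hU
      (mem_of_superset hm fun k hk => hk.1)
    refine ⟨hhA, leftOf_of hg.2 (hbi hhA).2 (fun t h1 h2 => ?_)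
      fun t _ _ h3 _ _ => by simp [(hbi hhA).1, hg.1] at h3⟩
    by_contra hc
    obtain ⟨c, hc1, hc2⟩ := _root_.exists_between (not_le.1 hc)
    obtain ⟨s, hs⟩ := (eventually_separated (hbi hhA) hg hc1 hc2).exists
    have hev : ∀ᶠ k : CadlagPath in U, k ∈ A ∧ g.LeftOf k := hm
    obtain ⟨k, hk1, hk2⟩ := (hev.and (eventually_right_lt (F := id) hU
      (hev.mono fun k hk => by simp [(hbi hk.1).1]) (hev.mono fun k hk => (hbi hk.1).2)
      hs.1 hs.2.1)).exists
    exact (hk2.trans hs.2.2.2).not_ge (hk1.2.pointwise hg (hbi hk1.1) s).2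
  have htot : ∀ g ∈ A, ∀ h ∈ A, g.LeftOf h ∨ h.LeftOf g := fun g hg h hh =>
    (hA.nonCrossing g hg h hh).leftOf (hA.half hg) (hA.half hh)
  have htr : ∀ {a b c : CadlagPath}, a ∈ biInfinite → b ∈ biInfinite → c ∈ biInfinite →
      a.LeftOf b → b.LeftOf c → a.LeftOf c := fun {a b c} ha hb hc h1 h2 =>
    leftOf_of_extends ha.2 hc.2 (ExtendsTo.refl a) (ExtendsTo.refl c) fun t =>
      ⟨(h1.pointwise ha hb t).1.trans (h2.pointwise hb hc t).1,
        (h1.pointwise ha hb t).2.trans (h2.pointwise hb hc t).2⟩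
  -- Two different ordered flow paths leave a gap, which pervasiveness fills with an element of `A`
  -- lying strictly inside at some time.
  have hsep : ∀ {a b : CadlagPath}, a ∈ flow A → b ∈ flow A → a.LeftOf b → a ≠ b →
      ∃ h ∈ A, ∃ s, a.LeftOf h ∧ h.LeftOf b ∧ (∃ c, a.right s < c ∧ c < b.right s ∧
        a.left s < c ∧ c < b.left s ∧ pt c s ∈ h.graph) := by
    intro a b ha hb hab hne
    obtain ⟨t, ht⟩ : ∃ t, a.right t ≠ b.right t := by
      by_contra! hall
      exact hne (biInfinite_eq_of_right_eq ha.1 hb.1 hall)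
    obtain ⟨c, hc1, hc2⟩ := _root_.exists_between
      (lt_of_le_of_ne (hab.pointwise ha.1 hb.1 t).2 ht)
    obtain ⟨s, hs⟩ := (eventually_separated ha.1 hb.1 hc1 hc2).exists
    obtain ⟨h, hh, hm⟩ := hA.pervasive (pt c s)
    obtain ⟨h1, h2⟩ := between_of_mem ha.1 hb.1 (hA.half hh) (ha.2 h hh).symm (hb.2 h hh).symm hs hm
    exact ⟨h, hh, s, h1, h2, c, hs.2.1, hs.2.2.2, hs.1, hs.2.2.1, hm⟩
  have hAF : A ⊆ flow A := fun g hg => ⟨hbi hg, fun h hh => hA.nonCrossing g hg h hh⟩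
  -- Compactness gives the rightmost element of `A` on the left of f, or, if there is none, the
  -- leftmost element of `A`. If it were not f, the element of `A` in the gap would contradict
  -- extremality.
  by_cases hne : ∃ g ∈ A, g.LeftOf f
  · obtain ⟨g, ⟨hg, hgf⟩, hmax⟩ := (hA.compact.of_isClosed_subset (hclosed f hfb)
      fun h hh => hh.1).exists_least_of_total (R := fun a b => b.LeftOf a) hne
      (fun b hb => by
        convert (hclosed f hfb).inter (hclosed' b (hbi hb.1)) using 1
        ext x
        simp only [mem_inter_iff, mem_ofPred_eq]
        tauto)
      (fun a ha b hb => htot b hb.1 a ha.1)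
      (fun a ha b hb c hc h1 h2 => htr (hbi hc.1) (hbi hb.1) (hbi ha.1) h2 h1)
    by_cases hfg : g = f
    · exact hfg ▸ hg
    · obtain ⟨h, hh, s, h1, h2, c, hc1, -, hc2, -, hm⟩ := hsep (hAF hg) hf hgf hfg
      have h3 := (hmax h ⟨hh, h2⟩).pointwise (hbi hh) (hbi hg) s
      exact absurd (hm.2.2.2.trans (sup_le_sup h3.1 h3.2)) (max_lt hc2 hc1).not_ge
  · push Not at hne
    have hall : ∀ g ∈ A, f.LeftOf g := fun g hg =>
      ((hf.2 g hg).leftOf hfb.2 (hA.half hg)).resolve_right (hne g hg)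
    obtain ⟨g₀, hg₀, -⟩ := hA.pervasive top
    obtain ⟨g, hg, hmin⟩ := hA.compact.exists_least_of_total (R := fun a b => a.LeftOf b)
      ⟨g₀, hg₀⟩ (fun b hb => hclosed b (hbi hb)) htot
      (fun a ha b hb c hc h1 h2 => htr (hbi ha) (hbi hb) (hbi hc) h1 h2)
    by_cases hfg : f = g
    · exact hfg ▸ hg
    · obtain ⟨h, hh, s, h1, h2, c, -, hc1, -, hc2, hm⟩ := hsep hf (hAF hg) (hall g hg) hfg
      have h3 := (hmin h hh).pointwise (hbi hg) (hbi hh) s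
      exact absurd ((inf_le_inf h3.1 h3.2).trans hm.2.2.1) (lt_min hc2 hc1).not_ge

end IsDetWeave
end

section

/-! ### The web of a deterministic weave -/

open SpaceTime CadlagPath

theorem SpaceTime.denseRange_pt : DenseRange fun z : ℝ × ℝ => pt (z.1 : EReal) z.2 := by
  have hfin : ∀ (x : EReal) (t : ℝ),
      pt x t ∈ closure (range fun z : ℝ × ℝ => pt (z.1 : EReal) z.2) := fun x t => by
    have hx : x ∈ closure (range ((↑) : ℝ → EReal)) := 
      dense_of_exists_between (fun a b h =>
        let ⟨c, h1, h2⟩ := EReal.lt_iff_exists_real_btwn.1 h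
        ⟨(c : EReal), mem_range_self c, h1, h2⟩) x
    have hc : Continuous fun y : EReal => pt y t :=
      continuous_pt.comp (continuous_id.prodMk continuous_const)
    refine closure_mono ?_ (image_closure_subset_closure_image hc (mem_image_of_mem _ hx))
    rintro _ ⟨_, ⟨y, rfl⟩, rfl⟩
    exact ⟨(y, t), rfl⟩
  rintro (⟨x, t⟩ | _ | _)
  · exact hfin x t
  · rw [← closure_closure]
    refine mem_closure_of_tendsto (f := fun t : ℝ => pt 0 t) (b := atBot) ?_
      (Eventually.of_forall (hfin 0))
    exact tendsto_bot.2 EReal.tendsto_coe_atBot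
  · rw [← closure_closure]
    refine mem_closure_of_tendsto (f := fun t : ℝ => pt 0 t) (b := atTop) ?_
      (Eventually.of_forall (hfin 0))
    exact tendsto_top.2 EReal.tendsto_coe_atTop

/-- The points passed by a compact set of paths form a closed set. -/
theorem isClosed_passed {W : Set CadlagPath} (hW : IsCompact W) :
    IsClosed {z | ∃ f ∈ W, z ∈ f.graph} := by
  refine isClosed_iff_ultrafilter.2 fun z U hU hm => ?_
  obtain ⟨w, f₀, hf₀, -⟩ := U.nonempty_of_mem hm
  have hex : ∀ w, ∃ f ∈ W, (∃ f ∈ W, w ∈ f.graph) → w ∈ f.graph := fun w => by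
    by_cases h : ∃ f ∈ W, w ∈ f.graph
    · exact ⟨h.choose, h.choose_spec.1, fun _ => h.choose_spec.2⟩
    · exact ⟨f₀, hf₀, fun h' => absurd h' h⟩
  choose F hF hF' using hex
  obtain ⟨f, hf, hf'⟩ := hW.exists_tendsto_ultrafilter U hF
  exact ⟨f, hf, mem_graph_of_tendsto_path hf' (mem_of_superset hm hF') hU⟩

theorem downset_mono {A B : Set CadlagPath} (h : A ⊆ B) : downset A ⊆ downset B :=
  fun _ ⟨hg, f, hf, hgf⟩ => ⟨hg, f, h hf, hgf⟩

theorem downset_downset_subset (A : Set CadlagPath) : downset (downset A) ⊆ downset A :=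
  fun _ ⟨hg, _, ⟨_, k, hk, hhk⟩, hgh⟩ => ⟨hg, k, hk, hgh.trans hhk⟩

theorem subset_downset {A : Set CadlagPath} (hA : A ⊆ halfInfinite) : A ⊆ downset A :=
  fun f hf => ⟨hA hf, f, hf, ExtendsTo.refl f⟩

theorem restrictTo_subset_downset (A : Set CadlagPath) (D : Set (ℝ × ℝ)) :
    restrictTo A D ⊆ downset A :=
  fun _ ⟨hg, _, _, f, hf, _, hgf, _⟩ => ⟨hg, f, hf, hgf⟩

theorem isCompact_downset {A : Set CadlagPath} (hA : IsCompact A) : IsCompact (downset A) := by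
  refine isCompact_of_hyperfilter fun G hG => ?_
  choose hτ F hF hGF using hG
  obtain ⟨f, hf, hf'⟩ := hA.exists_tendsto_ultrafilter (hyperfilter ℕ) hF
  obtain ⟨g, hg, hg', hgf⟩ := exists_tendsto_of_extendsTo hτ hf' hGF
  exact ⟨g, ⟨hg, f, hf, hgf⟩, hg'⟩

/-- A restriction of a limit of paths is a limit of restrictions, so downward closedness passes to
the closure. -/
theorem downset_closure_subset {S : Set CadlagPath} (hS : S ⊆ halfInfinite)
    (hd : downset S ⊆ S) : downset (closure S) ⊆ closure S := by
  rintro g ⟨hg, f, hf, hgf⟩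
  obtain ⟨F, hF, hF'⟩ := mem_closure_iff_seq_limit.1 hf
  obtain ⟨G, hG, hG'⟩ := exists_tendsto_restrict (U := hyperfilter ℕ) (fun i => hS (hF i))
    (hF'.mono_left Nat.hyperfilter_le_atTop) hg hgf
  exact mem_closure_of_tendsto hG' (Eventually.of_forall fun i =>
    hd ⟨(hG i).1, F i, hF i, (hG i).2⟩)

/-- Restrictions converge when the initial points converge to a non-ramified point. -/
theorem tendsto_restrict_of_isNonRamified {ι : Type*} {U : Ultrafilter ι} {F G : ι → CadlagPath}
    {A : Set CadlagPath} {f f' g : CadlagPath} {z : SpaceTime} (hz : IsNonRamified A z)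
    (hG : ∀ i, (G i).τ = ⊤) (hF : Tendsto F U (𝓝 f')) (hGF : ∀ i, (G i).ExtendsTo (F i))
    (hi : Tendsto (fun i => (G i).initialPoint) U (𝓝 z)) (hf' : f' ∈ A) (hf : f ∈ A)
    (hg : g.τ = ⊤) (hgf : g.ExtendsTo f) (hgz : g.initialPoint = z) : Tendsto G U (𝓝 g) := by
  obtain ⟨k, hk, hk', hkf⟩ := exists_tendsto_of_extendsTo hG hF hGF
  have hkz : k.initialPoint = z := tendsto_nhds_unique (tendsto_initialPoint hk') hi
  have h1 : z ∈ f.graph := hgz ▸ hgf.mem g.initialPoint_mem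
  have h2 : z ∈ f'.graph := hkz ▸ hkf.mem k.initialPoint_mem
  -- Both f and f' pass z, so one extends the other; k and g are then restrictions of one path with
  -- the same initial point.
  have : k = g := by
    rcases hz f hf f' hf' h1 h2 with h | h
    · exact eq_of_extendsTo_of_initialPoint hk hg hkf (hgf.trans h) (hkz.trans hgz.symm)
    · exact eq_of_extendsTo_of_initialPoint hk hg (hkf.trans h) hgf (hkz.trans hgz.symm)
  exact this ▸ hk'

/-- At a point that is non-ramified in `B`, all elements of `B` through it have the same restriction
there, and the elements of `A` through it are extended by such elements. -/
theorem restrictTo_eq_of_subset_downset {A B : Set CadlagPath} (hA : A ⊆ halfInfinite)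
    (hperv : IsPervasive A) (h : A ⊆ downset B) {D : Set (ℝ × ℝ)} (hD : D ⊆ nonRamified B) :
    restrictTo A D = restrictTo B D := by
  refine Subset.antisymm ?_ ?_
  · rintro g ⟨hg, z, hz, f, hf, hzf, hgf, hgz⟩
    obtain ⟨-, f', hf', hff⟩ := h hf
    exact ⟨hg, z, hz, f', hf', hff.mem hzf, hgf.trans hff, hgz⟩
  · rintro g ⟨hg, z, hz, f, hf, hzf, hgf, hgz⟩
    obtain ⟨k, hk, hzk⟩ := hperv (pt (z.1 : EReal) z.2)
    obtain ⟨-, k', hk', hkk⟩ := h hk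
    obtain ⟨l, hl, hlk, hlz⟩ := exists_restrict (hA hk) hzk
    have : g = l := by
      rcases hD hz f hf k' hk' hzf (hkk.mem hzk) with h1 | h1
      · exact eq_of_extendsTo_of_initialPoint hg hl (hgf.trans h1) (hlk.trans hkk)
          (hgz.trans hlz.symm)
      · exact eq_of_extendsTo_of_initialPoint hg hl hgf ((hlk.trans hkk).trans h1)
          (hgz.trans hlz.symm)
    exact ⟨hg, z, hz, k, hk, hzk, this ▸ hlk, hgz⟩

namespace IsDetWeave

variable {A B : Set CadlagPath} {D : Set (ℝ × ℝ)}

/-- Take restrictions starting at points of `D` that tend to z. Their limit starts at z, where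
non-ramification leaves g as the only candidate. -/
theorem mem_closure_restrictTo (hA : IsDetWeave A) (hD : Dense D) {z : ℝ × ℝ}
    (hz : z ∈ nonRamified A) {f g : CadlagPath} (hf : f ∈ A) (hg : g.τ = ⊤) (hgf : g.ExtendsTo f)
    (hgz : g.initialPoint = pt (z.1 : EReal) z.2) : g ∈ closure (restrictTo A D) := by
  obtain ⟨w, hw, hw'⟩ := mem_closure_iff_seq_limit.1 (hD z)
  choose F hF hFw using fun n => hA.pervasive (pt ((w n).1 : EReal) (w n).2)
  choose G hG hGF hGw using fun n => exists_restrict (hA.half (hF n)) (hFw n)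
  obtain ⟨f', hf', hFf⟩ := hA.compact.exists_tendsto_ultrafilter (hyperfilter ℕ) hF
  have hi : Tendsto (fun n => (G n).initialPoint) (hyperfilter ℕ) (𝓝 (pt (z.1 : EReal) z.2)) := by
    simp only [hGw]
    exact ((continuous_pt.comp ((continuous_coe_real_ereal.comp continuous_fst).prodMk
      continuous_snd)).tendsto z).comp (hw'.mono_left Nat.hyperfilter_le_atTop)
  exact mem_closure_of_tendsto
    (tendsto_restrict_of_isNonRamified hz hG hFf hGF hi hf' hf hg hgf hgz)
    (Eventually.of_forall fun n => ⟨hG n, w n, hw n, F n, hF n, hFw n, hGF n, hGw n⟩)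

theorem webOn_subset_downset (hA : IsDetWeave A) (D : Set (ℝ × ℝ)) : webOn D A ⊆ downset A :=
  closure_minimal ((downset_mono (restrictTo_subset_downset A D)).trans (downset_downset_subset A))
    (isCompact_downset hA.compact).isClosed

theorem downset_webOn_subset (A : Set CadlagPath) (D : Set (ℝ × ℝ)) :
    downset (webOn D A) ⊆ webOn D A :=
  downset_closure_subset (fun _ hg => hg.1) (downset_downset_subset _)

theorem webOn_eq_web (hA : IsDetWeave A) (hD : Dense D) (hD' : D ⊆ nonRamified A) :
    webOn D A = web A := by
  refine Subset.antisymm (closure_mono (downset_mono ?_)) (closure_minimal ?_ isClosed_closure)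
  · rintro g ⟨hg, z, hz, h⟩
    exact ⟨hg, z, hD' hz, h⟩
  · refine (downset_mono ?_).trans (downset_webOn_subset A D)
    rintro g ⟨hg, z, hz, f, hf, -, hgf, hgz⟩
    exact closure_mono (subset_downset fun _ h => h.1)
      (hA.mem_closure_restrictTo hD hz hf hg hgf hgz)

/-- All points of the dense set `D` are passed, and the points passed by a compact set of paths form
a closed set. -/
theorem webOn_isDetWeave (hA : IsDetWeave A) (hD : Dense D) : IsDetWeave (webOn D A) := by
  have hsub := hA.webOn_subset_downset D
  have hc : IsCompact (webOn D A) :=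
    (isCompact_downset hA.compact).of_isClosed_subset isClosed_closure hsub
  refine ⟨hc, fun g hg => (hsub hg).1, fun f hf g hg => ?_, fun z => ?_⟩
  · obtain ⟨-, f', hf', hff⟩ := hsub hf
    obtain ⟨-, g', hg', hgg⟩ := hsub hg
    exact (hA.nonCrossing f' hf' g' hg').mono hff hgg
  · have hcont : Continuous fun z : ℝ × ℝ => pt (z.1 : EReal) z.2 :=
      continuous_pt.comp ((continuous_coe_real_ereal.comp continuous_fst).prodMk continuous_snd)
    have hd := denseRange_pt.dense_image hcont hD
    refine closure_minimal ?_ (isClosed_passed hc) (hd z)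
    rintro _ ⟨w, hw, rfl⟩
    obtain ⟨f, hf, hwf⟩ := hA.pervasive (pt (w.1 : EReal) w.2)
    obtain ⟨g, hg, hgf, hgw⟩ := exists_restrict (hA.half hf) hwf
    refine ⟨g, subset_closure (subset_downset (fun _ h => h.1) ?_), ?_⟩
    · exact ⟨hg, w, hw, f, hf, hwf, hgf, hgw⟩
    · have := g.initialPoint_mem
      rwa [hgw] at this

theorem web_isDetWeave (hA : IsDetWeave A) : IsDetWeave (web A) :=
  hA.webOn_isDetWeave hA.dense_nonRamified

theorem web_subset_downset (hA : IsDetWeave A) : web A ⊆ downset A := hA.webOn_subset_downset _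

/-- Compute web(A) with the points that are non-ramified in the flow: they are dense, also
non-ramified in `A`, and have the same restrictions in both. The web is thus a function of the flow.
-/
theorem web_eq_web_flow (hA : IsDetWeave A) : web A = web (flow A) := by
  rw [← hA.webOn_eq_web hA.dense_nonRamified_flow hA.nonRamified_flow_subset, web, webOn, webOn,
    restrictTo_eq_of_subset_downset hA.half hA.pervasive hA.subset_downset_flow subset_rfl]

/-- Comparable weaves have the same web. -/
theorem web_eq_of_subset_downset (hA : IsDetWeave A) (hB : IsDetWeave B) (h : A ⊆ downset B) :
    web A = web B := by
  rw [hA.web_eq_web_flow, hB.web_eq_web_flow, hA.flow_eq_of_subset_downset hB h]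

theorem web_web (hA : IsDetWeave A) : web (web A) = web A :=
  hA.web_isDetWeave.web_eq_of_subset_downset hA hA.web_subset_downset

theorem flow_flow (hA : IsDetWeave A) : flow (flow A) = flow A :=
  (hA.flow_eq_of_subset_downset hA.flow_isDetWeave hA.subset_downset_flow).symm

theorem preceq_web (hA : IsDetWeave A) : Preceq (web A) A := by
  refine ⟨fun g hg => downset_webOn_subset A _ hg.1, hA.web_subset_downset⟩

end IsDetWeave
end

section

/-! ### Measurability of the web and of the flow -/

open SpaceTime CadlagPath

/-- A map to the compact sets is measurable if the hitting sets of all open sets are. -/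
theorem measurable_compacts_of_open {α X : Type*} [MeasurableSpace α] [EMetricSpace X]
    [SecondCountableTopology X] {φ : α → NonemptyCompacts X}
    (h : ∀ V : Set X, IsOpen V → MeasurableSet {a | ((φ a : Set X) ∩ V).Nonempty}) :
    @Measurable α (NonemptyCompacts X) _ (borel _) φ := by
  have hclosed : ∀ F : Set X, IsClosed F → MeasurableSet {a | ((φ a : Set X) ∩ F).Nonempty} := by
    intro F hF
    have hr : ∀ n : ℕ, (0 : ENNReal) < ((n : ENNReal) + 1)⁻¹ := fun n =>
      ENNReal.inv_pos.2 (ENNReal.add_ne_top.2 ⟨ENNReal.natCast_ne_top n, ENNReal.one_ne_top⟩)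
    -- By compactness of `φ a`, it meets `F` as soon as it meets all neighbourhoods of `F` of radius
    -- 1/(n+1).
    have : {a | ((φ a : Set X) ∩ F).Nonempty} =
        ⋂ n : ℕ, {a | ((φ a : Set X) ∩ {x | Metric.infEDist x F < ((n : ENNReal) + 1)⁻¹}).Nonempty} := by
      ext a
      rw [mem_iInter]
      refine ⟨fun ⟨x, hx, hx'⟩ n => ⟨x, hx, ?_⟩, fun H => ?_⟩
      · show Metric.infEDist x F < _
        rw [Metric.infEDist_zero_of_mem hx']
        exact hr n
      · obtain ⟨x, hx, hmin⟩ := (φ a).isCompact.exists_isMinOn (φ a).nonempty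
          (Metric.continuous_infEDist (s := F)).continuousOn
        refine ⟨x, hx, (Metric.mem_iff_infEDist_zero_of_closed hF).2 ?_⟩
        by_contra hne
        obtain ⟨n, hn⟩ := ENNReal.exists_inv_nat_lt hne
        obtain ⟨y, hy, hy'⟩ := H n
        have h1 : Metric.infEDist y F < ((n : ENNReal) + 1)⁻¹ := hy'
        refine ((hmin hy).trans_lt (h1.trans_le ?_)).not_ge hn.le
        exact ENNReal.inv_le_inv.2 le_self_add
    rw [this]
    exact MeasurableSet.iInter fun n =>
      h _ (isOpen_lt Metric.continuous_infEDist continuous_const)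
  -- The Vietoris topology has a subbasis of conditions of hitting, or of being contained in, an
  -- open set; second countability lets the subbasis generate the Borel sets.
  rw [borel_eq_generateFrom_of_subbasis induced_generateFrom_eq]
  refine measurable_generateFrom ?_
  rintro _ ⟨_, ⟨U, hU, rfl⟩ | ⟨U, hU, rfl⟩, rfl⟩
  · have : φ ⁻¹' (((↑) : NonemptyCompacts X → Set X) ⁻¹' 𝒫 U) =
        {a | ((φ a : Set X) ∩ Uᶜ).Nonempty}ᶜ := by
      ext a
      simp only [mem_preimage, mem_powerset_iff, mem_ofPred_eq, mem_compl_iff, not_nonempty_iff_eq_empty,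
        ← sdiff_eq, sdiff_eq_empty]
    rw [this]
    exact (hclosed _ hU.isClosed_compl).compl
  · exact h U hU

/-- A map to the compact sets is measurable if the hitting sets of all closed sets are. -/
theorem measurable_compacts_of_closed {α X : Type*} [MeasurableSpace α] [EMetricSpace X]
    [SecondCountableTopology X] {φ : α → NonemptyCompacts X}
    (h : ∀ F : Set X, IsClosed F → MeasurableSet {a | ((φ a : Set X) ∩ F).Nonempty}) :
    @Measurable α (NonemptyCompacts X) _ (borel _) φ := by
  refine measurable_compacts_of_open fun V hV => ?_
  obtain ⟨F, hF, -, hFV, -⟩ := hV.exists_iUnion_isClosed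
  have : {a | ((φ a : Set X) ∩ V).Nonempty} = ⋃ n, {a | ((φ a : Set X) ∩ F n).Nonempty} := by
    ext a
    simp only [← hFV, inter_iUnion, nonempty_iUnion, mem_iUnion, mem_ofPred_eq]
  rw [this]
  exact MeasurableSet.iUnion fun n => h _ (hF n)

/-- Elements of a convergent family of compact sets have limits. -/
theorem exists_tendsto_of_tendsto_compacts {X ι : Type*} [EMetricSpace X] {U : Ultrafilter ι}
    {K : ι → NonemptyCompacts X} {L : NonemptyCompacts X} (h : Tendsto K U (𝓝 L))
    {q : ι → X} (hq : ∀ i, q i ∈ K i) : ∃ p ∈ (L : Set X), Tendsto q U (𝓝 p) := by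
  choose k hk hk' using fun i => L.isCompact.exists_infEDist_eq_edist L.nonempty (q i)
  obtain ⟨p, hp, hp'⟩ := L.isCompact.exists_tendsto_ultrafilter U hk
  refine ⟨p, hp, tendsto_iff_edist_tendsto_0.2 ?_⟩
  have hsum : Tendsto (fun i => edist (K i) L + edist (k i) p) U (𝓝 0) := by
    simpa using (tendsto_iff_edist_tendsto_0.1 h).add (tendsto_iff_edist_tendsto_0.1 hp')
  refine tendsto_of_tendsto_of_tendsto_of_le_of_le tendsto_const_nhds hsum (fun _ => zero_le)
    fun i => ?_
  refine (edist_triangle _ (k i) _).trans ?_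
  gcongr
  rw [← hk']
  exact Metric.infEDist_le_hausdorffEDist_of_mem (hq i)

theorem isDetWeave_of_mem {A : CompactPaths} (h : A ∈ detWeaves) :
    IsDetWeave (A : Set CadlagPath) := ⟨A.isCompact, h.1, h.2.1, h.2.2⟩

theorem coe_toCompactPaths {S : Set CadlagPath} (h : IsDetWeave S) (A : CompactPaths) :
    (toCompactPaths S A : Set CadlagPath) = S := by
  have hne : S.Nonempty := let ⟨f, hf, _⟩ := h.pervasive top; ⟨f, hf⟩
  rw [toCompactPaths, dif_pos ⟨h.compact, hne⟩]
  rfl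

theorem toCompactPaths_mem {S : Set CadlagPath} (h : IsDetWeave S) (A : CompactPaths) :
    toCompactPaths S A ∈ detWeaves := by
  refine ⟨?_, ?_, ?_⟩ <;> rw [coe_toCompactPaths h]
  exacts [h.half, h.nonCrossing, h.pervasive]

theorem coe_flowMap {A : CompactPaths} (h : A ∈ detWeaves) : (flowMap A : Set CadlagPath) = flow A :=
  coe_toCompactPaths (isDetWeave_of_mem h).flow_isDetWeave A

theorem coe_webMap {A : CompactPaths} (h : A ∈ detWeaves) : (webMap A : Set CadlagPath) = web A :=
  coe_toCompactPaths (isDetWeave_of_mem h).web_isDetWeave A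

theorem flowMap_mem {A : CompactPaths} (h : A ∈ detWeaves) : flowMap A ∈ detWeaves :=
  toCompactPaths_mem (isDetWeave_of_mem h).flow_isDetWeave A

theorem webMap_mem {A : CompactPaths} (h : A ∈ detWeaves) : webMap A ∈ detWeaves :=
  toCompactPaths_mem (isDetWeave_of_mem h).web_isDetWeave A

/-- The flow is an upper semi-continuous function of the weave. -/
theorem isClosed_flow_inter_nonempty {F : Set CadlagPath} (hF : IsClosed F) :
    IsClosed {A : detWeaves | (flow (A : CompactPaths) ∩ F).Nonempty} := by
  refine IsSeqClosed.isClosed fun A B hA hAB => ?_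
  choose f hf hfF using hA
  have hU : Tendsto (fun n => (A n : CompactPaths)) (hyperfilter ℕ) (𝓝 (B : CompactPaths)) :=
    (continuous_subtype_val.tendsto B).comp (hAB.mono_left Nat.hyperfilter_le_atTop)
  obtain ⟨g, hg, hg'⟩ := exists_tendsto_flow exists_small_hyperfilter
    (fun n => isDetWeave_of_mem (A n).2) (isDetWeave_of_mem B.2)
    (fun _ hh => exists_tendsto_of_tendsto_compacts hU hh)
    (fun _ hg => exists_tendsto_compacts hU hg) hf
  exact ⟨g, hg, hF.mem_of_tendsto hg' (Eventually.of_forall hfF)⟩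

/-- The web is a lower semi-continuous function of the weave. -/
theorem isOpen_web_inter_nonempty {V : Set CadlagPath} (hV : IsOpen V) :
    IsOpen {A : detWeaves | (web (A : CompactPaths) ∩ V).Nonempty} := by
  refine isClosed_compl_iff.1 (IsSeqClosed.isClosed fun A B hA hAB hB => ?_)
  have hU : Tendsto (fun n => (A n : CompactPaths)) (hyperfilter ℕ) (𝓝 (B : CompactPaths)) :=
    (continuous_subtype_val.tendsto B).comp (hAB.mono_left Nat.hyperfilter_le_atTop)
  have hAw := fun n => isDetWeave_of_mem (A n).2
  obtain ⟨g, hg, hgV⟩ := hB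
  -- As `V` is open, it contains an element of the set whose closure is the web: a restriction g of
  -- some k that starts at a non-ramified point z of `B`. Non-ramified points of `A n` tending to z
  -- then give restrictions tending to k, and further restrictions tending to g.
  obtain ⟨g, hgV, hg, k, ⟨hk, z, hz, f, hf, hzf, hkf, hkz⟩, hgk⟩ :=
    mem_closure_iff.1 hg V hV hgV
  choose w hw hwz using fun n : ℕ =>
    (hAw n).dense_nonRamified.exists_dist_lt z (Nat.one_div_pos_of_nat (α := ℝ) (n := n))
  have hwz' : Tendsto w (hyperfilter ℕ) (𝓝 z) := by
    refine (tendsto_iff_dist_tendsto_zero.2 ?_).mono_left Nat.hyperfilter_le_atTop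
    refine squeeze_zero (fun _ => dist_nonneg) (fun n => ?_)
      tendsto_one_div_add_atTop_nhds_zero_nat
    rw [dist_comm]
    exact (hwz n).le
  choose F hF hFw using fun n => (hAw n).pervasive (pt ((w n).1 : EReal) (w n).2)
  choose G hG hGF hGw using fun n => exists_restrict ((hAw n).half (hF n)) (hFw n)
  obtain ⟨f', hf', hFf⟩ := exists_tendsto_of_tendsto_compacts hU hF
  have hi : Tendsto (fun n => (G n).initialPoint) (hyperfilter ℕ) (𝓝 (pt (z.1 : EReal) z.2)) := by
    simp only [hGw]
    exact ((continuous_pt.comp ((continuous_coe_real_ereal.comp continuous_fst).prodMk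
      continuous_snd)).tendsto z).comp hwz'
  have hGk := tendsto_restrict_of_isNonRamified hz hG hFf hGF hi hf' hf hk hkf hkz
  obtain ⟨H, hH, hHg⟩ := exists_tendsto_restrict hG hGk hg hgk
  obtain ⟨n, hn⟩ := (hHg.eventually_mem (hV.mem_nhds hgV)).exists
  refine hA n ⟨H n, subset_closure ⟨(hH n).1, G n, ?_, (hH n).2⟩, hn⟩
  exact ⟨hG n, w n, hw n, F n, hF n, hFw n, hGF n, hGw n⟩

theorem measurable_flowMap : Measurable fun A : detWeaves => flowMap A := by
  refine measurable_compacts_of_closed fun F hF => ?_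
  simp only [fun A : detWeaves => coe_flowMap A.2]
  exact (isClosed_flow_inter_nonempty hF).measurableSet

theorem measurable_webMap : Measurable fun A : detWeaves => webMap A := by
  refine measurable_compacts_of_open fun V hV => ?_
  simp only [fun A : detWeaves => coe_webMap A.2]
  exact (isOpen_web_inter_nonempty hV).measurableSet

theorem IsWeave.aemeasurable {μ : Measure CompactPaths} (hμ : IsWeave μ)
    {φ : CompactPaths → CompactPaths} (h : Measurable fun A : detWeaves => φ A) :
    AEMeasurable φ μ := by
  obtain ⟨S, hμS, hS, hSsub⟩ := hμ.ae_mem.exists_measurable_mem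
  have h1 : Measurable fun A : S => φ A := h.comp (measurable_inclusion hSsub)
  have h2 := aemeasurable_restrict_of_measurable_subtype (μ := μ) hS h1
  rwa [Measure.restrict_eq_self_of_ae_mem hμS] at h2
end

section

/-! ### The set of deterministic weaves is measurable -/

open SpaceTime CadlagPath

namespace CadlagPath

variable {f g : CadlagPath}

/-- The path `g` has a point at the initial time of `f` that lies on the right of the initial point
of `f`. -/
def StartsLeftOf (f g : CadlagPath) : Prop :=
  ∃ s : ℝ, f.σ = s ∧ ∃ y, f.left s ≤ y ∧ pt y s ∈ g.graph

/-- `StartsLeftOf` is a trace of the order at an initial time that passes to limits, whereas the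
comparison of left values does not. -/
theorem LeftOf.startsLeftOf (h : f.LeftOf g) (hg : g.τ = ⊤) {s : ℝ} (hf : f.σ = s)
    (hs : g.σ < s) : f.StartsLeftOf g := by
  have hgτ : (s : EReal) ≤ g.τ := by simp [hg]
  refine ⟨s, hf, ?_⟩
  rcases lt_or_ge (f.right s) (f.left s) with hlt | hge
  · exact ⟨_, h.2 s hf.le hs.le (.inr hlt) (.inl hs), pt_left_mem hs.le hgτ⟩
  · exact ⟨_, hge.trans (h.1 s hf.le hs.le), pt_right_mem hs.le hgτ⟩

theorem LeftOf.startsLeftOf_or (h : f.LeftOf g) (hf : f.τ = ⊤) (hg : g.τ = ⊤) {s t : ℝ}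
    (hfs : f.σ = s) (hgt : g.σ = t) : f.StartsLeftOf g ∨ g.reflect.StartsLeftOf f.reflect := by
  rcases lt_trichotomy s t with hst | rfl | hst
  · exact .inr (h.reflect.startsLeftOf hf hgt
      (by simpa [hfs] using hst))
  · have hgτ : (s : EReal) ≤ g.τ := by simp [hg]
    have hfτ : (s : EReal) ≤ f.τ := by simp [hf]
    rcases lt_or_ge (f.right s) (f.left s) with hlt | hge
    · rcases lt_or_ge (g.left s) (g.right s) with hlt' | hge'
      · exact .inl ⟨s, hfs, _, h.2 s hfs.le hgt.le (.inr hlt) (.inr hlt'), pt_left_mem hgt.le hgτ⟩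
      · refine .inr ⟨s, hgt, -f.right s, ?_, ?_⟩
        · simpa using (h.1 s hfs.le hgt.le).trans hge'
        · rw [mem_graph_reflect]
          simpa using pt_right_mem hfs.le hfτ
    · exact .inl ⟨s, hfs, _, hge.trans (h.1 s hfs.le hgt.le), pt_right_mem hgt.le hgτ⟩
  · exact .inl (h.startsLeftOf hg hfs (by simpa [hgt] using hst))

variable {ι : Type*} {U : Ultrafilter ι} {F G : ι → CadlagPath}

/-- In the limit g has a point at time t not on the left of f(t-). If g(t-) < f(t-), then g jumps to
the right up to f(t-), opposite to the jump of f. -/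
theorem left_le_of_tendsto_of_startsLeftOf (hF : Tendsto F U (𝓝 f)) (hG : Tendsto G U (𝓝 g))
    (h : ∀ᶠ i in U, (F i).StartsLeftOf (G i)) {t : ℝ} (hft : f.σ = t)
    (hlt : f.right t < f.left t)
    (hno : ∀ u v, u < v → v ≤ f.left t → f.right t ≤ u → g.left t ≤ u → v ≤ g.right t → False) :
    f.left t ≤ g.left t := by
  have hi := tendsto_initialPoint hF
  rw [initialPoint_of_eq hft] at hi
  obtain ⟨hi1, hi2⟩ := tendsto_pt.1 hi
  have hex : ∀ᶠ i in U, ∃ y, (F i).initialPoint.space ≤ y ∧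
      pt y (F i).initialPoint.time.toReal ∈ (G i).graph := by
    filter_upwards [h] with i ⟨s, hs, hy⟩
    simpa [initialPoint_of_eq hs, SpaceTime.space] using hy
  choose! p hp1 hp2 using fun i (hi : ∃ y, (F i).initialPoint.space ≤ y ∧
      pt y (F i).initialPoint.time.toReal ∈ (G i).graph) => hi
  obtain ⟨y, hy1, hy2⟩ := exists_tendsto_pt_of_time (U := U)
    (z := fun i => pt (p i) (F i).initialPoint.time.toReal) (t := t)
    ((continuous_coe_real_ereal.tendsto t).comp (tendsto_toReal_time hi1))
  have hfy : f.left t ≤ y := le_of_tendsto_of_tendsto hi2 hy2 (hex.mono hp1)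
  have hyg := mem_graph_of_tendsto_path hG (hex.mono hp2) hy1
  by_contra hc
  rw [not_le] at hc
  have hgy : f.left t ≤ g.right t := by
    rcases le_sup_iff.1 (hfy.trans hyg.2.2.2) with h | h
    · exact absurd hc h.not_gt
    · exact h
  exact hno (g.left t ⊔ f.right t) (f.left t) (max_lt hc hlt) le_rfl le_sup_right le_sup_left hgy

/-- Limits of ordered paths are ordered, unless they move in opposite directions at a same time. -/
theorem leftOf_of_tendsto_of_no_opposite (hF : Tendsto F U (𝓝 f)) (hG : Tendsto G U (𝓝 g))
    (hFτ : ∀ i, (F i).τ = ⊤) (hGτ : ∀ i, (G i).τ = ⊤) (h : ∀ᶠ i in U, (F i).LeftOf (G i))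
    (hno : ∀ t : ℝ, f.σ ≤ t → g.σ ≤ t → ∀ u v, u < v → v ≤ f.left t → f.right t ≤ u →
      g.left t ≤ u → v ≤ g.right t → False) : f.LeftOf g := by
  have hFi := (continuous_time.tendsto _).comp (tendsto_initialPoint hF)
  have hGi := (continuous_time.tendsto _).comp (tendsto_initialPoint hG)
  simp only [Function.comp_def, time_initialPoint] at hFi hGi
  refine leftOf_of (top_of_tendsto hF (.of_forall hFτ)) (top_of_tendsto hG (.of_forall hGτ))
    (fun t => right_le_of_tendsto hF hG hFτ hGτ h) fun t hft hgt hor h4 h5 => ?_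
  have hreal : ∀ {H : ι → EReal}, Tendsto H U (𝓝 (t : EReal)) →
      ∀ᶠ i in U, ∃ s : ℝ, H i = s := fun hH => by
    filter_upwards [hH.eventually_ne (EReal.coe_ne_bot t),
      hH.eventually_ne (EReal.coe_ne_top t)] with i h1 h2
    exact ⟨_, (EReal.coe_toReal h2 h1).symm⟩
  -- Left values need attention only where a limit path starts. If just one of them starts at t, the
  -- corresponding approximants eventually start later than the others.
  have key : (f.σ = t ∧ ∀ᶠ i in U, (F i).StartsLeftOf (G i)) ∨
      (g.σ = t ∧ ∀ᶠ i in U, (G i).reflect.StartsLeftOf (F i).reflect) := by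
    rcases hft.lt_or_eq with hft' | hft' <;> rcases hgt.lt_or_eq with hgt' | hgt'
    · exact absurd hor (not_or.2 ⟨hft'.ne, hgt'.ne⟩)
    · refine .inr ⟨hgt', ?_⟩
      obtain ⟨c, hc1, hc2⟩ := _root_.exists_between hft'
      filter_upwards [h, hreal (hgt' ▸ hGi), hFi.eventually_lt_const hc1,
        (hgt' ▸ hGi).eventually_const_lt hc2] with i h1 ⟨s, h2⟩ h3 h4
      exact h1.reflect.startsLeftOf (hFτ i) h2 ((h3.trans h4).trans_eq h2)
    · refine .inl ⟨hft', ?_⟩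
      obtain ⟨c, hc1, hc2⟩ := _root_.exists_between hgt'
      filter_upwards [h, hreal (hft' ▸ hFi), hGi.eventually_lt_const hc1,
        (hft' ▸ hFi).eventually_const_lt hc2] with i h1 ⟨s, h2⟩ h3 h4
      exact h1.startsLeftOf (hGτ i) h2 ((h3.trans h4).trans_eq h2)
    · have : ∀ᶠ i in U, (F i).StartsLeftOf (G i) ∨ (G i).reflect.StartsLeftOf (F i).reflect := by
        filter_upwards [h, hreal (hft' ▸ hFi), hreal (hgt' ▸ hGi)] with i h1 ⟨s, h2⟩ ⟨r, h3⟩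
        exact h1.startsLeftOf_or (hFτ i) (hGτ i) h2 h3
      exact (Ultrafilter.eventually_or.1 this).imp (fun h => ⟨hft', h⟩) fun h => ⟨hgt', h⟩
  rcases key with ⟨h1, h2⟩ | ⟨h1, h2⟩
  · exact left_le_of_tendsto_of_startsLeftOf hF hG h2 h1 (h4.resolve_left h1.not_lt) (hno t hft hgt)
  · have := left_le_of_tendsto_of_startsLeftOf (tendsto_reflect hG) (tendsto_reflect hF) h2 h1
      (by simpa using h5.resolve_left h1.not_lt) fun u v huv a b c d => ?_
    · simpa using this
    · simp only [reflect_left, reflect_right] at a b c d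
      exact hno t hft hgt (-v) (-u) (EReal.neg_lt_neg_iff.2 huv) (EReal.neg_le_of_neg_le c)
        (EReal.le_neg_of_le_neg d) (EReal.le_neg_of_le_neg a) (EReal.neg_le_of_neg_le b)

end CadlagPath

/-- The compact sets with two paths that traverse the spatial interval `[a, b]` in opposite
directions at a same time in `[-n, n]`. -/
def oppositeMoves (a b : ℝ) (n : ℕ) : Set CompactPaths :=
  {A | ∃ f ∈ A, ∃ g ∈ A, ∃ t ∈ Icc (-n : ℝ) n, f.Le (pt b t) (pt a t) ∧ g.Le (pt a t) (pt b t)}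

theorem isClosed_oppositeMoves (a b : ℝ) (n : ℕ) : IsClosed (oppositeMoves a b n) := by
  refine IsSeqClosed.isClosed fun A B hA hAB => ?_
  choose f hf g hg t ht h1 h2 using hA
  have hU : Tendsto A (hyperfilter ℕ) (𝓝 B) := hAB.mono_left Nat.hyperfilter_le_atTop
  obtain ⟨f', hf', hff⟩ := exists_tendsto_of_tendsto_compacts hU hf
  obtain ⟨g', hg', hgg⟩ := exists_tendsto_of_tendsto_compacts hU hg
  obtain ⟨s, hs, hts⟩ := isCompact_Icc.exists_tendsto_ultrafilter (hyperfilter ℕ) ht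
  have hp : ∀ c : EReal, Tendsto (fun i => pt c (t i)) (hyperfilter ℕ) (𝓝 (pt c s)) := fun c =>
    (continuous_pt.tendsto (c, s)).comp (tendsto_const_nhds.prodMk_nhds hts)
  exact ⟨f', hf', g', hg', s, hs, le_of_tendsto_path hff (.of_forall h1) (hp _) (hp _),
    le_of_tendsto_path hgg (.of_forall h2) (hp _) (hp _)⟩

/-- Non-crossing is not a closed condition, since initial jumps may become simultaneous with
opposite jumps in the limit. This is the only defect, and with rational levels and bounded times it
is excluded by countably many complements of closed sets. -/
theorem detWeaves_eq : detWeaves = closure detWeaves ∩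
    ⋂ (a : ℚ) (b : ℚ) (_ : a < b) (n : ℕ), (oppositeMoves a b n)ᶜ := by
  refine Subset.antisymm (fun A hA => ⟨subset_closure hA, ?_⟩) ?_
  · simp only [mem_iInter]
    rintro a b hab n ⟨f, hf, g, hg, t, -, h1, h2⟩
    exact (hA.2.1 g hg f hf).not_opposite (hA.1 hg) (hA.1 hf) h2 h1
      (show ((a : ℝ) : EReal) < (b : ℝ) by exact_mod_cast hab) le_rfl le_rfl le_rfl le_rfl
  · rintro B ⟨hB, hno⟩
    simp only [mem_iInter] at hno
    obtain ⟨A, hA, hAB⟩ := mem_closure_iff_seq_limit.1 hB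
    have hU : Tendsto A (hyperfilter ℕ) (𝓝 B) := hAB.mono_left Nat.hyperfilter_le_atTop
    have hhalf : (B : Set CadlagPath) ⊆ halfInfinite := fun f hf => by
      obtain ⟨F, hF, hFf⟩ := exists_tendsto_compacts hU hf
      exact top_of_tendsto hFf (.of_forall fun n => (hA n).1 (hF n))
    refine ⟨hhalf, fun f hf g hg => ?_, fun z => ?_⟩
    · obtain ⟨F, hF, hFf⟩ := exists_tendsto_compacts hU hf
      obtain ⟨G, hG, hGg⟩ := exists_tendsto_compacts hU hg
      have hFτ := fun n => (hA n).1 (hF n)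
      have hGτ := fun n => (hA n).1 (hG n)
      have hopp : ∀ f ∈ B, ∀ g ∈ B, ∀ t : ℝ, f.σ ≤ t → g.σ ≤ t → ∀ u v, u < v → v ≤ f.left t →
          f.right t ≤ u → g.left t ≤ u → v ≤ g.right t → False := by
        intro f hf g hg t hft hgt u v huv h1 h2 h3 h4
        obtain ⟨a, hua, hav⟩ := EReal.lt_iff_exists_rat_btwn.1 huv
        obtain ⟨b, hab, hbv⟩ := EReal.lt_iff_exists_rat_btwn.1 hav
        obtain ⟨n, hn⟩ := exists_nat_ge |t|
        have hfτ : (t : EReal) ≤ f.τ := by simp [show f.τ = ⊤ from hhalf hf]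
        have hgτ : (t : EReal) ≤ g.τ := by simp [show g.τ = ⊤ from hhalf hg]
        refine hno a b (by exact_mod_cast hab) n ⟨f, hf, g, hg, t, abs_le.1 hn, ?_, ?_⟩
        · refine le_pt.2 ⟨hft, hfτ, mem_uIcc.2 (.inr ⟨?_, ?_⟩), mem_uIcc.2 (.inr ⟨?_, ?_⟩)⟩
          exacts [h2.trans hua.le, (hab.le.trans hbv.le).trans h1, hab.le, hbv.le.trans h1]
        · refine le_pt.2 ⟨hgt, hgτ, mem_uIcc.2 (.inl ⟨?_, ?_⟩), mem_uIcc.2 (.inl ⟨?_, ?_⟩)⟩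
          exacts [h3.trans (hua.le.trans hab.le), hbv.le.trans h4, h3.trans hua.le, hab.le]
      rw [nonCrossing_iff (hhalf hf) (hhalf hg)]
      have hor : (∀ᶠ n in hyperfilter ℕ, (F n).LeftOf (G n)) ∨
          ∀ᶠ n in hyperfilter ℕ, (G n).LeftOf (F n) := by
        rw [← Ultrafilter.eventually_or]
        exact .of_forall fun n => ((hA n).2.1 _ (hF n) _ (hG n)).leftOf (hFτ n) (hGτ n)
      exact hor.imp
        (fun h => leftOf_of_tendsto_of_no_opposite hFf hGg hFτ hGτ h (hopp f hf g hg))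
        (fun h => leftOf_of_tendsto_of_no_opposite hGg hFf hGτ hFτ h (hopp g hg f hf))
    · choose F hF hFz using fun n => (hA n).2.2 z
      obtain ⟨f, hf, hFf⟩ := exists_tendsto_of_tendsto_compacts hU hF
      exact ⟨f, hf, mem_graph_of_tendsto_path hFf (.of_forall hFz) tendsto_const_nhds⟩

theorem measurableSet_detWeaves : MeasurableSet detWeaves := by
  rw [detWeaves_eq]
  exact isClosed_closure.measurableSet.inter <| .iInter fun a => .iInter fun b => .iInter fun _ =>
    .iInter fun n => (isClosed_oppositeMoves a b n).measurableSet.compl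
end

section

/-! ### Laws of weaves -/

open CadlagPath

section Coupling

variable {μ : Measure CompactPaths} {φ : CompactPaths → CompactPaths}

theorem map_fst_prodMk (hφ : AEMeasurable φ μ) : (μ.map fun A => (A, φ A)).map Prod.fst = μ := by
  rw [AEMeasurable.map_map_of_aemeasurable measurable_fst.aemeasurable
    (aemeasurable_id'.prodMk hφ)]
  exact Measure.map_id

theorem map_snd_prodMk (hφ : AEMeasurable φ μ) :
    (μ.map fun A => (A, φ A)).map Prod.snd = μ.map φ := by
  rw [AEMeasurable.map_map_of_aemeasurable measurable_snd.aemeasurable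
    (aemeasurable_id'.prodMk hφ)]
  rfl

/-- `P` need not be measurable. The graph of the measurable version of `φ` is measurable and carries
the image law; on it the claim concerns the first coordinate alone. -/
theorem ae_map_prodMk (hφ : AEMeasurable φ μ) {P : CompactPaths → CompactPaths → Prop}
    (h : ∀ᵐ A ∂μ, P A (φ A)) : ∀ᵐ p ∂(μ.map fun A => (A, φ A)), P p.1 p.2 := by
  have h1 : ∀ᵐ p ∂(μ.map fun A => (A, φ A)), p.2 = hφ.mk φ p.1 := by
    exact (ae_map_iff (aemeasurable_id'.prodMk hφ) (measurableSet_eq_fun measurable_snd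
      (hφ.measurable_mk.comp measurable_fst))).2 hφ.ae_eq_mk
  have h2 : ∀ᵐ p ∂(μ.map fun A => (A, φ A)), P p.1 (φ p.1) ∧ φ p.1 = hφ.mk φ p.1 := by
    refine ae_of_ae_map (f := Prod.fst) (p := fun A => P A (φ A) ∧ φ A = hφ.mk φ A)
      measurable_fst.aemeasurable ?_
    rw [map_fst_prodMk hφ]
    exact h.and hφ.ae_eq_mk
  filter_upwards [h1, h2] with p a b
  rw [a, ← b.2]
  exact b.1

theorem preceqLaw_map (hφ : AEMeasurable φ μ)
    (h : ∀ᵐ (A : CompactPaths) ∂μ, Preceq (A : Set CadlagPath) (φ A)) :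
    PreceqLaw μ (μ.map φ) :=
  ⟨_, map_fst_prodMk hφ, map_snd_prodMk hφ,
    ae_map_prodMk (P := fun A B => Preceq (A : Set CadlagPath) B) hφ h⟩

theorem map_preceqLaw (hφ : AEMeasurable φ μ)
    (h : ∀ᵐ (A : CompactPaths) ∂μ, Preceq (φ A : Set CadlagPath) A) :
    PreceqLaw (μ.map φ) μ := by
  refine ⟨(μ.map fun A => (A, φ A)).map Prod.swap, ?_, ?_, ?_⟩
  · rw [Measure.map_map measurable_fst measurable_swap]
    exact map_snd_prodMk hφ
  · rw [Measure.map_map measurable_snd measurable_swap]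
    exact map_fst_prodMk hφ
  · exact (MeasurableEquiv.prodComm (α := CompactPaths)
      (β := CompactPaths)).measurableEmbedding.ae_map_iff.2
        (ae_map_prodMk (P := fun A B => Preceq (B : Set CadlagPath) A) hφ h)

/-- The law of the image under an idempotent map is concentrated on the fixed points. -/
theorem ae_map_fixed (hφ : AEMeasurable φ μ) (hφ' : AEMeasurable φ (μ.map φ))
    (h : ∀ᵐ A ∂μ, φ (φ A) = φ A) : ∀ᵐ A ∂(μ.map φ), φ A = A := by
  have h1 : ∀ᵐ A ∂(μ.map φ), hφ'.mk φ A = A := by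
    refine (ae_map_iff hφ (measurableSet_eq_fun hφ'.measurable_mk measurable_id)).2 ?_
    filter_upwards [h, ae_of_ae_map hφ hφ'.ae_eq_mk] with A h2 h3
    exact h3.symm.trans h2
  filter_upwards [h1, hφ'.ae_eq_mk] with A h2 h3
  exact h3.trans h2

theorem map_eq_of_coupling {ν : Measure CompactPaths} {π : Measure (CompactPaths × CompactPaths)}
    (h1 : π.map Prod.fst = μ) (h2 : π.map Prod.snd = ν) (hμ : AEMeasurable φ μ)
    (hν : AEMeasurable φ ν) (h : ∀ᵐ p ∂π, φ p.1 = φ p.2) : μ.map φ = ν.map φ := by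
  subst h1 h2
  rw [AEMeasurable.map_map_of_aemeasurable hμ measurable_fst.aemeasurable,
    AEMeasurable.map_map_of_aemeasurable hν measurable_snd.aemeasurable]
  exact Measure.map_congr h

end Coupling

namespace IsWeave

variable {μ ν : Measure CompactPaths}

theorem aemeasurable_webMap (hμ : IsWeave μ) : AEMeasurable webMap μ :=
  hμ.aemeasurable measurable_webMap

theorem aemeasurable_flowMap (hμ : IsWeave μ) : AEMeasurable flowMap μ :=
  hμ.aemeasurable measurable_flowMap

/-- Transferring almost sure membership to the image law is where measurability of `detWeaves`
enters. -/
theorem map (hμ : IsWeave μ) {φ : CompactPaths → CompactPaths} (hφ : AEMeasurable φ μ)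
    (h : ∀ A ∈ detWeaves, φ A ∈ detWeaves) : IsWeave (μ.map φ) where
  isProbabilityMeasure :=
    have := hμ.isProbabilityMeasure
    Measure.isProbabilityMeasure_map hφ
  ae_mem := (ae_map_iff hφ measurableSet_detWeaves).2 (hμ.ae_mem.mono h)

theorem webLaw (hμ : IsWeave μ) : IsWeave (webLaw μ) :=
  hμ.map hμ.aemeasurable_webMap fun _ => webMap_mem

theorem flowLaw (hμ : IsWeave μ) : IsWeave (flowLaw μ) :=
  hμ.map hμ.aemeasurable_flowMap fun _ => flowMap_mem

theorem webLaw_preceqLaw (hμ : IsWeave μ) : PreceqLaw (_root_.webLaw μ) μ :=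
  map_preceqLaw hμ.aemeasurable_webMap <| hμ.ae_mem.mono fun A hA => by
    rw [coe_webMap hA]
    exact (isDetWeave_of_mem hA).preceq_web

theorem preceqLaw_flowLaw (hμ : IsWeave μ) : PreceqLaw μ (_root_.flowLaw μ) :=
  preceqLaw_map hμ.aemeasurable_flowMap <| hμ.ae_mem.mono fun A hA => by
    rw [coe_flowMap hA]
    exact (isDetWeave_of_mem hA).preceq_flow

/-- Under a coupling of two weaves, almost surely both of its components are weaves. -/
theorem ae_mem_coupling (hμ : IsWeave μ) (hν : IsWeave ν)
    {π : Measure (CompactPaths × CompactPaths)} (h1 : π.map Prod.fst = μ)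
    (h2 : π.map Prod.snd = ν) : ∀ᵐ p ∂π, p.1 ∈ detWeaves ∧ p.2 ∈ detWeaves :=
  (ae_of_ae_map measurable_fst.aemeasurable (h1 ▸ hμ.ae_mem)).and
    (ae_of_ae_map measurable_snd.aemeasurable (h2 ▸ hν.ae_mem))

theorem webLaw_eq (hμ : IsWeave μ) (hν : IsWeave ν) (h : PreceqLaw μ ν) :
    _root_.webLaw μ = _root_.webLaw ν := by
  obtain ⟨π, h1, h2, h3⟩ := h
  refine map_eq_of_coupling h1 h2 hμ.aemeasurable_webMap hν.aemeasurable_webMap ?_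
  filter_upwards [h3, hμ.ae_mem_coupling hν h1 h2] with p h4 ⟨h5, h6⟩
  refine SetLike.coe_injective ?_
  rw [coe_webMap h5, coe_webMap h6]
  exact (isDetWeave_of_mem h5).web_eq_of_subset_downset (isDetWeave_of_mem h6) h4.2

theorem flowLaw_eq (hμ : IsWeave μ) (hν : IsWeave ν) (h : PreceqLaw μ ν) :
    _root_.flowLaw μ = _root_.flowLaw ν := by
  obtain ⟨π, h1, h2, h3⟩ := h
  refine map_eq_of_coupling h1 h2 hμ.aemeasurable_flowMap hν.aemeasurable_flowMap ?_
  filter_upwards [h3, hμ.ae_mem_coupling hν h1 h2] with p h4 ⟨h5, h6⟩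
  refine SetLike.coe_injective ?_
  rw [coe_flowMap h5, coe_flowMap h6]
  exact (isDetWeave_of_mem h5).flow_eq_of_subset_downset (isDetWeave_of_mem h6) h4.2

/-- In a coupling of a weave below `μ` with `μ`, the upper component is its own web, hence the web
of the lower one, hence below it; antisymmetry makes the two components equal. -/
theorem isWeb_of_ae_eq (hμ : IsWeave μ)
    (h : ∀ᵐ (A : CompactPaths) ∂μ, (A : Set CadlagPath) = web A) : IsWeb μ := by
  refine ⟨hμ, fun ν hν ⟨π, h1, h2, h3⟩ => ?_⟩
  subst h1 h2
  refine Measure.map_congr ?_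
  filter_upwards [h3, hν.ae_mem_coupling hμ rfl rfl,
    ae_of_ae_map measurable_snd.aemeasurable h] with p h4 ⟨h5, h6⟩ h7
  have h5' := isDetWeave_of_mem h5
  refine SetLike.coe_injective (h4.antisymm ?_)
  rw [h7, ← h5'.web_eq_of_subset_downset (isDetWeave_of_mem h6) h4.2]
  exact h5'.preceq_web

theorem isFlow_of_ae_eq (hμ : IsWeave μ)
    (h : ∀ᵐ (A : CompactPaths) ∂μ, (A : Set CadlagPath) = flow A) : IsFlow μ := by
  refine ⟨hμ, fun ν hν ⟨π, h1, h2, h3⟩ => ?_⟩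
  subst h1 h2
  refine Measure.map_congr (EventuallyEq.symm ?_)
  filter_upwards [h3, hμ.ae_mem_coupling hν rfl rfl,
    ae_of_ae_map measurable_fst.aemeasurable h] with p h4 ⟨h5, h6⟩ h7
  have h6' := isDetWeave_of_mem h6
  refine SetLike.coe_injective (h4.antisymm ?_)
  rw [h7, (isDetWeave_of_mem h5).flow_eq_of_subset_downset h6' h4.2]
  exact h6'.preceq_flow

theorem ae_eq_web_webLaw (hμ : IsWeave μ) :
    ∀ᵐ (A : CompactPaths) ∂(_root_.webLaw μ), (A : Set CadlagPath) = web A := by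
  have h : ∀ᵐ A ∂(_root_.webLaw μ), webMap A = A := by
    refine ae_map_fixed hμ.aemeasurable_webMap hμ.webLaw.aemeasurable_webMap ?_
    filter_upwards [hμ.ae_mem] with A hA
    refine SetLike.coe_injective ?_
    rw [coe_webMap (webMap_mem hA), coe_webMap hA, (isDetWeave_of_mem hA).web_web]
  filter_upwards [h, hμ.webLaw.ae_mem] with A h1 h2
  rw [← coe_webMap h2, h1]

theorem ae_eq_flow_flowLaw (hμ : IsWeave μ) :
    ∀ᵐ (A : CompactPaths) ∂(_root_.flowLaw μ), (A : Set CadlagPath) = flow A := by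
  have h : ∀ᵐ A ∂(_root_.flowLaw μ), flowMap A = A := by
    refine ae_map_fixed hμ.aemeasurable_flowMap hμ.flowLaw.aemeasurable_flowMap ?_
    filter_upwards [hμ.ae_mem] with A hA
    refine SetLike.coe_injective ?_
    rw [coe_flowMap (flowMap_mem hA), coe_flowMap hA, (isDetWeave_of_mem hA).flow_flow]
  filter_upwards [h, hμ.flowLaw.ae_mem] with A h1 h2
  rw [← coe_flowMap h2, h1]

theorem isWeb_webLaw (hμ : IsWeave μ) : IsWeb (_root_.webLaw μ) :=
  hμ.webLaw.isWeb_of_ae_eq hμ.ae_eq_web_webLaw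

theorem isFlow_flowLaw (hμ : IsWeave μ) : IsFlow (_root_.flowLaw μ) :=
  hμ.flowLaw.isFlow_of_ae_eq hμ.ae_eq_flow_flowLaw

theorem webLaw_webLaw (hμ : IsWeave μ) : _root_.webLaw (_root_.webLaw μ) = _root_.webLaw μ :=
  hμ.webLaw.webLaw_eq hμ hμ.webLaw_preceqLaw

theorem flowLaw_webLaw (hμ : IsWeave μ) : _root_.flowLaw (_root_.webLaw μ) = _root_.flowLaw μ :=
  hμ.webLaw.flowLaw_eq hμ hμ.webLaw_preceqLaw

theorem webLaw_flowLaw (hμ : IsWeave μ) : _root_.webLaw (_root_.flowLaw μ) = _root_.webLaw μ :=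
  (hμ.webLaw_eq hμ.flowLaw hμ.preceqLaw_flowLaw).symm

/-- Web and flow determine each other in law: the flow of the web is the flow, and the web of the
flow is the web. -/
theorem webLaw_eq_iff (hμ : IsWeave μ) (hν : IsWeave ν) :
    _root_.webLaw ν = _root_.webLaw μ ↔ _root_.flowLaw ν = _root_.flowLaw μ :=
  ⟨fun h => by rw [← hν.flowLaw_webLaw, h, hμ.flowLaw_webLaw],
    fun h => by rw [← hν.webLaw_flowLaw, h, hμ.webLaw_flowLaw]⟩

end IsWeave

/-- The law of the web is a weave below `μ`, so minimality forces equality. -/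
theorem IsWeb.webLaw_eq_self {μ : Measure CompactPaths} (h : IsWeb μ) : webLaw μ = μ :=
  h.2 _ h.1.webLaw h.1.webLaw_preceqLaw

theorem IsFlow.flowLaw_eq_self {μ : Measure CompactPaths} (h : IsFlow μ) : flowLaw μ = μ :=
  h.2 _ h.1.flowLaw h.1.preceqLaw_flowLaw

theorem IsWeave.isWeb_iff {μ : Measure CompactPaths} (hμ : IsWeave μ) :
    IsWeb μ ↔ ∀ᵐ (A : CompactPaths) ∂μ, (A : Set CadlagPath) = web A :=
  ⟨fun h => h.webLaw_eq_self ▸ hμ.ae_eq_web_webLaw, hμ.isWeb_of_ae_eq⟩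

theorem IsWeave.isFlow_iff {μ : Measure CompactPaths} (hμ : IsWeave μ) :
    IsFlow μ ↔ ∀ᵐ (A : CompactPaths) ∂μ, (A : Set CadlagPath) = flow A :=
  ⟨fun h => h.flowLaw_eq_self ▸ hμ.ae_eq_flow_flowLaw, hμ.isFlow_of_ae_eq⟩

theorem IsWeave.isFlow_iff_biInfinite {μ : Measure CompactPaths} (hμ : IsWeave μ) :
    IsFlow μ ↔ ∀ᵐ (A : CompactPaths) ∂μ, (A : Set CadlagPath) ⊆ biInfinite := by
  rw [hμ.isFlow_iff]
  refine eventually_congr (hμ.ae_mem.mono fun A hA => ⟨fun h => ?_, fun h => ?_⟩)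
  · rw [h]
    exact IsDetWeave.flow_subset _
  · exact (isDetWeave_of_mem hA).eq_flow_of_biInfinite h

end

end

/-- The structure of weaves. Here `μ` is the law of the weave `𝒜`.
The first block says that `web` and `flow` are well defined, measurable operations on weaves: every
deterministic weave has a dense set of non-ramified points, `web_D(A)` is the same set for all dense
non-ramified `D ⊆ ℝ²`, and `web(A)` and `flow(A)` are deterministic weaves. -/
theorem theorem2p5 (μ : Measure CompactPaths) (hμ : IsWeave μ) :
    -- (0) `web` and `flow` are well defined, and `web(𝒜)` and `flow(𝒜)` are random variables
    ((∀ A ∈ detWeaves,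
        Dense (nonRamified (A : Set CadlagPath)) ∧
        (∀ D ⊆ nonRamified (A : Set CadlagPath), Dense D →
          webOn D (A : Set CadlagPath) = web A) ∧
        (webMap A : Set CadlagPath) = web A ∧ webMap A ∈ detWeaves ∧
        (flowMap A : Set CadlagPath) = flow A ∧ flowMap A ∈ detWeaves) ∧
      AEMeasurable webMap μ ∧ AEMeasurable flowMap μ) ∧
    -- (1) webs are the fixed points of `web`
    (IsWeb μ ↔ ∀ᵐ (A : CompactPaths) ∂μ, (A : Set CadlagPath) = web A) ∧
    -- (2) flows are the fixed points of `flow`, and the weaves of bi-infinite paths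
    ((IsFlow μ ↔ ∀ᵐ (A : CompactPaths) ∂μ, (A : Set CadlagPath) = flow A) ∧
      (IsFlow μ ↔ ∀ᵐ (A : CompactPaths) ∂μ, (A : Set CadlagPath) ⊆ biInfinite)) ∧
    -- (3) almost surely `web(𝒜) ≼ 𝒜 ≼ flow(𝒜)`
    (∀ᵐ (A : CompactPaths) ∂μ,
      Preceq (web A) (A : Set CadlagPath) ∧ Preceq (A : Set CadlagPath) (flow A)) ∧
    -- (4) the laws of `web(𝒜)` and `flow(𝒜)` are the unique web below and the unique flow above
    ((IsWeb (webLaw μ) ∧ PreceqLaw (webLaw μ) μ ∧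
        ∀ ν, IsWeb ν → PreceqLaw ν μ → ν = webLaw μ) ∧
      (IsFlow (flowLaw μ) ∧ PreceqLaw μ (flowLaw μ) ∧
        ∀ ν, IsFlow ν → PreceqLaw μ ν → ν = flowLaw μ)) ∧
    -- two weaves have the same web in law if and only if they have the same flow in law
    (∀ ν, IsWeave ν → (webLaw ν = webLaw μ ↔ flowLaw ν = flowLaw μ)) ∧
    -- the class of `μ` has a minimum, which is the only web in it
    (webLaw (webLaw μ) = webLaw μ ∧
      (∀ ν, IsWeave ν → webLaw ν = webLaw μ → PreceqLaw (webLaw μ) ν) ∧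
      (∀ ν, IsWeb ν → webLaw ν = webLaw μ → ν = webLaw μ)) ∧
    -- the class of `μ` has a maximum, which is the only flow in it
    (webLaw (flowLaw μ) = webLaw μ ∧
      (∀ ν, IsWeave ν → webLaw ν = webLaw μ → PreceqLaw ν (flowLaw μ)) ∧
      (∀ ν, IsFlow ν → webLaw ν = webLaw μ → ν = flowLaw μ)) := by
  refine ⟨⟨fun A hA => ?_, hμ.aemeasurable_webMap, hμ.aemeasurable_flowMap⟩, hμ.isWeb_iff,
    ⟨hμ.isFlow_iff, hμ.isFlow_iff_biInfinite⟩, ?_, ⟨⟨hμ.isWeb_webLaw, hμ.webLaw_preceqLaw, ?_⟩,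
      hμ.isFlow_flowLaw, hμ.preceqLaw_flowLaw, ?_⟩, fun ν hν => hμ.webLaw_eq_iff hν,
    ⟨hμ.webLaw_webLaw, fun ν hν h => ?_, fun ν hν h => ?_⟩,
    hμ.webLaw_flowLaw, fun ν hν h => ?_, fun ν hν h => ?_⟩
  · have hA' := isDetWeave_of_mem hA
    exact ⟨hA'.dense_nonRamified, fun D hD hD' => hA'.webOn_eq_web hD' hD, coe_webMap hA,
      webMap_mem hA, coe_flowMap hA, flowMap_mem hA⟩
  · filter_upwards [hμ.ae_mem] with A hA
    exact ⟨(isDetWeave_of_mem hA).preceq_web, (isDetWeave_of_mem hA).preceq_flow⟩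
  -- Uniqueness: a web is its own web law, and comparability with `μ` makes that the web law of `μ`.
  · exact fun ν hν h => hν.webLaw_eq_self.symm.trans (hν.1.webLaw_eq hμ h)
  · exact fun ν hν h => hν.flowLaw_eq_self.symm.trans (hμ.flowLaw_eq hν.1 h).symm
  · exact h ▸ hν.webLaw_preceqLaw
  · exact hν.webLaw_eq_self.symm.trans h
  · exact (hμ.webLaw_eq_iff hν).1 h ▸ hν.preceqLaw_flowLaw
  · exact hν.flowLaw_eq_self.symm.trans ((hμ.webLaw_eq_iff hν.1).1 h)
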